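/- For a character $\chi:\mathbb R^*\to\mathbb R^*$ and an $r$-dimensional real vector space $V$ with space of frames $\mathrm{Fr}(V)=\mathrm{Isom}(\mathbb R^r,V)$, let $L_\chi(V)$ be the line of functions $\xi:\mathrm{Fr}(V)\to\mathbb R$ with $\xi(e\cdot A)=\chi(\det A)\,\xi(e)$ for all $A\in GL_r$. The cases $\chi=|\cdot|$, $\chi=\mathrm{id}$, $\chi=\mathrm{sign}$ give the densities $\mathcal D_V$, the volume elements $\mathcal V_V=\Lambda^{\mathrm{top}}V^*$ and the orientation line $\mathfrak o_V$. Pointwise multiplication gives $L_\chi(V)\otimes L_\psi(V)\cong L_{\chi\psi}(V)$, the pairing $(\eta,\xi)\mapsto\eta(e^*)\,\xi(e)$ (for any frame $e$, with dual frame $e^*$) gives $L_\chi(V^*)\cong L_\chi(V)^*$, and a short exact sequence $0\to V\to U\to W\to 0$ induces $L_\chi(U)\cong L_\chi(V)\otimes L_\chi(W)$. Let $\mathcal G$ be a (finite-dimensional) Lie groupoid over $M$ with source $s$, target $t$ and Lie algebroid $A$ ($A_x=\ker d_{1_x}s$), with all $s$-fibres of the same dimension $r$. Put $L_\chi^{\mathrm{tr}}=L_\chi(A^*)\otimes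 L_\chi(TM)$, a smooth line bundle over $M$; thus one has $\mathcal D_A^{\mathrm{tr}}$, $\mathcal V_A^{\mathrm{tr}}$ and $\mathfrak o_A^{\mathrm{tr}}$. For an arrow $g:x\to y$, right translation by $g$ and $ds$ give a short exact sequence $0\to A_y\to T_g\mathcal G\to T_xM\to 0$. These sequences at $g$ and at $g^{-1}$ and the differential of the inversion $T_g\mathcal G\cong T_{g^{-1}}\mathcal G$ induce $$L_\chi(A_y)\otimes L_\chi(T_xM)\cong L_\chi(T_g\mathcal G)\cong L_\chi(T_{g^{-1}}\mathcal G)\cong L_\chi(A_x)\otimes L_\chi(T_yM),$$ hence, by $L_\chi(A^*)\cong L_\chi(A)^*$, a linear map $g_\sharp: L^{\mathrm{tr}}_{\chi,x}\to L^{\mathrm{tr}}_{\chi,y}$. Let $g_*=\chi((-1)^r)\,g_\sharp$ (so $g_*=g_\sharp$ for densities). Then, for the actions $g\mapsto g_*$, the bundles $\mathcal D_A^{\mathrm{tr}}$, $\mathcal V_A^{\mathrm{tr}}$ and $\mathfrak o_A^{\mathrm{tr}}$ are (smooth) representations of $\mathcal G$, and the canonical isomorphisms of smooth line bundles $$\mathcal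 D_A^{\mathrm{tr}}\cong\mathcal V_A^{\mathrm{tr}}\otimes\mathfrak o_A^{\mathrm{tr}},\qquad \mathcal V_A^{\mathrm{tr}}\cong\mathcal D_A^{\mathrm{tr}}\otimes\mathfrak o_A^{\mathrm{tr}},\qquad \mathfrak o_A^{\mathrm{tr}}\otimes\mathfrak o_A^{\mathrm{tr}}\cong M\times\mathbb R,\qquad \mathfrak o_A^{\mathrm{tr}}\cong(\mathfrak o_A^{\mathrm{tr}})^*,$$ all induced by pointwise multiplication of functions of frames, are isomorphisms of representations of $\mathcal G$, where tensor products and duals carry the induced actions and $M\times\mathbb R$ the trivial action. The same four isomorphisms also commute with the maps induced by the $g_\sharp$ (the dual of $g_\sharp$ being $l\mapsto l\circ(g^{-1})_\sharp$). -/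

import Mathlib

open CategoryTheory Bundle Set TopologicalSpace
open scoped Manifold ContDiff TensorProduct Topology

noncomputable section

namespace TransverseBundles

section LinearAlgebra

/-- Frames of an `r`-dimensional real vector space `V`: linear isomorphisms `ℝ^r ≅ V`. -/
abbrev Frame (r : ℕ) (V : Type*) [AddCommGroup V] [Module ℝ V] := (Fin r → ℝ) ≃ₗ[ℝ] V

/-- The general linear group `GL_r`; its product is composition. -/
abbrev GLr (r : ℕ) := (Fin r → ℝ) ≃ₗ[ℝ] (Fin r → ℝ)

/-- `L_δ(V)`: the functions `ξ : Fr(V) → ℝ` with `ξ(e · A) = δ(A) ξ(e)`, where `e · A = e ∘ A`. -/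
def Line {r : ℕ} (δ : GLr r →* ℝˣ) (V : Type*) [AddCommGroup V] [Module ℝ V] :
    Submodule ℝ (Frame r V → ℝ) where
  carrier := {ξ | ∀ (e : Frame r V) (A : GLr r), ξ (A.trans e) = (δ A : ℝ) * ξ e}
  zero_mem' := by intro e A; simp
  add_mem' := by
    intro ξ η hξ hη e A
    simp [hξ e A, hη e A, mul_add]
  smul_mem' := by
    intro c ξ hξ e A
    simp [hξ e A, mul_left_comm]

/-- The character `χ ∘ det` of `GL_r` attached to a multiplicative map `χ` of `ℝ`. -/
def detChar (χ : ℝ →*₀ ℝ) (r : ℕ) : GLr r →* ℝˣ :=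
  (Units.map (χ : ℝ →* ℝ)).comp LinearEquiv.det

theorem detChar_apply (χ : ℝ →*₀ ℝ) {r : ℕ} (A : GLr r) :
    (detChar χ r A : ℝ) = χ (LinearEquiv.det A : ℝ) := rfl

/-- The identity, for which `χ ∘ det = det`. -/
abbrev idChar : ℝ →*₀ ℝ := MonoidWithZeroHom.id ℝ

/-- The sign, for which `χ ∘ det = sign ∘ det`. -/
def signChar : ℝ →*₀ ℝ where
  toFun a := (SignType.sign a : ℝ)
  map_zero' := by simp
  map_one' := by simp
  map_mul' a b := by simp [sign_mul]

/-- The absolute value, for which `χ ∘ det = |det|`. -/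
abbrev absChar : ℝ →*₀ ℝ := absHom

/-- A character of `ℝ^*` that is smooth. -/
class SmoothChar (χ : ℝ →*₀ ℝ) : Prop where
  contDiffOn : ContDiffOn ℝ ∞ χ {0}ᶜ

instance : SmoothChar idChar := ⟨contDiffOn_id⟩

instance : SmoothChar absChar := ⟨by
  intro x hx
  exact (contDiffAt_abs hx).contDiffWithinAt⟩

instance : SmoothChar signChar := ⟨by
  intro x hx
  refine ContDiffAt.contDiffWithinAt ?_
  rcases lt_or_gt_of_ne (show x ≠ 0 from hx) with h | h
  · refine (contDiffAt_const (c := (-1 : ℝ))).congr_of_eventuallyEq ?_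
    filter_upwards [Iio_mem_nhds h] with y hy
    simp [signChar, sign_neg (show y < 0 from hy)]
  · refine (contDiffAt_const (c := (1 : ℝ))).congr_of_eventuallyEq ?_
    filter_upwards [Ioi_mem_nhds h] with y hy
    simp [signChar, sign_pos (show 0 < y from hy)]⟩

instance : SmoothChar 1 := ⟨by
  intro x hx
  refine ContDiffAt.contDiffWithinAt ((contDiffAt_const (c := (1 : ℝ))).congr_of_eventuallyEq ?_)
  filter_upwards [isOpen_compl_singleton.mem_nhds hx] with y hy
  exact MonoidWithZeroHom.one_apply_of_ne_zero hy⟩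

variable {r m n : ℕ} {V W U : Type*} [AddCommGroup V] [Module ℝ V] [AddCommGroup W] [Module ℝ W]
  [AddCommGroup U] [Module ℝ U]

/-- Evaluation on a frame identifies `L_δ(V)` with `ℝ`. -/
def Line.eval (δ : GLr r →* ℝˣ) (e : Frame r V) : Line δ V ≃ₗ[ℝ] ℝ where
  toFun ξ := ξ.1 e
  map_add' _ _ := rfl
  map_smul' _ _ := rfl
  invFun c := ⟨fun e' => (δ (e'.trans e.symm) : ℝ) * c, by
    intro e' A
    have : (A.trans e').trans e.symm = (e'.trans e.symm) * A := rfl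
    simp only [this, map_mul, Units.val_mul]
    ring⟩
  left_inv ξ := by
    ext e'
    have h := ξ.2 e (e'.trans e.symm)
    have h2 : (e'.trans e.symm).trans e = e' := by ext; simp
    rw [h2] at h
    exact h.symm
  right_inv c := by
    have : e.trans e.symm = 1 := by ext; simp
    simp [this]

instance (δ : GLr r →* ℝˣ) : Module.Finite ℝ (Line δ V) := by
  rcases isEmpty_or_nonempty (Frame r V) with h | ⟨⟨e⟩⟩
  · have : Subsingleton (Line δ V) := ⟨fun ξ η => Subtype.ext (funext fun e => isEmptyElim e)⟩
    infer_instance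
  · exact Module.Finite.equiv (Line.eval δ e).symm

/-- Functoriality of `L_δ` for isomorphisms. -/
def Line.map (δ : GLr r →* ℝˣ) (f : V ≃ₗ[ℝ] W) : Line δ V ≃ₗ[ℝ] Line δ W where
  toFun ξ := ⟨fun e => ξ.1 (e.trans f.symm), fun e A => ξ.2 (e.trans f.symm) A⟩
  map_add' _ _ := rfl
  map_smul' _ _ := rfl
  invFun η := ⟨fun e => η.1 (e.trans f), fun e A => η.2 (e.trans f) A⟩
  left_inv ξ := by
    ext e
    show ξ.1 ((e.trans f).trans f.symm) = ξ.1 e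
    exact congrArg _ (by ext; simp)
  right_inv η := by
    ext e
    show η.1 ((e.trans f.symm).trans f) = η.1 e
    exact congrArg _ (by ext; simp)

/-- The dual frame of the dual space. -/
def dualFrame (e : Frame r V) : Frame r (Module.Dual ℝ V) :=
  (Pi.basisFun ℝ (Fin r)).toDualEquiv.trans e.symm.dualMap

theorem dualFrame_apply (e : Frame r V) (c : Fin r → ℝ) (v : V) :
    dualFrame e c v = ∑ i, c i * e.symm v i := by
  simp only [dualFrame, LinearEquiv.trans_apply, LinearEquiv.dualMap_apply,
    Module.Basis.toDualEquiv_apply]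
  simp [Module.Basis.toDual, Module.Basis.constr_apply_fintype]

/-- Pointwise multiplication `L_δ(V) ⊗ L_δ'(V) → L_δδ'(V)`. -/
def Line.mulMap {δ δ' δ'' : GLr r →* ℝˣ} (h : δ * δ' = δ'') :
    Line δ V ⊗[ℝ] Line δ' V →ₗ[ℝ] Line δ'' V :=
  TensorProduct.lift (LinearMap.mk₂ ℝ
    (fun ξ η => (⟨fun e => ξ.1 e * η.1 e, by
      intro e A
      simp only [ξ.2 e A, η.2 e A, ← h, MonoidHom.mul_apply, Units.val_mul]
      ring⟩ : Line δ'' V))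
    (by intros; ext; simp [add_mul]) (by intros; ext; simp [mul_assoc])
    (by intros; ext; simp [mul_add]) (by intros; ext; simp [mul_left_comm]))

theorem Line.mulMap_tmul {δ δ' δ'' : GLr r →* ℝˣ} (h : δ * δ' = δ'') (ξ : Line δ V)
    (η : Line δ' V) (e : Frame r V) : (Line.mulMap h (ξ ⊗ₜ η)).1 e = ξ.1 e * η.1 e := rfl

theorem Line.mulMap_bijective {δ δ' δ'' : GLr r →* ℝˣ} (h : δ * δ' = δ'')
    (hV : Nonempty (Frame r V)) : Function.Bijective (Line.mulMap (V := V) h) := by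
  obtain ⟨e⟩ := hV
  let T := TensorProduct.congr (Line.eval δ e) (Line.eval δ' e) ≪≫ₗ TensorProduct.lid ℝ ℝ
    ≪≫ₗ (Line.eval δ'' e).symm
  have : Line.mulMap (V := V) h = T.toLinearMap := by
    ext ξ η : 3
    apply (Line.eval δ'' e).injective
    simp [T]
    rfl
  rw [this]
  exact T.bijective

/-- The canonical isomorphism `L_δ(V) ⊗ L_δ'(V) ≅ L_δδ'(V)` given by pointwise multiplication. -/
def Line.mulIso {δ δ' δ'' : GLr r →* ℝˣ} (h : δ * δ' = δ'') (hV : Nonempty (Frame r V)) :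
    Line δ V ⊗[ℝ] Line δ' V ≃ₗ[ℝ] Line δ'' V :=
  LinearEquiv.ofBijective (Line.mulMap h) (Line.mulMap_bijective h hV)

/-- The canonical isomorphism of `L_1(V)` (the constant functions of frames) with `ℝ`. -/
def Line.constIso (hV : Nonempty (Frame r V)) : Line (1 : GLr r →* ℝˣ) V ≃ₗ[ℝ] ℝ :=
  Line.eval 1 hV.some

theorem Line.constIso_apply (hV : Nonempty (Frame r V)) (ξ : Line (1 : GLr r →* ℝˣ) V)
    (e : Frame r V) : Line.constIso hV ξ = ξ.1 e := by
  have h := ξ.2 e (hV.some.trans e.symm)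
  have h2 : (hV.some.trans e.symm).trans e = hV.some := by ext; simp
  rw [h2] at h
  exact h.trans (by simp)

theorem det_dualFrame (e e' : Frame r V) :
    LinearEquiv.det ((dualFrame e').trans (dualFrame e).symm) =
      LinearEquiv.det (e.trans e'.symm) := by
  have key : LinearMap.toMatrix' ((dualFrame e').trans (dualFrame e).symm).toLinearMap =
      (LinearMap.toMatrix' (e.trans e'.symm).toLinearMap).transpose := by
    ext j i
    have h : ∀ c, dualFrame e (((dualFrame e').trans (dualFrame e).symm) c) = dualFrame e' c := by
      intro c; simp
    have h1 := LinearMap.congr_fun (h (Pi.single i 1)) (e (Pi.single j 1))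
    rw [dualFrame_apply, dualFrame_apply] at h1
    simpa [LinearMap.toMatrix'_apply, Pi.single_apply] using h1
  ext
  rw [LinearEquiv.coe_det, LinearEquiv.coe_det, ← LinearMap.det_toMatrix', key,
    Matrix.det_transpose, LinearMap.det_toMatrix']

/-- The canonical isomorphism `L_χ(V^*) ≅ L_χ(V)^*`, given by `(η, ξ) ↦ η(e^*) ξ(e)`
for any frame `e`. -/
def Line.dualIso (χ : ℝ →*₀ ℝ) (hV : Nonempty (Frame r V)) :
    Line (detChar χ r) (Module.Dual ℝ V) ≃ₗ[ℝ] Module.Dual ℝ (Line (detChar χ r) V) :=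
  Line.eval _ (dualFrame hV.some) ≪≫ₗ (LinearMap.ringLmapEquivSelf ℝ ℝ ℝ).symm ≪≫ₗ
    (Line.eval _ hV.some).dualMap

theorem Line.eval_change (δ : GLr r →* ℝˣ) (ξ : Line δ V) (e e' : Frame r V) :
    ξ.1 e' = (δ (e'.trans e.symm) : ℝ) * ξ.1 e := by
  have h := ξ.2 e (e'.trans e.symm)
  rwa [show (e'.trans e.symm).trans e = e' by ext; simp] at h

theorem Line.dualIso_apply (χ : ℝ →*₀ ℝ) (hV : Nonempty (Frame r V))
    (η : Line (detChar χ r) (Module.Dual ℝ V)) (ξ : Line (detChar χ r) V) (e : Frame r V) :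
    Line.dualIso χ hV η ξ = η.1 (dualFrame e) * ξ.1 e := by
  have h1 := Line.eval_change _ ξ e hV.some
  have h2 := Line.eval_change _ η (dualFrame hV.some) (dualFrame e)
  have h3 : Line.dualIso χ hV η ξ = η.1 (dualFrame hV.some) * ξ.1 hV.some := by
    simp [Line.dualIso, Line.eval, mul_comm]
  rw [h3, h1, h2]
  simp only [detChar, MonoidHom.comp_apply, det_dualFrame]
  ring

/-- The sequence `0 → V → U → W → 0` given by `i` and `p` is exact. -/
structure ShortExact (i : V →ₗ[ℝ] U) (p : U →ₗ[ℝ] W) : Prop where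
  injective : Function.Injective i
  exact : Function.Exact i p
  surjective : Function.Surjective p

/-- `u` is a frame of the middle term of the sequence `i, p` that is adapted to the frames `e`
and `f` of the outer terms: it consists of the image of `e` followed by a lift of `f`. -/
def IsAdapted (i : V →ₗ[ℝ] U) (p : U →ₗ[ℝ] W) (e : Frame m V) (f : Frame n W)
    (u : Frame (m + n) U) : Prop :=
  (∀ c : Fin m → ℝ, u (Fin.append c 0) = i (e c)) ∧
    ∀ (c : Fin m → ℝ) (d : Fin n → ℝ), p (u (Fin.append c d)) = f d

theorem exists_isAdapted {i : V →ₗ[ℝ] U} {p : U →ₗ[ℝ] W} (h : ShortExact i p)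
    (e : Frame m V) (f : Frame n W) : ∃ u : Frame (m + n) U, IsAdapted i p e f u := by
  obtain ⟨hi, hip, hp⟩ := h
  obtain ⟨g, hg⟩ := LinearMap.exists_rightInverse_of_surjective p (LinearMap.range_eq_top.2 hp)
  have hg' : ∀ w, p (g w) = w := fun w => LinearMap.congr_fun hg w
  have hpi : ∀ v, p (i v) = 0 := fun v => (hip _).2 ⟨v, rfl⟩
  let T : (Fin (m + n) → ℝ) →ₗ[ℝ] U :=
    i ∘ₗ e.toLinearMap ∘ₗ LinearMap.funLeft ℝ ℝ (Fin.castAdd n) +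
      g ∘ₗ f.toLinearMap ∘ₗ LinearMap.funLeft ℝ ℝ (Fin.natAdd m)
  have hT : ∀ c d, T (Fin.append c d) = i (e c) + g (f d) := by
    intro c d
    have h1 : LinearMap.funLeft ℝ ℝ (Fin.castAdd n) (Fin.append c d) = c := by
      ext j; simp [LinearMap.funLeft_apply]
    have h2 : LinearMap.funLeft ℝ ℝ (Fin.natAdd m) (Fin.append c d) = d := by
      ext j; simp [LinearMap.funLeft_apply]
    simp [T, h1, h2]
  have hsplit : ∀ x : Fin (m + n) → ℝ, ∃ c d, x = Fin.append c d := fun x =>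
    ⟨fun j => x (Fin.castAdd n j), fun j => x (Fin.natAdd m j), (Fin.append_castAdd_natAdd).symm⟩
  have hbij : Function.Bijective T := by
    constructor
    · rw [injective_iff_map_eq_zero]
      intro x hx
      obtain ⟨c, d, rfl⟩ := hsplit x
      rw [hT] at hx
      have h1 : f d = 0 := by simpa [hpi, hg'] using congrArg p hx
      have hd : d = 0 := by simpa using h1
      rw [h1, map_zero, add_zero] at hx
      have hc : c = 0 := by
        have := hi (hx.trans (map_zero i).symm)
        simpa using this
      subst hc; subst hd
      ext j
      refine Fin.addCases (fun j => ?_) (fun j => ?_) j <;> simp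
    · intro y
      obtain ⟨v, hv⟩ := (hip (y - g (p y))).1 (by simp [hg'])
      refine ⟨Fin.append (e.symm v) (f.symm (p y)), ?_⟩
      rw [hT]; simp [hv]
  refine ⟨LinearEquiv.ofBijective T hbij, ?_, ?_⟩
  · intro c
    exact (hT c 0).trans (by simp)
  · intro c d
    exact (congrArg p (hT c d)).trans (by simp [hpi, hg'])

theorem det_isAdapted {i : V →ₗ[ℝ] U} {p : U →ₗ[ℝ] W}
    {e e' : Frame m V} {f f' : Frame n W} {u u' : Frame (m + n) U} (hu : IsAdapted i p e f u)
    (hu' : IsAdapted i p e' f' u') :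
    LinearEquiv.det (u'.trans u.symm) =
      LinearEquiv.det (e'.trans e.symm) * LinearEquiv.det (f'.trans f.symm) := by
  have hsplit : ∀ x : Fin (m + n) → ℝ, ∃ c d, x = Fin.append c d := fun x =>
    ⟨fun j => x (Fin.castAdd n j), fun j => x (Fin.natAdd m j), (Fin.append_castAdd_natAdd).symm⟩
  have h1 : ∀ c, (u'.trans u.symm) (Fin.append c 0) = Fin.append ((e'.trans e.symm) c) 0 := by
    intro c
    apply u.injective
    rw [hu.1]
    simp [hu'.1]
  have h2 : ∀ c d, ∃ c', (u'.trans u.symm) (Fin.append c d) =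
      Fin.append c' ((f'.trans f.symm) d) := by
    intro c d
    obtain ⟨c', d', h⟩ := hsplit ((u'.trans u.symm) (Fin.append c d))
    refine ⟨c', ?_⟩
    rw [h]
    congr 1
    apply f.injective
    have := hu.2 c' d'
    rw [← h] at this
    simp only [LinearEquiv.trans_apply, LinearEquiv.apply_symm_apply, hu'.2] at this ⊢
    exact this.symm
  have a1 : ∀ j : Fin m, (Pi.single (Fin.castAdd n j) 1 : Fin (m + n) → ℝ) =
      Fin.append (Pi.single j 1) 0 := by
    intro j; ext k
    refine Fin.addCases (fun k => ?_) (fun k => ?_) k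
    · simp [Pi.single_apply]
    · simp [Pi.single_apply, Fin.ext_iff]; omega
  have a2 : ∀ j : Fin n, (Pi.single (Fin.natAdd m j) 1 : Fin (m + n) → ℝ) =
      Fin.append 0 (Pi.single j 1) := by
    intro j; ext k
    refine Fin.addCases (fun k => ?_) (fun k => ?_) k
    · simp [Pi.single_apply, Fin.ext_iff]; omega
    · simp [Pi.single_apply]
  have key : Matrix.reindex finSumFinEquiv.symm finSumFinEquiv.symm
      (LinearMap.toMatrix' (u'.trans u.symm).toLinearMap) =
      Matrix.fromBlocks (LinearMap.toMatrix' (e'.trans e.symm).toLinearMap)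
        (Matrix.of fun k j => LinearMap.toMatrix' (u'.trans u.symm).toLinearMap
          (Fin.castAdd n k) (Fin.natAdd m j)) 0
        (LinearMap.toMatrix' (f'.trans f.symm).toLinearMap) := by
    ext k j
    rcases k with k | k <;> rcases j with j | j
    · simp only [Matrix.reindex_apply, Matrix.submatrix_apply, Equiv.symm_symm,
        finSumFinEquiv_apply_left, Matrix.fromBlocks_apply₁₁, LinearMap.toMatrix'_apply,
        LinearEquiv.coe_coe]
      rw [a1, h1, Fin.append_left]
    · simp
    · simp only [Matrix.reindex_apply, Matrix.submatrix_apply, Equiv.symm_symm,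
        finSumFinEquiv_apply_left, finSumFinEquiv_apply_right, Matrix.fromBlocks_apply₂₁,
        LinearMap.toMatrix'_apply, LinearEquiv.coe_coe]
      rw [a1, h1, Fin.append_right]; rfl
    · simp only [Matrix.reindex_apply, Matrix.submatrix_apply, Equiv.symm_symm,
        finSumFinEquiv_apply_right, Matrix.fromBlocks_apply₂₂, LinearMap.toMatrix'_apply,
        LinearEquiv.coe_coe]
      obtain ⟨c', h⟩ := h2 0 (Pi.single j 1)
      rw [a2, h, Fin.append_right]
  ext
  rw [Units.val_mul, LinearEquiv.coe_det, LinearEquiv.coe_det, LinearEquiv.coe_det,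
    ← LinearMap.det_toMatrix', ← LinearMap.det_toMatrix', ← LinearMap.det_toMatrix',
    ← Matrix.det_reindex_self finSumFinEquiv.symm, key, Matrix.det_fromBlocks_zero₂₁]

/-- For a short exact sequence `0 → V → U → W → 0`, the induced isomorphism
`L_χ(U) ≅ L_χ(V) ⊗ L_χ(W)`. -/
def Line.exactIso (χ : ℝ →*₀ ℝ) {i : V →ₗ[ℝ] U} {p : U →ₗ[ℝ] W} (h : ShortExact i p)
    (hV : Nonempty (Frame m V)) (hW : Nonempty (Frame n W)) :
    Line (detChar χ (m + n)) U ≃ₗ[ℝ] Line (detChar χ m) V ⊗[ℝ] Line (detChar χ n) W :=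
  Line.eval _ (exists_isAdapted h hV.some hW.some).choose ≪≫ₗ
    (TensorProduct.lid ℝ ℝ).symm ≪≫ₗ
    TensorProduct.congr (Line.eval _ hV.some).symm (Line.eval _ hW.some).symm

theorem Line.exactIso_symm_tmul (χ : ℝ →*₀ ℝ) {i : V →ₗ[ℝ] U} {p : U →ₗ[ℝ] W}
    (h : ShortExact i p) (hV : Nonempty (Frame m V)) (hW : Nonempty (Frame n W)) (α : Line (detChar χ m) V)
    (β : Line (detChar χ n) W) {e : Frame m V} {f : Frame n W} {u : Frame (m + n) U}
    (hu : IsAdapted i p e f u) :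
    ((Line.exactIso χ h hV hW).symm (α ⊗ₜ β)).1 u = α.1 e * β.1 f := by
  have hu0 := (exists_isAdapted h hV.some hW.some).choose_spec
  rw [Line.eval_change _ _ (exists_isAdapted h hV.some hW.some).choose u,
    Line.eval_change _ α hV.some e, Line.eval_change _ β hW.some f]
  simp only [detChar_apply, det_isAdapted hu0 hu, map_mul, Units.val_mul]
  have h3 : ((Line.exactIso χ h hV hW).symm (α ⊗ₜ β)).1
      (exists_isAdapted h hV.some hW.some).choose = α.1 hV.some * β.1 hW.some := by
    have : Line.eval _ (exists_isAdapted h hV.some hW.some).choose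
        ((Line.exactIso χ h hV hW).symm (α ⊗ₜ β)) =
        Line.eval _ hV.some α * Line.eval _ hW.some β := by
      simp [Line.exactIso]
    exact this
  rw [h3]
  ring

/-- From an isomorphism `P ⊗ Q → P' ⊗ Q'` of tensor products of lines, the induced map
`P'^* ⊗ Q → P^* ⊗ Q'`: an element `λ ⊗ q` goes to the element of `P^* ⊗ Q' = Hom(P, Q')`
that sends `p` to the contraction of `φ (p ⊗ q)` with `λ`. -/
def transposeLeft {P Q P' Q' : Type*} [AddCommGroup P] [Module ℝ P] [Module.Finite ℝ P]
    [AddCommGroup Q] [Module ℝ Q] [AddCommGroup P'] [Module ℝ P'] [AddCommGroup Q'] [Module ℝ Q']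
    (φ : P ⊗[ℝ] Q →ₗ[ℝ] P' ⊗[ℝ] Q') :
    Module.Dual ℝ P' ⊗[ℝ] Q →ₗ[ℝ] Module.Dual ℝ P ⊗[ℝ] Q' :=
  (dualTensorHomEquiv ℝ P Q').symm.toLinearMap ∘ₗ
    TensorProduct.lift (LinearMap.mk₂ ℝ
      (fun l q => (TensorProduct.lid ℝ Q').toLinearMap ∘ₗ l.rTensor Q' ∘ₗ φ ∘ₗ
        (TensorProduct.mk ℝ P Q).flip q)
      (by intros; ext; simp [LinearMap.rTensor_add])
      (by intros; ext; simp [LinearMap.rTensor_smul])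
      (by intros; ext; simp)
      (by intros; ext; simp))

section Transport

variable {V' W' U' : Type*} [AddCommGroup V'] [Module ℝ V'] [AddCommGroup W'] [Module ℝ W']
  [AddCommGroup U'] [Module ℝ U']

/-- Given short exact sequences `0 → V → U → W → 0` and `0 → V' → U' → W' → 0` and an isomorphism
`d : U ≅ U'`, the composition `L(V) ⊗ L(W) ≅ L(U) ≅ L(U') ≅ L(V') ⊗ L(W')`. -/
def Line.swapIso (χ : ℝ →*₀ ℝ) {i : V →ₗ[ℝ] U} {p : U →ₗ[ℝ] W} (h : ShortExact i p)
    {i' : V' →ₗ[ℝ] U'} {p' : U' →ₗ[ℝ] W'} (h' : ShortExact i' p') (d : U ≃ₗ[ℝ] U')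
    (hV : Nonempty (Frame m V)) (hW : Nonempty (Frame n W))
    (hV' : Nonempty (Frame m V')) (hW' : Nonempty (Frame n W')) :
    Line (detChar χ m) V ⊗[ℝ] Line (detChar χ n) W ≃ₗ[ℝ]
      Line (detChar χ m) V' ⊗[ℝ] Line (detChar χ n) W' :=
  (Line.exactIso χ h hV hW).symm ≪≫ₗ Line.map _ d ≪≫ₗ Line.exactIso χ h' hV' hW'

/-- The map `L(V'^*) ⊗ L(W) → L(V^*) ⊗ L(W')` induced by `Line.swapIso` and the canonical
isomorphisms `L(V^*) ≅ L(V)^*` and `L(V'^*) ≅ L(V')^*`. -/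
def Line.transport (χ : ℝ →*₀ ℝ) {i : V →ₗ[ℝ] U} {p : U →ₗ[ℝ] W} (h : ShortExact i p)
    {i' : V' →ₗ[ℝ] U'} {p' : U' →ₗ[ℝ] W'} (h' : ShortExact i' p') (d : U ≃ₗ[ℝ] U')
    (hV : Nonempty (Frame m V)) (hW : Nonempty (Frame n W))
    (hV' : Nonempty (Frame m V')) (hW' : Nonempty (Frame n W')) :
    Line (detChar χ m) (Module.Dual ℝ V') ⊗[ℝ] Line (detChar χ n) W →ₗ[ℝ]
      Line (detChar χ m) (Module.Dual ℝ V) ⊗[ℝ] Line (detChar χ n) W' :=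
  (TensorProduct.congr (Line.dualIso χ hV).symm
      (LinearEquiv.refl ℝ (Line (detChar χ n) W'))).toLinearMap ∘ₗ
    transposeLeft (Line.swapIso χ h h' d hV hW hV' hW').toLinearMap ∘ₗ
    (TensorProduct.congr (Line.dualIso χ hV')
      (LinearEquiv.refl ℝ (Line (detChar χ n) W))).toLinearMap

end Transport

end LinearAlgebra
section LineBundles

variable {EM M : Type*} [NormedAddCommGroup EM] [NormedSpace ℝ EM] [TopologicalSpace M]
  [ChartedSpace EM M]

variable (EM M) in
/-- A smooth real line bundle over `M` with prescribed fibres, given by a covering family of local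
trivializations with smooth transition functions. A local trivialization is a pair `(U, φ)` of an
open set and of linear isomorphisms `φ x` of the fibres with `ℝ`; the values of `φ` outside of `U`
are irrelevant. The bundle in the sense of Mathlib is constructed below. -/
structure LineBundle where
  /-- the fibres -/
  Fiber : M → Type*
  [addCommGroup : ∀ x, AddCommGroup (Fiber x)]
  [module : ∀ x, Module ℝ (Fiber x)]
  /-- the local trivializations -/
  triv : Set (Opens M × ∀ x, Fiber x ≃ₗ[ℝ] ℝ)
  exists_mem_triv : ∀ x, ∃ φ ∈ triv, x ∈ φ.1
  contMDiffOn_transition : ∀ φ ∈ triv, ∀ ψ ∈ triv,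
    ContMDiffOn 𝓘(ℝ, EM) 𝓘(ℝ, ℝ) ∞ (fun x => ψ.2 x ((φ.2 x).symm 1))
      ((φ.1 : Set M) ∩ (ψ.1 : Set M))

namespace LineBundle

attribute [instance] LineBundle.addCommGroup LineBundle.module

/-- The fibres carry their canonical topology as finite-dimensional vector spaces. -/
instance (L : LineBundle EM M) (x : M) : TopologicalSpace (L.Fiber x) := moduleTopology ℝ _

instance (L : LineBundle EM M) (x : M) : IsModuleTopology ℝ (L.Fiber x) := ⟨rfl⟩

/-- The map `L|_U → U × ℝ` of a local trivialization. -/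
def pretriv (L : LineBundle EM M) (φ : Opens M × ∀ x, L.Fiber x ≃ₗ[ℝ] ℝ) :
    Pretrivialization ℝ (π ℝ L.Fiber) where
  toFun p := (p.1, φ.2 p.1 p.2)
  invFun q := ⟨q.1, (φ.2 q.1).symm q.2⟩
  source := π ℝ L.Fiber ⁻¹' φ.1
  target := (φ.1 : Set M) ×ˢ univ
  map_source' p hp := ⟨hp, mem_univ _⟩
  map_target' q hq := hq.1
  left_inv' p _ := by simp
  right_inv' q _ := by simp
  open_target := φ.1.isOpen.prod isOpen_univ
  baseSet := φ.1
  open_baseSet := φ.1.isOpen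
  source_eq := rfl
  target_eq := rfl
  proj_toFun _ _ := rfl

theorem pretriv_symm (L : LineBundle EM M) (φ : Opens M × ∀ x, L.Fiber x ≃ₗ[ℝ] ℝ) {x : M}
    (hx : x ∈ φ.1) (v : ℝ) : (L.pretriv φ).symm x v = (φ.2 x).symm v := by
  have h := (L.pretriv φ).symm_apply_apply_mk hx ((φ.2 x).symm v)
  have h2 : ((L.pretriv φ) ⟨x, (φ.2 x).symm v⟩).2 = v := (φ.2 x).apply_symm_apply v
  rwa [h2] at h

/-- The local trivializations as a vector prebundle. -/
def prebundle (L : LineBundle EM M) : VectorPrebundle ℝ ℝ L.Fiber where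
  pretrivializationAtlas := L.pretriv '' L.triv
  pretrivialization_linear' := by
    rintro _ ⟨φ, _, rfl⟩
    exact ⟨fun x _ => (φ.2 x).toLinearMap.isLinear⟩
  pretrivializationAt x := L.pretriv (L.exists_mem_triv x).choose
  mem_base_pretrivializationAt x := (L.exists_mem_triv x).choose_spec.2
  pretrivialization_mem_atlas x := ⟨_, (L.exists_mem_triv x).choose_spec.1, rfl⟩
  exists_coordChange := by
    rintro _ ⟨φ, hφ, rfl⟩ _ ⟨ψ, hψ, rfl⟩
    refine ⟨fun x => (ψ.2 x ((φ.2 x).symm 1)) • ContinuousLinearMap.id ℝ ℝ,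
      (L.contMDiffOn_transition φ hφ ψ hψ).continuousOn.smul continuousOn_const, ?_⟩
    intro x hx v
    rw [pretriv_symm L φ hx.1]
    show ψ.2 x ((φ.2 x).symm 1) * v = ψ.2 x ((φ.2 x).symm v)
    have : v = v • (1 : ℝ) := by simp
    conv_rhs => rw [this, map_smul, map_smul]
    simp [mul_comm]
  totalSpaceMk_isInducing x := by
    let e := (L.exists_mem_triv x).choose.2 x
    have : ContinuousAdd (L.Fiber x) := IsModuleTopology.toContinuousAdd ℝ _
    have h1 : Continuous e := IsModuleTopology.continuous_of_linearMap e.toLinearMap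
    have h2 : Continuous e.symm := IsModuleTopology.continuous_of_linearMap e.symm.toLinearMap
    let h : L.Fiber x ≃ₜ ℝ := ⟨e.toEquiv, h1, h2⟩
    exact (Topology.isInducing_const_prod.2 h.isInducing : Topology.IsInducing fun v => (x, h v))

instance (L : LineBundle EM M) : L.prebundle.IsContMDiff 𝓘(ℝ, EM) ∞ where
  exists_contMDiffCoordChange := by
    rintro _ ⟨φ, hφ, rfl⟩ _ ⟨ψ, hψ, rfl⟩
    refine ⟨fun x => (ψ.2 x ((φ.2 x).symm 1)) • ContinuousLinearMap.id ℝ ℝ,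
      (L.contMDiffOn_transition φ hφ ψ hψ).smul contMDiffOn_const, ?_⟩
    intro x hx v
    rw [pretriv_symm L φ hx.1]
    show ψ.2 x ((φ.2 x).symm 1) * v = ψ.2 x ((φ.2 x).symm v)
    have : v = v • (1 : ℝ) := by simp
    conv_rhs => rw [this, map_smul, map_smul]
    simp [mul_comm]

instance (L : LineBundle EM M) : TopologicalSpace (TotalSpace ℝ L.Fiber) :=
  L.prebundle.totalSpaceTopology

instance (L : LineBundle EM M) : FiberBundle ℝ L.Fiber := L.prebundle.toFiberBundle

instance (L : LineBundle EM M) : VectorBundle ℝ ℝ L.Fiber := L.prebundle.toVectorBundle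

instance (L : LineBundle EM M) : ContMDiffVectorBundle ∞ ℝ L.Fiber 𝓘(ℝ, EM) :=
  L.prebundle.contMDiffVectorBundle 𝓘(ℝ, EM)

variable (EM M) in
/-- The trivial line bundle. -/
def trivial : LineBundle EM M where
  Fiber _ := ℝ
  triv := {(⊤, fun _ => LinearEquiv.refl ℝ ℝ)}
  exists_mem_triv x := ⟨_, rfl, Set.mem_univ x⟩
  contMDiffOn_transition := by
    rintro _ rfl _ rfl
    exact contMDiffOn_const

/-- The tensor product of two line bundles. -/
def tensor (L L' : LineBundle EM M) : LineBundle EM M where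
  Fiber x := L.Fiber x ⊗[ℝ] L'.Fiber x
  triv := {θ | ∃ φ ∈ L.triv, ∃ ψ ∈ L'.triv, θ = (φ.1 ⊓ ψ.1, fun x =>
    TensorProduct.congr (φ.2 x) (ψ.2 x) ≪≫ₗ TensorProduct.lid ℝ ℝ)}
  exists_mem_triv x := by
    obtain ⟨φ, hφ, hx⟩ := L.exists_mem_triv x
    obtain ⟨ψ, hψ, hx'⟩ := L'.exists_mem_triv x
    exact ⟨_, ⟨φ, hφ, ψ, hψ, rfl⟩, hx, hx'⟩
  contMDiffOn_transition := by
    rintro _ ⟨φ, hφ, ψ, hψ, rfl⟩ _ ⟨φ', hφ', ψ', hψ', rfl⟩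
    have s1 : ((φ.1 ⊓ ψ.1 : Opens M) : Set M) ∩ ((φ'.1 ⊓ ψ'.1 : Opens M) : Set M) ⊆
        (φ.1 : Set M) ∩ (φ'.1 : Set M) := fun x hx => ⟨hx.1.1, hx.2.1⟩
    have s2 : ((φ.1 ⊓ ψ.1 : Opens M) : Set M) ∩ ((φ'.1 ⊓ ψ'.1 : Opens M) : Set M) ⊆
        (ψ.1 : Set M) ∩ (ψ'.1 : Set M) := fun x hx => ⟨hx.1.2, hx.2.2⟩
    have h1 := (L.contMDiffOn_transition φ hφ φ' hφ').mono s1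
    have h2 := (L'.contMDiffOn_transition ψ hψ ψ' hψ').mono s2
    refine (h1.mul h2).congr ?_
    intro x _
    simp

/-- The dual of a line bundle. -/
def dual (L : LineBundle EM M) : LineBundle EM M where
  Fiber x := Module.Dual ℝ (L.Fiber x)
  triv := {θ | ∃ φ ∈ L.triv, θ = (φ.1, fun x =>
    (φ.2 x).symm.dualMap ≪≫ₗ LinearMap.ringLmapEquivSelf ℝ ℝ ℝ)}
  exists_mem_triv x := by
    obtain ⟨φ, hφ, hx⟩ := L.exists_mem_triv x
    exact ⟨_, ⟨φ, hφ, rfl⟩, hx⟩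
  contMDiffOn_transition := by
    rintro _ ⟨φ, hφ, rfl⟩ _ ⟨ψ, hψ, rfl⟩
    refine ((L.contMDiffOn_transition ψ hψ φ hφ).mono (fun x hx => ⟨hx.2, hx.1⟩)).congr ?_
    intro x _
    simp

end LineBundle

end LineBundles

section SubmersionFacts

universe u

variable {EN : Type u} {N EB B EM M : Type*} [NormedAddCommGroup EN] [NormedSpace ℝ EN]
  [TopologicalSpace N] [ChartedSpace EN N]
  [NormedAddCommGroup EB] [NormedSpace ℝ EB]
  [TopologicalSpace B] [ChartedSpace EB B]
  [NormedAddCommGroup EM] [NormedSpace ℝ EM] [TopologicalSpace M] [ChartedSpace EM M]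

theorem mdifferentiable_of_mem_maximalAtlas {e : OpenPartialHomeomorph N EN}
    (he : e ∈ IsManifold.maximalAtlas 𝓘(ℝ, EN) ∞ N) :
    e.MDifferentiable 𝓘(ℝ, EN) 𝓘(ℝ, EN) :=
  ⟨(contMDiffOn_of_mem_maximalAtlas he).mdifferentiableOn (by simp),
    (contMDiffOn_symm_of_mem_maximalAtlas he).mdifferentiableOn (by simp)⟩

/-- The local form of a submersion and of its differential. -/
theorem submersion_local {f : N → B} (hf : Manifold.IsSubmersion 𝓘(ℝ, EN) 𝓘(ℝ, EB) ∞ f) (p : N) :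
    ∃ (F : Type u) (_ : NormedAddCommGroup F) (_ : NormedSpace ℝ F) (l : EN ≃L[ℝ] EB × F)
      (e : OpenPartialHomeomorph N EN) (k : EB → B)
      (_ : e ∈ IsManifold.maximalAtlas 𝓘(ℝ, EN) ∞ N), p ∈ e.source ∧
      (∀ z ∈ e.target, f (e.symm z) = k (l z).1) ∧
      ∀ z ∈ e.target, ∃ D : EB ≃L[ℝ] EB, ∀ w : EN,
        (mfderiv 𝓘(ℝ, EN) 𝓘(ℝ, EB) f (e.symm z) (mfderiv 𝓘(ℝ, EN) 𝓘(ℝ, EN) e.symm z w) : EB) =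
          D (l w).1 := by
  have hp := hf.isSubmersionAt p
  have he := mdifferentiable_of_mem_maximalAtlas hp.domChart_mem_maximalAtlas
  have hc := mdifferentiable_of_mem_maximalAtlas hp.codChart_mem_maximalAtlas
  have hw : ∀ z ∈ hp.domChart.target,
      hp.codChart (f (hp.domChart.symm z)) = (hp.equiv z).1 := by
    intro z hz
    have hz2 : z ∈ (hp.domChart.extend 𝓘(ℝ, EN)).target := by simpa using hz
    have := hp.writtenInCharts hz2
    simpa using this
  have hs : ∀ z ∈ hp.domChart.target, f (hp.domChart.symm z) ∈ hp.codChart.source := fun z hz =>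
    hp.source_subset_preimage_source (hp.domChart.map_target hz)
  have hk : ∀ z ∈ hp.domChart.target,
      f (hp.domChart.symm z) = hp.codChart.symm (hp.equiv z).1 := by
    intro z hz
    rw [← hw z hz, hp.codChart.left_inv (hs z hz)]
  refine ⟨hp.complement, inferInstance, inferInstance, hp.equiv, hp.domChart, hp.codChart.symm, hp.domChart_mem_maximalAtlas,
    hp.mem_domChart_source, hk, ?_⟩
  intro z hz
  have hz' : (hp.equiv z).1 ∈ hp.codChart.target := by
    rw [← hw z hz]; exact hp.codChart.map_source (hs z hz)
  refine ⟨hc.symm.mfderiv hz', fun w => ?_⟩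
  have h1 : HasMFDerivAt 𝓘(ℝ, EN) 𝓘(ℝ, EB) (f ∘ hp.domChart.symm) z
      ((mfderiv 𝓘(ℝ, EN) 𝓘(ℝ, EB) f (hp.domChart.symm z)).comp
        (mfderiv 𝓘(ℝ, EN) 𝓘(ℝ, EN) hp.domChart.symm z)) :=
    ((hf.contMDiff.mdifferentiable (by simp) _).hasMFDerivAt).comp z
      ((he.mdifferentiableAt_symm hz).hasMFDerivAt)
  have h2 : HasMFDerivAt 𝓘(ℝ, EN) 𝓘(ℝ, EB)
      (hp.codChart.symm ∘ (fun z => (hp.equiv z).1)) z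
      ((mfderiv 𝓘(ℝ, EB) 𝓘(ℝ, EB) hp.codChart.symm (hp.equiv z).1).comp
        ((ContinuousLinearMap.fst ℝ EB hp.complement).comp
          (hp.equiv : EN →L[ℝ] EB × hp.complement))) :=
    ((hc.mdifferentiableAt_symm hz').hasMFDerivAt).comp z
      ((ContinuousLinearMap.fst ℝ EB hp.complement).comp
          (hp.equiv : EN →L[ℝ] EB × hp.complement)).hasMFDerivAt
  have h3 := h2.congr_of_eventuallyEq (f₁ := f ∘ hp.domChart.symm)
    (by filter_upwards [hp.domChart.open_target.mem_nhds hz] with z' hz' using hk z' hz')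
  exact DFunLike.congr_fun (hasMFDerivAt_unique h1 h3) w

theorem submersion_surjective {f : N → B} (hf : Manifold.IsSubmersion 𝓘(ℝ, EN) 𝓘(ℝ, EB) ∞ f)
    (p : N) : Function.Surjective (mfderiv 𝓘(ℝ, EN) 𝓘(ℝ, EB) f p) := by
  obtain ⟨F, _, _, l, e, k, he, hp, -, h⟩ := submersion_local hf p
  obtain ⟨D, hD⟩ := h _ (e.map_source hp)
  intro v
  rw [e.left_inv hp] at hD
  exact ⟨_, (hD (l.symm (D.symm (v : EB), 0))).trans (by simp; exact D.apply_symm_apply (v : EB))⟩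

theorem submersion_ker {f : N → B} (hf : Manifold.IsSubmersion 𝓘(ℝ, EN) 𝓘(ℝ, EB) ∞ f)
    (p : N) (v : EN) (hv : mfderiv 𝓘(ℝ, EN) 𝓘(ℝ, EB) f p v = 0) :
    ∃ γ : ℝ → N, γ 0 = p ∧ (∀ᶠ τ in 𝓝 0, f (γ τ) = f p) ∧
      HasMFDerivAt 𝓘(ℝ, ℝ) 𝓘(ℝ, EN) γ 0 (ContinuousLinearMap.toSpanSingleton ℝ v) := by
  obtain ⟨F, _, _, l, e, k, he, hp, hk, h⟩ := submersion_local hf p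
  have hm := mdifferentiable_of_mem_maximalAtlas he
  obtain ⟨D, hD⟩ := h _ (e.map_source hp)
  let w : EN := mfderiv 𝓘(ℝ, EN) 𝓘(ℝ, EN) e p v
  have hw : (mfderiv 𝓘(ℝ, EN) 𝓘(ℝ, EN) e.symm (e p) w : EN) = v :=
    DFunLike.congr_fun (hm.symm_comp_deriv hp) v
  have hw2 : (l w).1 = 0 := by
    have h1 := hD w
    rw [hw, e.left_inv hp] at h1
    have h2 : D (l w).1 = 0 := h1.symm.trans hv
    simpa using h2
  have hc : ContinuousAt (fun τ : ℝ => e p + τ • w) 0 := by fun_prop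
  refine ⟨fun τ => e.symm (e p + τ • w), by simp [e.left_inv hp], ?_, ?_⟩
  · have hn : e.target ∈ 𝓝 (e p + (0 : ℝ) • w) := by
      simpa using e.open_target.mem_nhds (e.map_source hp)
    filter_upwards [hc.preimage_mem_nhds hn] with τ hτ
    rw [hk _ hτ]
    have := hk _ (e.map_source hp)
    rw [e.left_inv hp] at this
    rw [this]
    simp [hw2]
  · have h1 : HasMFDerivAt 𝓘(ℝ, ℝ) 𝓘(ℝ, EN) (fun τ : ℝ => e p + τ • w) 0
        (ContinuousLinearMap.toSpanSingleton ℝ w) := by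
      have := ((hasDerivAt_id (0 : ℝ)).smul_const w).const_add (e p)
      rw [one_smul] at this
      exact this.hasFDerivAt.hasMFDerivAt
    have h2 : HasMFDerivAt 𝓘(ℝ, EN) 𝓘(ℝ, EN) e.symm (e p + (0 : ℝ) • w)
        (mfderiv 𝓘(ℝ, EN) 𝓘(ℝ, EN) e.symm (e p)) := by
      rw [zero_smul, add_zero]
      exact (hm.mdifferentiableAt_symm (e.map_source hp)).hasMFDerivAt
    have h3 := h2.comp (0 : ℝ) h1
    have h4 : (mfderiv 𝓘(ℝ, EN) 𝓘(ℝ, EN) e.symm (e p) : EN →L[ℝ] EN).comp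
        (ContinuousLinearMap.toSpanSingleton ℝ w) =
        ContinuousLinearMap.toSpanSingleton ℝ v := by
      ext
      exact (congrArg _ (one_smul ℝ w)).trans (hw.trans (one_smul ℝ v).symm)
    exact h4 ▸ h3

theorem contMDiffOn_chart_field [IsManifold 𝓘(ℝ, EN) ∞ N] {u : M → N} (hu : ContMDiff 𝓘(ℝ, EM) 𝓘(ℝ, EN) ∞ u)
    {e : OpenPartialHomeomorph N EN} (he : e ∈ IsManifold.maximalAtlas 𝓘(ℝ, EN) ∞ N) (w : EN) :
    ContMDiffOn 𝓘(ℝ, EM) (𝓘(ℝ, EN).prod 𝓘(ℝ, EN)) ∞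
      (fun x => (⟨e.symm (e (u x)), mfderiv 𝓘(ℝ, EN) 𝓘(ℝ, EN) e.symm (e (u x)) w⟩ :
        TangentBundle 𝓘(ℝ, EN) N)) (u ⁻¹' e.source) := by
  have h1 := (contMDiffOn_symm_of_mem_maximalAtlas he).contMDiffOn_tangentMapWithin
    (m := ∞) (by simp) e.open_target.uniqueMDiffOn
  have h2 : ContMDiffOn 𝓘(ℝ, EM) 𝓘(ℝ, EN) ∞ (fun x => e (u x)) (u ⁻¹' e.source) :=
    (contMDiffOn_of_mem_maximalAtlas he).comp hu.contMDiffOn (fun x hx => hx)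
  have h3 : ContMDiffOn 𝓘(ℝ, EM) (𝓘(ℝ, EN).prod 𝓘(ℝ, EN)) ∞
      (fun x => (⟨e (u x), w⟩ : TangentBundle 𝓘(ℝ, EN) EN)) (u ⁻¹' e.source) := by
    intro x hx
    rw [contMDiffWithinAt_totalSpace]
    exact ⟨h2 x hx, by simpa using contMDiffWithinAt_const⟩
  refine (h1.comp h3 (fun x hx => e.map_source hx)).congr ?_
  intro x hx
  simp only [Function.comp, tangentMapWithin]
  rw [mfderivWithin_of_isOpen e.open_target (e.map_source hx)]

end SubmersionFacts

section Frames

variable {EM M EN N : Type*} [NormedAddCommGroup EM] [NormedSpace ℝ EM]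
  [TopologicalSpace M] [ChartedSpace EM M]
  [NormedAddCommGroup EN] [NormedSpace ℝ EN]
  [TopologicalSpace N] [ChartedSpace EN N] [IsManifold 𝓘(ℝ, EN) ∞ N]
  {V : M → Type*} [∀ x, AddCommGroup (V x)] [∀ x, Module ℝ (V x)] {r : ℕ}

/-- Let `V` be a family of vector spaces over `M`, embedded by `j` into the pull-back along `u` of
the tangent bundle of `N`. The family of frames `a` is smooth over `U` if its members are smooth
as maps to `TN`. -/
def IsSmoothFrameOn (u : M → N) (j : ∀ x, V x →ₗ[ℝ] TangentSpace 𝓘(ℝ, EN) (u x)) (U : Opens M)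
    (a : ∀ x, Frame r (V x)) : Prop :=
  ∀ c : Fin r → ℝ, ContMDiffOn 𝓘(ℝ, EM) (𝓘(ℝ, EN).prod 𝓘(ℝ, EN)) ∞
    (fun x => (⟨u x, j x (a x c)⟩ : TangentBundle 𝓘(ℝ, EN) N)) U

theorem contMDiffWithinAt_matrix_det {A : M → Matrix (Fin r) (Fin r) ℝ} {s : Set M} {x : M}
    (h : ∀ i k, ContMDiffWithinAt 𝓘(ℝ, EM) 𝓘(ℝ, ℝ) ∞ (fun y => A y i k) s x) :
    ContMDiffWithinAt 𝓘(ℝ, EM) 𝓘(ℝ, ℝ) ∞ (fun y => (A y).det) s x := by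
  simp only [Matrix.det_apply']
  refine contMDiffWithinAt_finsetSum fun σ _ => ?_
  exact contMDiffWithinAt_const.mul (contMDiffWithinAt_finsetProd fun i _ => h _ _)

theorem contMDiffOn_det [FiniteDimensional ℝ EN] {u : M → N}
    {j : ∀ x, V x →ₗ[ℝ] TangentSpace 𝓘(ℝ, EN) (u x)} (hj : ∀ x, Function.Injective (j x))
    {U U' : Opens M} {a b : ∀ x, Frame r (V x)} (ha : IsSmoothFrameOn (EM := EM) u j U a)
    (hb : IsSmoothFrameOn (EM := EM) u j U' b) :
    ContMDiffOn 𝓘(ℝ, EM) 𝓘(ℝ, ℝ) ∞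
      (fun x => (LinearEquiv.det ((a x).trans (b x).symm) : ℝ)) ((U : Set M) ∩ (U' : Set M)) := by
  intro x₀ hx₀
  let t := trivializationAt EN (TangentSpace 𝓘(ℝ, EN)) (u x₀)
  have hmem : u x₀ ∈ t.baseSet := mem_baseSet_trivializationAt _ _ _
  let s : Set M := (U : Set M) ∩ (U' : Set M)
  have hA : ∀ c, ContMDiffWithinAt 𝓘(ℝ, EM) 𝓘(ℝ, EN) ∞
      (fun x => (t ⟨u x, j x (a x c)⟩).2) s x₀ := fun c =>
    (contMDiffWithinAt_totalSpace.1 ((ha c x₀ hx₀.1).mono inter_subset_left)).2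
  have hB : ∀ c, ContMDiffWithinAt 𝓘(ℝ, EM) 𝓘(ℝ, EN) ∞
      (fun x => (t ⟨u x, j x (b x c)⟩).2) s x₀ := fun c =>
    (contMDiffWithinAt_totalSpace.1 ((hb c x₀ hx₀.2).mono inter_subset_right)).2
  have hu : ContinuousWithinAt u s x₀ :=
    (contMDiffWithinAt_totalSpace.1 ((ha 0 x₀ hx₀.1).mono inter_subset_left)).1.continuousWithinAt
  let T : ∀ x, V x →ₗ[ℝ] EN := fun x => t.linearMapAt ℝ (u x) ∘ₗ j x
  have hT : ∀ x, u x ∈ t.baseSet → ∀ v, T x v = (t ⟨u x, j x v⟩).2 := by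
    intro x hx v
    show t.linearMapAt ℝ (u x) (j x v) = _
    rw [t.coe_linearMapAt_of_mem hx]
  have hTinj : Function.Injective (T x₀ ∘ₗ (b x₀).toLinearMap) := by
    have h1 : Function.Injective (t.linearMapAt ℝ (u x₀)) := by
      have h2 : Function.Injective (t.linearEquivAt ℝ (u x₀) hmem) := LinearEquiv.injective _
      intro v w h
      apply h2
      simpa [t.coe_linearMapAt_of_mem hmem] using h
    exact (h1.comp (hj x₀)).comp (b x₀).injective
  obtain ⟨q', hq'⟩ := LinearMap.exists_leftInverse_of_injective _ (LinearMap.ker_eq_bot.2 hTinj)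
  let q : EN →L[ℝ] (Fin r → ℝ) := LinearMap.toContinuousLinearMap q'
  let P : (∀ x, Frame r (V x)) → M → Matrix (Fin r) (Fin r) ℝ := fun a x =>
    LinearMap.toMatrix' (q' ∘ₗ T x ∘ₗ (a x).toLinearMap)
  have hev : ∀ᶠ x in 𝓝[s] x₀, u x ∈ t.baseSet :=
    hu (t.open_baseSet.mem_nhds hmem)
  have hP : ∀ a : ∀ x, Frame r (V x), (∀ c, ContMDiffWithinAt 𝓘(ℝ, EM) 𝓘(ℝ, EN) ∞
      (fun x => (t ⟨u x, j x (a x c)⟩).2) s x₀) →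
      ContMDiffWithinAt 𝓘(ℝ, EM) 𝓘(ℝ, ℝ) ∞ (fun x => (P a x).det) s x₀ := by
    intro a ha
    refine contMDiffWithinAt_matrix_det fun i k => ?_
    let qi : EN →L[ℝ] ℝ := (ContinuousLinearMap.proj i).comp q
    have h1 := (qi.contDiff (n := ∞)).contMDiff.contMDiffAt.comp_contMDiffWithinAt x₀
      (ha (Pi.single k 1))
    refine h1.congr_of_eventuallyEq_of_mem ?_ hx₀
    filter_upwards [hev] with x hx
    simp only [P, LinearMap.toMatrix'_apply, LinearMap.comp_apply, Function.comp]
    rw [hT x hx]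
    rfl
  have hdet : ∀ x, (LinearEquiv.det ((a x).trans (b x).symm) : ℝ) * (P b x).det = (P a x).det := by
    intro x
    simp only [P, LinearMap.det_toMatrix', LinearEquiv.coe_det]
    rw [mul_comm, ← LinearMap.det_comp]
    congr 1
    ext c
    simp
  have hb0 : (P b x₀).det = 1 := by
    simp only [P, LinearMap.det_toMatrix']
    rw [hq', LinearMap.det_id]
  have hcont := (hP b hB).continuousWithinAt
  have hne : ∀ᶠ x in 𝓝[s] x₀, (P b x).det ≠ 0 :=
    hcont.eventually_ne (by simp only [hb0]; exact one_ne_zero)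
  refine ((hP a hA).div₀ (hP b hB) (by rw [hb0]; exact one_ne_zero)).congr_of_eventuallyEq_of_mem ?_ hx₀
  filter_upwards [hne] with x hx
  rw [Pi.div_apply, ← hdet x, mul_div_cancel_right₀ _ hx]

theorem contMDiffOn_char_det [FiniteDimensional ℝ EN] (χ : ℝ →*₀ ℝ) [hχ : SmoothChar χ] {u : M → N}
    {j : ∀ x, V x →ₗ[ℝ] TangentSpace 𝓘(ℝ, EN) (u x)} (hj : ∀ x, Function.Injective (j x))
    {U U' : Opens M} {a b : ∀ x, Frame r (V x)} (ha : IsSmoothFrameOn (EM := EM) u j U a)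
    (hb : IsSmoothFrameOn (EM := EM) u j U' b) :
    ContMDiffOn 𝓘(ℝ, EM) 𝓘(ℝ, ℝ) ∞
      (fun x => χ (LinearEquiv.det ((a x).trans (b x).symm) : ℝ))
      ((U : Set M) ∩ (U' : Set M)) := by
  exact hχ.contDiffOn.contMDiffOn.comp (contMDiffOn_det hj ha hb)
    (fun x _ => Units.ne_zero (LinearEquiv.det ((a x).trans (b x).symm)))

end Frames

section TangentLine

variable {EM M : Type*} [NormedAddCommGroup EM] [NormedSpace ℝ EM] [FiniteDimensional ℝ EM]
  [TopologicalSpace M] [ChartedSpace EM M]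

instance (x : M) : FiniteDimensional ℝ (TangentSpace 𝓘(ℝ, EM) x) :=
  inferInstanceAs (FiniteDimensional ℝ EM)

theorem nonempty_tangentFrame (x : M) :
    Nonempty (Frame (Module.finrank ℝ EM) (TangentSpace 𝓘(ℝ, EM) x)) :=
  ⟨(Module.finBasis ℝ EM).equivFun.symm⟩

variable [IsManifold 𝓘(ℝ, EM) ∞ M]

theorem exists_smoothFrame_tangent (x₀ : M) : ∃ (U : Opens M)
    (a : ∀ x : M, Frame (Module.finrank ℝ EM) (TangentSpace 𝓘(ℝ, EM) x)), x₀ ∈ U ∧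
      IsSmoothFrameOn (EM := EM) id (fun _ => LinearMap.id) U a := by
  classical
  let e := chartAt EM x₀
  have he : e ∈ IsManifold.maximalAtlas 𝓘(ℝ, EM) ∞ M := IsManifold.chart_mem_maximalAtlas x₀
  have hm := mdifferentiable_of_mem_maximalAtlas he
  let b : (Fin (Module.finrank ℝ EM) → ℝ) ≃ₗ[ℝ] EM := (Module.finBasis ℝ EM).equivFun.symm
  have key : ∀ x : M, ∃ a : Frame (Module.finrank ℝ EM) (TangentSpace 𝓘(ℝ, EM) x), x ∈ e.source →
      ∀ c, (a c : EM) = mfderiv 𝓘(ℝ, EM) 𝓘(ℝ, EM) e.symm (e x) (b c) := by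
    intro x
    by_cases hx : x ∈ e.source
    · let D : TangentSpace 𝓘(ℝ, EM) (e x) ≃L[ℝ] TangentSpace 𝓘(ℝ, EM) (e.symm (e x)) :=
        hm.symm.mfderiv (e.map_source hx)
      exact ⟨b.trans D.toLinearEquiv, fun _ c => rfl⟩
    · exact ⟨b, fun h => absurd h hx⟩
  choose a ha using key
  refine ⟨⟨e.source, e.open_source⟩, a, mem_chart_source EM x₀, fun c => ?_⟩
  refine (contMDiffOn_chart_field (u := (id : M → M)) contMDiff_id he (b c)).congr ?_
  intro x hx
  have h1 : e.symm (e x) = x := e.left_inv hx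
  refine TotalSpace.ext h1.symm (heq_of_eq ?_)
  exact ha x hx c

/-- The line bundle `L_χ(TM)`. Its local trivializations are the evaluations on the smooth local
frames of `TM`. -/
def tangentLine (EM M : Type*) [NormedAddCommGroup EM] [NormedSpace ℝ EM] [FiniteDimensional ℝ EM]
    [TopologicalSpace M] [ChartedSpace EM M] [IsManifold 𝓘(ℝ, EM) ∞ M]
    (χ : ℝ →*₀ ℝ) [SmoothChar χ] : LineBundle EM M where
  Fiber x := Line (detChar χ (Module.finrank ℝ EM)) (TangentSpace 𝓘(ℝ, EM) x)
  triv := {θ | ∃ a : ∀ x : M, Frame (Module.finrank ℝ EM) (TangentSpace 𝓘(ℝ, EM) x),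
    IsSmoothFrameOn (EM := EM) id (fun _ => LinearMap.id) θ.1 a ∧
      θ.2 = fun x => Line.eval _ (a x)}
  exists_mem_triv x := by
    obtain ⟨U, a, hx, ha⟩ := exists_smoothFrame_tangent (EM := EM) x
    exact ⟨(U, fun x => Line.eval _ (a x)), ⟨a, ha, rfl⟩, hx⟩
  contMDiffOn_transition := by
    rintro ⟨U, φ⟩ ⟨a, ha, rfl⟩ ⟨U', ψ⟩ ⟨b, hb, rfl⟩
    refine ((contMDiffOn_char_det χ (fun _ => Function.injective_id) hb ha).mono
      (fun x hx => ⟨hx.2, hx.1⟩)).congr ?_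
    intro x _
    exact mul_one _

end TangentLine

section Groupoids

/-- The arrows of a groupoid with set of objects `M`. -/
structure Arrows (M : Type*) [Groupoid M] where
  /-- the source -/
  src : M
  /-- the target -/
  tgt : M
  /-- the arrow from `src` to `tgt` -/
  hom : src ⟶ tgt

namespace Arrows

variable {M : Type*} [Groupoid M]

/-- An arrow `g : x ⟶ y` as an element of the set of all arrows. -/
abbrev of {x y : M} (g : x ⟶ y) : Arrows M := ⟨x, y, g⟩

/-- The unit `1_x`. -/
abbrev unit (x : M) : Arrows M := ⟨x, x, 𝟙 x⟩

/-- The inversion. -/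
abbrev inv (g : Arrows M) : Arrows M := ⟨g.tgt, g.src, Groupoid.inv g.hom⟩

open Classical in
/-- The multiplication `(g, h) ↦ g h`, first `h` and then `g`. It is meaningful if the source of
`g` is the target of `h`; the value is irrelevant otherwise. -/
def mul (g h : Arrows M) : Arrows M :=
  if e : g.src = h.tgt then ⟨h.src, g.tgt, h.hom ≫ eqToHom e.symm ≫ g.hom⟩ else g

theorem mul_of {x y z : M} (g : y ⟶ z) (h : x ⟶ y) : (of g).mul (of h) = of (h ≫ g) := by
  simp [mul]

theorem inv_inv (g : Arrows M) : g.inv.inv = g := by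
  cases g; simp [inv]

theorem mul_of_inv_cancel {x y : M} (g : x ⟶ y) (h : Arrows M) (hh : h.src = y) :
    (h.mul (of g)).mul (of (Groupoid.inv g)) = h := by
  obtain ⟨y', z, h⟩ := h
  obtain rfl : y' = y := hh
  show ((of h).mul (of g)).mul (of (Groupoid.inv g)) = of h
  rw [mul_of, mul_of]
  simp

theorem src_mul (g h : Arrows M) (e : g.src = h.tgt) : (g.mul h).src = h.src := by
  simp [mul, e]

end Arrows

/-- A Lie groupoid over `M`, with space of arrows `Arrows M`: the space of objects and that of
arrows are smooth manifolds, the source is a submersion, and the structure maps are smooth.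
As the source is a submersion, the composable pairs form an embedded submanifold of the product. -/
class LieGroupoid (EM EG M : Type*) [Groupoid M]
    [NormedAddCommGroup EM] [NormedSpace ℝ EM] [NormedAddCommGroup EG] [NormedSpace ℝ EG]
    [TopologicalSpace M] [ChartedSpace EM M] [IsManifold 𝓘(ℝ, EM) ∞ M]
    [TopologicalSpace (Arrows M)] [ChartedSpace EG (Arrows M)]
    [IsManifold 𝓘(ℝ, EG) ∞ (Arrows M)] : Prop where
  isSubmersion_src : Manifold.IsSubmersion 𝓘(ℝ, EG) 𝓘(ℝ, EM) ∞ (Arrows.src : Arrows M → M)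
  contMDiff_tgt : ContMDiff 𝓘(ℝ, EG) 𝓘(ℝ, EM) ∞ (Arrows.tgt : Arrows M → M)
  contMDiff_unit : ContMDiff 𝓘(ℝ, EM) 𝓘(ℝ, EG) ∞ (Arrows.unit : M → Arrows M)
  contMDiff_inv : ContMDiff 𝓘(ℝ, EG) 𝓘(ℝ, EG) ∞ (Arrows.inv : Arrows M → Arrows M)
  contMDiffOn_mul : ContMDiffOn (𝓘(ℝ, EG).prod 𝓘(ℝ, EG)) 𝓘(ℝ, EG) ∞
    (fun p : Arrows M × Arrows M => p.1.mul p.2) {p | p.1.src = p.2.tgt}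

variable (EM EG : Type*) {M : Type*} [Groupoid M]
    [NormedAddCommGroup EM] [NormedSpace ℝ EM] [NormedAddCommGroup EG] [NormedSpace ℝ EG]
    [TopologicalSpace M] [ChartedSpace EM M]
    [TopologicalSpace (Arrows M)] [ChartedSpace EG (Arrows M)]

section Rank

/-- The rank of the Lie algebroid, which is the dimension of the source fibres. -/
def algRank (EM EG : Type*) [NormedAddCommGroup EM] [NormedSpace ℝ EM] [NormedAddCommGroup EG]
    [NormedSpace ℝ EG] : ℕ := Module.finrank ℝ EG - Module.finrank ℝ EM

end Rank

/-- The fibre at `x` of the Lie algebroid: the kernel of `ds` at the unit `1_x`. -/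
def algFiber (x : M) : Submodule ℝ (TangentSpace 𝓘(ℝ, EG) (Arrows.unit x)) :=
  LinearMap.ker (mfderiv 𝓘(ℝ, EG) 𝓘(ℝ, EM) Arrows.src (Arrows.unit x)).toLinearMap

/-- The map `A_y → T_g 𝒢` for an arrow `g : x ⟶ y`: the restriction to the tangent space
`A_y` of the source fibre at `1_y` of the differential of the right translation `h ↦ h g`, which is
defined on the source fibre of `y`. -/
def rightTranslation {x y : M} (g : x ⟶ y) :
    algFiber EM EG y →ₗ[ℝ] TangentSpace 𝓘(ℝ, EG) (Arrows.of g) :=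
  let D : EG →L[ℝ] EG := mfderivWithin 𝓘(ℝ, EG) 𝓘(ℝ, EG) (fun h : Arrows M => h.mul (Arrows.of g))
    (Arrows.src ⁻¹' {y}) (Arrows.unit y)
  D.toLinearMap ∘ₗ (algFiber EM EG y).subtype

/-- The map `ds : T_g 𝒢 → T_x M` for an arrow `g : x ⟶ y`. -/
def dsrc {x y : M} (g : x ⟶ y) :
    TangentSpace 𝓘(ℝ, EG) (Arrows.of g) →ₗ[ℝ] TangentSpace 𝓘(ℝ, EM) x :=
  (mfderiv 𝓘(ℝ, EG) 𝓘(ℝ, EM) Arrows.src (Arrows.of g)).toLinearMap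

variable [IsManifold 𝓘(ℝ, EM) ∞ M] [IsManifold 𝓘(ℝ, EG) ∞ (Arrows M)]

variable {EM EG} in
theorem mdifferentiableWithinAt_mul (hG : LieGroupoid EM EG M) {x y : M} (g : x ⟶ y) (p : Arrows M) (hp : p.src = y) :
    MDifferentiableWithinAt 𝓘(ℝ, EG) 𝓘(ℝ, EG) (fun h : Arrows M => h.mul (Arrows.of g))
      (Arrows.src ⁻¹' {y}) p := by
  have h1 : ContMDiffOn 𝓘(ℝ, EG) (𝓘(ℝ, EG).prod 𝓘(ℝ, EG)) ∞
      (fun h : Arrows M => (h, Arrows.of g)) (Arrows.src ⁻¹' {y}) :=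
    (contMDiff_id.prodMk contMDiff_const).contMDiffOn
  exact ((hG.contMDiffOn_mul.comp h1 (fun h hh => hh)) p hp).mdifferentiableWithinAt (by simp)

theorem dinv_bijective [FiniteDimensional ℝ EG] (hG : LieGroupoid EM EG M) (g : Arrows M) :
    Function.Bijective (mfderiv 𝓘(ℝ, EG) 𝓘(ℝ, EG) Arrows.inv g) := by
  let D : EG →L[ℝ] EG := mfderiv 𝓘(ℝ, EG) 𝓘(ℝ, EG) Arrows.inv g
  let D' : EG →L[ℝ] EG := mfderiv 𝓘(ℝ, EG) 𝓘(ℝ, EG) Arrows.inv g.inv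
  have hd : MDifferentiable 𝓘(ℝ, EG) 𝓘(ℝ, EG) (Arrows.inv : Arrows M → Arrows M) :=
    hG.contMDiff_inv.mdifferentiable (by simp)
  have h1 : HasMFDerivAt 𝓘(ℝ, EG) 𝓘(ℝ, EG) (Arrows.inv ∘ Arrows.inv) g (D'.comp D) :=
    (hd g.inv).hasMFDerivAt.comp g (hd g).hasMFDerivAt
  have h2 : (Arrows.inv ∘ Arrows.inv : Arrows M → Arrows M) = id := funext Arrows.inv_inv
  rw [h2] at h1
  have h3 : ∀ v : EG, D' (D v) = v := fun v =>
    DFunLike.congr_fun (hasMFDerivAt_unique h1 (hasMFDerivAt_id g)) v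
  have h4 : Function.Injective D.toLinearMap := fun v w h => by
    rw [← h3 v, ← h3 w]; exact congrArg D' h
  exact ⟨h4, LinearMap.surjective_of_injective h4⟩

variable [hG : LieGroupoid EM EG M]

theorem dsrc_surjective {x y : M} (g : x ⟶ y) : Function.Surjective (dsrc EM EG g) :=
  submersion_surjective hG.isSubmersion_src (Arrows.of g)

theorem finrank_ker_dsrc [FiniteDimensional ℝ EG] {x y : M} (g : x ⟶ y) :
    Module.finrank ℝ (LinearMap.ker (dsrc EM EG g)) = algRank EM EG := by
  have : FiniteDimensional ℝ (TangentSpace 𝓘(ℝ, EG) (Arrows.of g)) :=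
    inferInstanceAs (FiniteDimensional ℝ EG)
  have h := LinearMap.finrank_range_add_finrank_ker (dsrc EM EG g)
  rw [LinearMap.range_eq_top.2 (dsrc_surjective EM EG g), finrank_top] at h
  change Module.finrank ℝ EM + _ = Module.finrank ℝ EG at h
  unfold algRank
  omega

theorem rightTranslation_spec {x y : M} (g : x ⟶ y) :
    Function.Injective (rightTranslation EM EG g) ∧
      ∀ v, dsrc EM EG g (rightTranslation EM EG g v) = 0 := by
  let f : Arrows M → Arrows M := fun h => h.mul (Arrows.of g)
  let f' : Arrows M → Arrows M := fun h => h.mul (Arrows.of (Groupoid.inv g))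
  let s : Set (Arrows M) := Arrows.src ⁻¹' {y}
  let s' : Set (Arrows M) := Arrows.src ⁻¹' {x}
  have hf0 : f (Arrows.unit y) = Arrows.of g := by
    have := Arrows.mul_of (𝟙 y) g
    simpa using this
  have hfs : ∀ h ∈ s, f h ∈ s' := fun h hh => Arrows.src_mul _ _ hh
  let D : EG →L[ℝ] EG := mfderivWithin 𝓘(ℝ, EG) 𝓘(ℝ, EG) f s (Arrows.unit y)
  let D' : EG →L[ℝ] EG := mfderivWithin 𝓘(ℝ, EG) 𝓘(ℝ, EG) f' s' (f (Arrows.unit y))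
  have h1 : HasMFDerivWithinAt 𝓘(ℝ, EG) 𝓘(ℝ, EG) f s (Arrows.unit y) D :=
    (mdifferentiableWithinAt_mul hG g (Arrows.unit y) rfl).hasMFDerivWithinAt
  have h2 : HasMFDerivWithinAt 𝓘(ℝ, EG) 𝓘(ℝ, EG) f' s' (f (Arrows.unit y)) D' :=
    (mdifferentiableWithinAt_mul hG (Groupoid.inv g) (f (Arrows.unit y))
      (hfs _ rfl)).hasMFDerivWithinAt
  let S : EG →L[ℝ] EM := mfderiv 𝓘(ℝ, EG) 𝓘(ℝ, EM) Arrows.src (Arrows.of g)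
  have h3 : HasMFDerivAt 𝓘(ℝ, EG) 𝓘(ℝ, EM) Arrows.src (f (Arrows.unit y)) S := by
    rw [hf0]
    exact (hG.isSubmersion_src.contMDiff.mdifferentiable (by simp) _).hasMFDerivAt
  have key : ∀ v : EG, mfderiv 𝓘(ℝ, EG) 𝓘(ℝ, EM) Arrows.src (Arrows.unit y) v = 0 →
      D' (D v) = v ∧ S (D v) = 0 := by
    intro v hv
    obtain ⟨γ, hγ0, hγs, hγ⟩ := submersion_ker hG.isSubmersion_src (Arrows.unit y) v hv
    have hmem : γ ⁻¹' s ∈ 𝓝 (0 : ℝ) := hγs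
    have h1' : HasMFDerivWithinAt 𝓘(ℝ, EG) 𝓘(ℝ, EG) f s (γ 0) D := by rw [hγ0]; exact h1
    have h2' : HasMFDerivWithinAt 𝓘(ℝ, EG) 𝓘(ℝ, EG) f' s' ((f ∘ γ) 0) D' := by
      show HasMFDerivWithinAt 𝓘(ℝ, EG) 𝓘(ℝ, EG) f' s' (f (γ 0)) D'
      rw [hγ0]; exact h2
    have h3' : HasMFDerivAt 𝓘(ℝ, EG) 𝓘(ℝ, EM) Arrows.src ((f ∘ γ) 0) S := by
      show HasMFDerivAt 𝓘(ℝ, EG) 𝓘(ℝ, EM) Arrows.src (f (γ 0)) S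
      rw [hγ0]; exact h3
    have a1 : HasMFDerivWithinAt 𝓘(ℝ, ℝ) 𝓘(ℝ, EG) (f ∘ γ) (γ ⁻¹' s) 0
        (D.comp (ContinuousLinearMap.toSpanSingleton ℝ v)) :=
      h1'.comp 0 hγ.hasMFDerivWithinAt subset_rfl
    have a2 : HasMFDerivWithinAt 𝓘(ℝ, ℝ) 𝓘(ℝ, EG) (f' ∘ (f ∘ γ)) (γ ⁻¹' s) 0
        (D'.comp (D.comp (ContinuousLinearMap.toSpanSingleton ℝ v))) :=
      h2'.comp 0 a1 (fun τ hτ => hfs _ hτ)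
    have a3 : HasMFDerivAt 𝓘(ℝ, ℝ) 𝓘(ℝ, EM) (Arrows.src ∘ (f ∘ γ)) 0
        (S.comp (D.comp (ContinuousLinearMap.toSpanSingleton ℝ v))) :=
      h3'.comp 0 (a1.hasMFDerivAt hmem)
    have e1 : f' ∘ (f ∘ γ) =ᶠ[𝓝 0] γ := by
      filter_upwards [hmem] with τ hτ using Arrows.mul_of_inv_cancel g (γ τ) hτ
    have e2 : Arrows.src ∘ (f ∘ γ) =ᶠ[𝓝 0] fun _ => x := by
      filter_upwards [hmem] with τ hτ using hfs _ hτ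
    constructor
    · have := hasMFDerivAt_unique ((a2.hasMFDerivAt hmem).congr_of_eventuallyEq e1.symm) hγ
      have h4 := DFunLike.congr_fun this (1 : ℝ)
      have h5 : D' (D ((1 : ℝ) • v)) = (1 : ℝ) • v := h4
      simpa using h5
    · have := hasMFDerivAt_unique (a3.congr_of_eventuallyEq e2.symm)
        (hasMFDerivAt_const (I := 𝓘(ℝ, ℝ)) (I' := 𝓘(ℝ, EM)) x (0 : ℝ))
      have h4 := DFunLike.congr_fun this (1 : ℝ)
      have h5 : S (D ((1 : ℝ) • v)) = 0 := h4
      simpa using h5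
  refine ⟨fun v w h => Subtype.ext ?_, fun v => (key v.1 v.2).2⟩
  have h4 : D v.1 = D w.1 := h
  rw [← (key v.1 v.2).1, h4, (key w.1 w.2).1]

theorem nonempty_algFrame [FiniteDimensional ℝ EG] (x : M) :
    Nonempty (Frame (algRank EM EG) (algFiber EM EG x)) := by
  have : FiniteDimensional ℝ (TangentSpace 𝓘(ℝ, EG) (Arrows.unit x)) :=
    inferInstanceAs (FiniteDimensional ℝ EG)
  have h : Module.finrank ℝ (algFiber EM EG x) = algRank EM EG := finrank_ker_dsrc EM EG (𝟙 x)
  exact ⟨(Module.finBasisOfFinrankEq ℝ _ h).equivFun.symm⟩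

theorem exact_rightTranslation [FiniteDimensional ℝ EG] {x y : M} (g : x ⟶ y) :
    Function.Exact (rightTranslation EM EG g) (dsrc EM EG g) := by
  have : FiniteDimensional ℝ (TangentSpace 𝓘(ℝ, EG) (Arrows.of g)) :=
    inferInstanceAs (FiniteDimensional ℝ EG)
  obtain ⟨h1, h2⟩ := rightTranslation_spec EM EG g
  rw [LinearMap.exact_iff]
  symm
  refine Submodule.eq_of_le_of_finrank_eq ?_ ?_
  · rintro _ ⟨v, rfl⟩
    exact h2 v
  · rw [LinearMap.finrank_range_of_inj h1, finrank_ker_dsrc]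
    exact finrank_ker_dsrc EM EG (𝟙 y)

/-- The short exact sequence `0 → A_y → T_g 𝒢 → T_x M → 0` of an arrow `g : x ⟶ y`. -/
theorem shortExact_arrow [FiniteDimensional ℝ EG] {x y : M} (g : x ⟶ y) :
    ShortExact (rightTranslation EM EG g) (dsrc EM EG g) :=
  ⟨(rightTranslation_spec EM EG g).1, exact_rightTranslation EM EG g, dsrc_surjective EM EG g⟩

/-- The isomorphism `T_g 𝒢 ≅ T_{g⁻¹} 𝒢` given by the differential of the inversion. -/
def dinv [FiniteDimensional ℝ EG] {x y : M} (g : x ⟶ y) :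
    TangentSpace 𝓘(ℝ, EG) (Arrows.of g) ≃ₗ[ℝ]
      TangentSpace 𝓘(ℝ, EG) (Arrows.of (Groupoid.inv g)) :=
  LinearEquiv.ofBijective
    (mfderiv 𝓘(ℝ, EG) 𝓘(ℝ, EG) Arrows.inv (Arrows.of g)).toLinearMap (dinv_bijective EM EG hG _)

variable [FiniteDimensional ℝ EM] [FiniteDimensional ℝ EG]

theorem exists_smoothFrame_alg (x₀ : M) : ∃ (U : Opens M)
    (a : ∀ x : M, Frame (algRank EM EG) (algFiber EM EG x)), x₀ ∈ U ∧
      IsSmoothFrameOn (EM := EM) Arrows.unit (fun x => (algFiber EM EG x).subtype) U a := by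
  obtain ⟨F, _, _, l, e, k, he, hp, -, hD⟩ :=
    submersion_local hG.isSubmersion_src (Arrows.unit x₀)
  have hm := mdifferentiable_of_mem_maximalAtlas he
  have : FiniteDimensional ℝ (EM × F) := Module.Finite.equiv l.toLinearEquiv
  have : FiniteDimensional ℝ F :=
    Module.Finite.of_surjective (LinearMap.snd ℝ EM F) LinearMap.snd_surjective
  have hF : Module.finrank ℝ F = algRank EM EG := by
    have := l.toLinearEquiv.finrank_eq
    rw [Module.finrank_prod] at this
    unfold algRank
    omega
  let b : (Fin (algRank EM EG) → ℝ) ≃ₗ[ℝ] F := (Module.finBasisOfFinrankEq ℝ F hF).equivFun.symm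
  have key : ∀ x : M, ∃ a : Frame (algRank EM EG) (algFiber EM EG x),
      Arrows.unit x ∈ e.source → ∀ c, ((a c).1 : EG) =
        mfderiv 𝓘(ℝ, EG) 𝓘(ℝ, EG) e.symm (e (Arrows.unit x)) (l.symm (0, b c)) := by
    intro x
    by_cases hx : Arrows.unit x ∈ e.source
    · have hz := e.map_source hx
      obtain ⟨D, hD⟩ := hD _ hz
      rw [e.left_inv hx] at hD
      let Φ : EG →L[ℝ] EG := mfderiv 𝓘(ℝ, EG) 𝓘(ℝ, EG) e.symm (e (Arrows.unit x))
      have hΦ : Function.Injective Φ := (hm.symm.mfderiv hz).injective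
      let T : (Fin (algRank EM EG) → ℝ) →ₗ[ℝ] EG :=
        Φ.toLinearMap ∘ₗ l.symm.toLinearEquiv.toLinearMap ∘ₗ LinearMap.inr ℝ EM F ∘ₗ b.toLinearMap
      have hT : Function.Injective T := by
        have h1 : Function.Injective fun c => ((0 : EM), b c) := fun c d h =>
          b.injective (congrArg Prod.snd h)
        exact hΦ.comp (l.symm.injective.comp h1)
      have hmem : ∀ c, T c ∈ algFiber EM EG x := by
        intro c
        have h1 : (l (l.symm (0, b c))).1 = 0 := by simp
        have h2 := hD (l.symm (0, b c))
        rw [h1] at h2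
        have h3 : D 0 = 0 := map_zero D
        exact h2.trans h3
      let T' : (Fin (algRank EM EG) → ℝ) →ₗ[ℝ] algFiber EM EG x :=
        LinearMap.codRestrict (M₂ := TangentSpace 𝓘(ℝ, EG) (Arrows.unit x)) _ T hmem
      have hT' : Function.Injective T' := fun c d h => hT (congrArg Subtype.val h)
      have hd : Module.finrank ℝ (algFiber EM EG x) = algRank EM EG :=
        finrank_ker_dsrc EM EG (𝟙 x)
      have : FiniteDimensional ℝ (TangentSpace 𝓘(ℝ, EG) (Arrows.unit x)) :=
        inferInstanceAs (FiniteDimensional ℝ EG)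
      exact ⟨LinearEquiv.ofBijective T' ⟨hT',
        (LinearMap.injective_iff_surjective_of_finrank_eq_finrank (by simp [hd])).1 hT'⟩,
        fun _ c => rfl⟩
    · exact ⟨(nonempty_algFrame EM EG x).some, fun h => absurd h hx⟩
  choose a ha using key
  refine ⟨⟨Arrows.unit ⁻¹' e.source, e.open_source.preimage hG.contMDiff_unit.continuous⟩, a, hp,
    fun c => ?_⟩
  refine (contMDiffOn_chart_field hG.contMDiff_unit he (l.symm (0, b c))).congr ?_
  intro x hx
  refine TotalSpace.ext (e.left_inv hx).symm (heq_of_eq ?_)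
  exact ha x hx c

/-- The line bundle `L_χ(A^*)`. Its local trivializations are the evaluations on the dual frames
of the smooth local frames of `A`, a section of `A` being smooth if it is smooth as a map to the
tangent bundle of the space of arrows. -/
def dualAlgLine (χ : ℝ →*₀ ℝ) [SmoothChar χ] : LineBundle EM M where
  Fiber x := Line (detChar χ (algRank EM EG)) (Module.Dual ℝ (algFiber EM EG x))
  triv := {θ | ∃ a : ∀ x : M, Frame (algRank EM EG) (algFiber EM EG x),
    IsSmoothFrameOn (EM := EM) Arrows.unit (fun x => (algFiber EM EG x).subtype) θ.1 a ∧
      θ.2 = fun x => Line.eval _ (dualFrame (a x))}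
  exists_mem_triv x := by
    obtain ⟨U, a, hx, ha⟩ := exists_smoothFrame_alg EM EG x
    exact ⟨(U, fun x => Line.eval _ (dualFrame (a x))), ⟨a, ha, rfl⟩, hx⟩
  contMDiffOn_transition := by
    rintro ⟨U, φ⟩ ⟨a, ha, rfl⟩ ⟨U', ψ⟩ ⟨b, hb, rfl⟩
    refine (contMDiffOn_char_det χ (fun _ => Subtype.val_injective) ha hb).congr ?_
    intro x _
    refine (mul_one _).trans ?_
    rw [detChar_apply, det_dualFrame]

/-- The bundle `L_χ^tr = L_χ(A^*) ⊗ L_χ(TM)`. -/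
def trLine (χ : ℝ →*₀ ℝ) [SmoothChar χ] : LineBundle EM M :=
  (dualAlgLine EM EG χ).tensor (tangentLine EM M χ)

/-- For `g : x ⟶ y`, the map `L_χ(A_x^*) ⊗ L_χ(T_x M) → L_χ(A_y^*) ⊗ L_χ(T_y M)` induced by
`L_χ(A_y) ⊗ L_χ(T_x M) ≅ L_χ(T_g 𝒢) ≅ L_χ(T_{g⁻¹} 𝒢) ≅ L_χ(A_x) ⊗ L_χ(T_y M)`, where the middle
isomorphism is given by the differential of the inversion and the outer ones by the short exact
sequences `0 → A_y → T_g 𝒢 → T_x M → 0` and `0 → A_x → T_{g⁻¹} 𝒢 → T_y M → 0`. -/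
def rawAction (χ : ℝ →*₀ ℝ) [SmoothChar χ] (x y : M) (g : x ⟶ y) :
    (trLine EM EG χ : LineBundle EM M).Fiber x →ₗ[ℝ] (trLine EM EG χ : LineBundle EM M).Fiber y :=
  Line.transport χ (shortExact_arrow EM EG g) (shortExact_arrow EM EG (Groupoid.inv g))
    (dinv EM EG g) (nonempty_algFrame EM EG y) (nonempty_tangentFrame x)
    (nonempty_algFrame EM EG x) (nonempty_tangentFrame y)

/-- The canonical action of the groupoid on `L_χ^tr`. The differential of the inversion at a unit
is the identity on the tangent space of the objects and `-1` on the quotient `A`; the factor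
`χ((-1)^r)`, `r` being the rank of `A`, makes the units act by the identity. It is `1` in the case
of densities. -/
def trAction (χ : ℝ →*₀ ℝ) [SmoothChar χ] (x y : M) (g : x ⟶ y) :
    (trLine EM EG χ : LineBundle EM M).Fiber x →ₗ[ℝ] (trLine EM EG χ : LineBundle EM M).Fiber y :=
  χ ((-1) ^ algRank EM EG) • rawAction EM EG χ x y g

theorem trAction_absChar (x y : M) (g : x ⟶ y) :
    trAction EM EG absChar x y g = rawAction EM EG absChar x y g := by
  have : absChar ((-1) ^ algRank EM EG) = 1 := by
    show |(-1 : ℝ) ^ algRank EM EG| = 1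
    simp
  rw [trAction, this, one_smul]

end Groupoids

section Representations

variable {EM EG M : Type*} [Groupoid M]
    [NormedAddCommGroup EM] [NormedSpace ℝ EM] [NormedAddCommGroup EG] [NormedSpace ℝ EG]
    [TopologicalSpace M] [ChartedSpace EM M]
    [TopologicalSpace (Arrows M)] [ChartedSpace EG (Arrows M)]

/-- The candidates for representations of a groupoid on a line bundle: families of linear maps
`g_* : L_x → L_y`, one for each arrow `g : x ⟶ y`. -/
abbrev ArrowMaps (L : LineBundle EM M) := ∀ x y : M, (x ⟶ y) → (L.Fiber x →ₗ[ℝ] L.Fiber y)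

/-- The tensor product action. -/
def ArrowMaps.tensor {L L' : LineBundle EM M} (ρ : ArrowMaps L) (ρ' : ArrowMaps L') :
    ArrowMaps (L.tensor L') :=
  fun x y g => TensorProduct.map (ρ x y g) (ρ' x y g)

/-- The dual action, `g · l = l ∘ (g⁻¹)_*`. -/
def ArrowMaps.dual {L : LineBundle EM M} (ρ : ArrowMaps L) : ArrowMaps L.dual :=
  fun x y g => (ρ y x (Groupoid.inv g)).dualMap

variable (EM M) in
/-- The trivial action on the trivial line bundle. -/
def ArrowMaps.trivial : ArrowMaps (LineBundle.trivial EM M) := fun _ _ _ => LinearMap.id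

/-- The linear isomorphisms `Φ` of the fibres commute with the maps `ρ` and `ρ'`. -/
def Intertwines {L L' : LineBundle EM M} (ρ : ArrowMaps L) (ρ' : ArrowMaps L')
    (Φ : ∀ x, L.Fiber x ≃ₗ[ℝ] L'.Fiber x) : Prop :=
  ∀ (x y : M) (g : x ⟶ y) (v : L.Fiber x), Φ y (ρ x y g v) = ρ' x y g (Φ x v)

/-- The linear isomorphisms `Φ` of the fibres form an isomorphism of smooth line bundles. -/
structure IsBundleIso {L L' : LineBundle EM M} (Φ : ∀ x, L.Fiber x ≃ₗ[ℝ] L'.Fiber x) : Prop where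
  contMDiff : ContMDiff (𝓘(ℝ, EM).prod 𝓘(ℝ, ℝ)) (𝓘(ℝ, EM).prod 𝓘(ℝ, ℝ)) ∞
    (fun p : TotalSpace ℝ L.Fiber => (⟨p.1, Φ p.1 p.2⟩ : TotalSpace ℝ L'.Fiber))
  contMDiff_symm : ContMDiff (𝓘(ℝ, EM).prod 𝓘(ℝ, ℝ)) (𝓘(ℝ, EM).prod 𝓘(ℝ, ℝ)) ∞
    (fun p : TotalSpace ℝ L'.Fiber => (⟨p.1, (Φ p.1).symm p.2⟩ : TotalSpace ℝ L.Fiber))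

variable [IsManifold 𝓘(ℝ, EM) ∞ M] [IsManifold 𝓘(ℝ, EG) ∞ (Arrows M)]

/-- The source as a continuous map. -/
def srcMap (hG : LieGroupoid EM EG M) : C(Arrows M, M) :=
  ⟨Arrows.src, hG.isSubmersion_src.contMDiff.continuous⟩

/-- `ρ` is a representation of the Lie groupoid on the line bundle `L`: it respects units and
products, and the map `s^* L → L` that sends `v` over the arrow `g` to `g_* v` is smooth. -/
structure IsRepresentation (hG : LieGroupoid EM EG M) {L : LineBundle EM M} (ρ : ArrowMaps L) :
    Prop where
  map_id : ∀ x, ρ x x (𝟙 x) = LinearMap.id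
  map_comp : ∀ (x y z : M) (g : x ⟶ y) (h : y ⟶ z), ρ x z (g ≫ h) = ρ y z h ∘ₗ ρ x y g
  contMDiff : ContMDiff (𝓘(ℝ, EG).prod 𝓘(ℝ, ℝ)) (𝓘(ℝ, EM).prod 𝓘(ℝ, ℝ)) ∞
    (fun p : TotalSpace ℝ ((srcMap hG : Arrows M → M) *ᵖ L.Fiber) =>
      (⟨p.1.tgt, ρ p.1.src p.1.tgt p.1.hom p.2⟩ : TotalSpace ℝ L.Fiber))

/-- `Φ` is an isomorphism between the representations `ρ` and `ρ'`. -/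
structure IsRepresentationIso (hG : LieGroupoid EM EG M) {L L' : LineBundle EM M}
    (ρ : ArrowMaps L) (ρ' : ArrowMaps L') (Φ : ∀ x, L.Fiber x ≃ₗ[ℝ] L'.Fiber x) : Prop where
  left : IsRepresentation hG ρ
  right : IsRepresentation hG ρ'
  isBundleIso : IsBundleIso Φ
  intertwines : Intertwines ρ ρ' Φ

end Representations

section CanonicalIsomorphisms

theorem detChar_mul {χ ψ κ : ℝ →*₀ ℝ} (h : χ * ψ = κ) (r : ℕ) :
    detChar χ r * detChar ψ r = detChar κ r := by
  subst h; ext A; rfl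

theorem detChar_one (r : ℕ) : detChar 1 r = 1 := by
  ext A
  exact MonoidWithZeroHom.one_apply_of_ne_zero (LinearEquiv.det A).ne_zero

theorem idChar_mul_signChar : idChar * signChar = absChar := by
  ext a
  exact self_mul_sign a

theorem absChar_mul_signChar : absChar * signChar = idChar := by
  ext a
  exact abs_mul_sign a

theorem signChar_mul_signChar : signChar * signChar = 1 := by
  ext a
  rcases eq_or_ne a 0 with rfl | ha
  · simp
  · rw [MonoidWithZeroHom.one_apply_of_ne_zero ha]
    rcases lt_or_gt_of_ne ha with h | h
    · show (SignType.sign a : ℝ) * (SignType.sign a : ℝ) = 1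
      simp [sign_neg h]
    · show (SignType.sign a : ℝ) * (SignType.sign a : ℝ) = 1
      simp [sign_pos h]

/-- An isomorphism `P ⊗ P ≅ ℝ`, with `P` of dimension one, gives `P ≅ P^*`. -/
theorem curry_bijective {P : Type*} [AddCommGroup P] [Module ℝ P] (φ : P ≃ₗ[ℝ] ℝ)
    (T : P ⊗[ℝ] P ≃ₗ[ℝ] ℝ) :
    Function.Bijective (TensorProduct.curry T.toLinearMap : P →ₗ[ℝ] Module.Dual ℝ P) := by
  have : Module.Finite ℝ P := Module.Finite.equiv φ.symm
  have hinj : Function.Injective (TensorProduct.curry T.toLinearMap : P →ₗ[ℝ] Module.Dual ℝ P) := by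
    rw [injective_iff_map_eq_zero]
    intro p hp
    have h1 : T (p ⊗ₜ p) = 0 := LinearMap.congr_fun hp p
    have h2 : p ⊗ₜ[ℝ] p = 0 := by simpa using h1
    have h3 := congrArg (TensorProduct.congr φ φ ≪≫ₗ TensorProduct.lid ℝ ℝ) h2
    have h4 : φ p * φ p = 0 := by simpa using h3
    simpa using h4
  exact ⟨hinj, (LinearMap.injective_iff_surjective_of_finrank_eq_finrank
    (Subspace.dual_finrank_eq).symm).1 hinj⟩

variable (EM EG : Type*) {M : Type*} [Groupoid M]
    [NormedAddCommGroup EM] [NormedSpace ℝ EM] [NormedAddCommGroup EG] [NormedSpace ℝ EG]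
    [TopologicalSpace M] [ChartedSpace EM M]
    [TopologicalSpace (Arrows M)] [ChartedSpace EG (Arrows M)]
    [IsManifold 𝓘(ℝ, EM) ∞ M] [IsManifold 𝓘(ℝ, EG) ∞ (Arrows M)] [hG : LieGroupoid EM EG M]
    [FiniteDimensional ℝ EG]

theorem nonempty_dualAlgFrame (x : M) :
    Nonempty (Frame (algRank EM EG) (Module.Dual ℝ (algFiber EM EG x))) :=
  (nonempty_algFrame EM EG x).map dualFrame

variable [FiniteDimensional ℝ EM]

/-- The isomorphism `L_χ^tr ⊗ L_ψ^tr ≅ L_χψ^tr` obtained from the pointwise multiplications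
`L_χ(A^*) ⊗ L_ψ(A^*) ≅ L_χψ(A^*)` and `L_χ(TM) ⊗ L_ψ(TM) ≅ L_χψ(TM)`. -/
def trMulIso {χ ψ κ : ℝ →*₀ ℝ} [SmoothChar χ] [SmoothChar ψ] [SmoothChar κ] (h : χ * ψ = κ)
    (x : M) : ((trLine EM EG χ).tensor (trLine EM EG ψ) : LineBundle EM M).Fiber x ≃ₗ[ℝ]
      (trLine EM EG κ : LineBundle EM M).Fiber x :=
  TensorProduct.tensorTensorTensorComm ℝ
      (Line (detChar χ (algRank EM EG)) (Module.Dual ℝ (algFiber EM EG x)))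
      (Line (detChar χ (Module.finrank ℝ EM)) (TangentSpace 𝓘(ℝ, EM) x))
      (Line (detChar ψ (algRank EM EG)) (Module.Dual ℝ (algFiber EM EG x)))
      (Line (detChar ψ (Module.finrank ℝ EM)) (TangentSpace 𝓘(ℝ, EM) x)) ≪≫ₗ
    TensorProduct.congr (Line.mulIso (detChar_mul h _) (nonempty_dualAlgFrame EM EG x))
      (Line.mulIso (detChar_mul h _) (nonempty_tangentFrame x))

variable (M)

/-- The transverse density bundle `𝒟^tr = 𝒟(A^*) ⊗ 𝒟(TM)`. -/
abbrev densityTr : LineBundle EM M := trLine EM EG absChar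

/-- The transverse volume bundle `𝒱^tr = 𝒱(A^*) ⊗ 𝒱(TM)`. -/
abbrev volumeTr : LineBundle EM M := trLine EM EG idChar

/-- The transverse orientation bundle `𝔬^tr = 𝔬(A^*) ⊗ 𝔬(TM)`. -/
abbrev orientationTr : LineBundle EM M := trLine EM EG signChar

/-- The canonical isomorphism `𝒟^tr ≅ 𝒱^tr ⊗ 𝔬^tr`. -/
def densityIso (x : M) : (densityTr EM EG M).Fiber x ≃ₗ[ℝ]
    ((volumeTr EM EG M).tensor (orientationTr EM EG M)).Fiber x :=
  (trMulIso EM EG idChar_mul_signChar x).symm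

/-- The canonical isomorphism `𝒱^tr ≅ 𝒟^tr ⊗ 𝔬^tr`. -/
def volumeIso (x : M) : (volumeTr EM EG M).Fiber x ≃ₗ[ℝ]
    ((densityTr EM EG M).tensor (orientationTr EM EG M)).Fiber x :=
  (trMulIso EM EG absChar_mul_signChar x).symm

/-- The canonical isomorphism of `𝔬^tr ⊗ 𝔬^tr` with the trivial line bundle. -/
def orientationSquareIso (x : M) :
    ((orientationTr EM EG M).tensor (orientationTr EM EG M)).Fiber x ≃ₗ[ℝ]
      (LineBundle.trivial EM M).Fiber x :=
  TensorProduct.tensorTensorTensorComm ℝ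
      (Line (detChar signChar (algRank EM EG)) (Module.Dual ℝ (algFiber EM EG x)))
      (Line (detChar signChar (Module.finrank ℝ EM)) (TangentSpace 𝓘(ℝ, EM) x))
      (Line (detChar signChar (algRank EM EG)) (Module.Dual ℝ (algFiber EM EG x)))
      (Line (detChar signChar (Module.finrank ℝ EM)) (TangentSpace 𝓘(ℝ, EM) x)) ≪≫ₗ
    TensorProduct.congr
      (Line.mulIso ((detChar_mul signChar_mul_signChar _).trans (detChar_one _))
          (nonempty_dualAlgFrame EM EG x) ≪≫ₗ Line.constIso (nonempty_dualAlgFrame EM EG x))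
      (Line.mulIso ((detChar_mul signChar_mul_signChar _).trans (detChar_one _))
          (nonempty_tangentFrame x) ≪≫ₗ Line.constIso (nonempty_tangentFrame x)) ≪≫ₗ
    TensorProduct.lid ℝ ℝ

/-- The canonical isomorphism `𝔬^tr ≅ (𝔬^tr)^*` given by the pairing
`𝔬^tr ⊗ 𝔬^tr → ℝ`. -/
def orientationDualIso (x : M) : (orientationTr EM EG M).Fiber x ≃ₗ[ℝ]
    (orientationTr EM EG M).dual.Fiber x :=
  LinearEquiv.ofBijective
    (TensorProduct.curry (orientationSquareIso EM EG M x).toLinearMap)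
    (curry_bijective (((orientationTr EM EG M).exists_mem_triv x).choose.2 x)
      (orientationSquareIso EM EG M x))

end CanonicalIsomorphisms

end TransverseBundles

end

/-!
In frames of `A_x`, `T_x M`, `A_y` and `T_y M`, the map `g_♯` on `L_χ^tr` is multiplication by
`χ (D g)`, where the nonzero real number `D g` does not depend on `χ`. It is the determinant
comparing two frames of `T_g 𝒢`: one adapted to `0 → A_y → T_g 𝒢 → T_x M → 0` (right translation
and `ds`), the other to `0 → A_x → T_g 𝒢 → T_y M → 0` (left translation and `dt`), which is the
sequence at `g⁻¹` transported along the inversion.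

The space of pairs of composable tangent vectors at `(g, h)` is an extension of `T_h 𝒢`, `T_g 𝒢`
and `T_{gh} 𝒢` by `A_z`, `A_x` and `A_y`, respectively. Frames adapted to two of these extensions
differ by a swap of two blocks of length `r`, of determinant `(-1)^r`, whence
`D (gh) = (-1)^(3r) D g * D h`. Thus `(-1)^r D` is multiplicative, in particular equal to `1` at the
units, and applying `χ` makes the maps `g_*` a representation. When `χ ψ = κ`, the isomorphism
`L_χ^tr ⊗ L_ψ^tr ≅ L_κ^tr` commutes with the maps since all three are given by the same number
`D g`. Smoothness follows because a smooth section of `A` extends to a smooth right-invariant vector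
field, so that the adapted frames can be chosen to depend smoothly on `g`.
-/

namespace TransverseBundles

section FrameDeterminants

variable {r : ℕ} {V : Type*} [AddCommGroup V] [Module ℝ V]

/-- The determinant of the frame `u` with respect to the frame `v`. -/
noncomputable def frameDet (u v : Frame r V) : ℝˣ := LinearEquiv.det (u.trans v.symm)

theorem frameDet_trans_left (A : GLr r) (u v : Frame r V) :
    frameDet (A.trans u) v = LinearEquiv.det A * frameDet u v := by
  unfold frameDet
  rw [mul_comm, ← map_mul]
  rfl

theorem frameDet_mul (u v w : Frame r V) : frameDet u v * frameDet v w = frameDet u w := by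
  have h : (u.trans v.symm).trans v = u := by ext; simp
  rw [← congrArg (frameDet · w) h, frameDet_trans_left, frameDet]

@[simp]
theorem frameDet_self (u : Frame r V) : frameDet u u = 1 := by
  simpa using frameDet_mul u u u

end FrameDeterminants

section AdaptedFrames

variable {m n : ℕ}

/-- The decomposition of `ℝ^(m+n)` into blocks, as a linear isomorphism; `IsAdapted` speaks of it
through `Fin.append`. -/
def appendLinearEquiv (m n : ℕ) : ((Fin m → ℝ) × (Fin n → ℝ)) ≃ₗ[ℝ] (Fin (m + n) → ℝ) where
  __ := Fin.appendEquiv m n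
  map_add' x y := by
    ext i
    refine Fin.addCases (fun i => ?_) (fun i => ?_) i <;> simp [Fin.appendEquiv]
  map_smul' a x := by
    ext i
    refine Fin.addCases (fun i => ?_) (fun i => ?_) i <;> simp [Fin.appendEquiv]

theorem appendLinearEquiv_apply (c : Fin m → ℝ) (d : Fin n → ℝ) :
    appendLinearEquiv m n (c, d) = Fin.append c d := rfl

@[simp]
theorem appendLinearEquiv_symm_append (c : Fin m → ℝ) (d : Fin n → ℝ) :
    (appendLinearEquiv m n).symm (Fin.append c d) = (c, d) :=
  (appendLinearEquiv m n).symm_apply_apply (c, d)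

theorem exists_eq_append (x : Fin (m + n) → ℝ) :
    ∃ (c : Fin m → ℝ) (d : Fin n → ℝ), x = Fin.append c d :=
  ⟨_, _, ((appendLinearEquiv m n).apply_symm_apply x).symm⟩

@[simp]
theorem append_zero_zero : Fin.append (0 : Fin m → ℝ) (0 : Fin n → ℝ) = 0 :=
  map_zero (appendLinearEquiv m n)

variable {V W U : Type*} [AddCommGroup V] [Module ℝ V] [AddCommGroup W] [Module ℝ W]
  [AddCommGroup U] [Module ℝ U] {i : V →ₗ[ℝ] U} {p : U →ₗ[ℝ] W}

theorem ShortExact.comp_eq_zero (h : ShortExact i p) (v : V) : p (i v) = 0 :=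
  (h.exact _).2 ⟨v, rfl⟩

theorem exists_isAdapted_append (h : ShortExact i p) (e : Frame m V) (f : Frame n W)
    (s : (Fin n → ℝ) →ₗ[ℝ] U) (hs : ∀ d, p (s d) = f d) :
    ∃ u : Frame (m + n) U,
      IsAdapted i p e f u ∧ ∀ c d, u (Fin.append c d) = i (e c) + s d := by
  let T := ((i ∘ₗ e.toLinearMap).coprod s) ∘ₗ (appendLinearEquiv m n).symm.toLinearMap
  have T_append (c : Fin m → ℝ) (d : Fin n → ℝ) : T (Fin.append c d) = i (e c) + s d := by
    simp [T]
  have p_T (c : Fin m → ℝ) (d : Fin n → ℝ) : p (T (Fin.append c d)) = f d := by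
    rw [T_append, map_add, h.comp_eq_zero, zero_add, hs]
  have T_injective : Function.Injective T := by
    refine (injective_iff_map_eq_zero T).2 fun x hx => ?_
    obtain ⟨c, d, rfl⟩ := exists_eq_append x
    obtain rfl : d = 0 := by simpa [hx] using (p_T c d).symm
    obtain rfl : c = 0 := by
      simpa [T_append, map_eq_zero_iff i h.injective] using hx
    exact append_zero_zero
  have T_surjective : Function.Surjective T := by
    intro x
    obtain ⟨v, hv⟩ := (h.exact (x - s (f.symm (p x)))).1 (by simp [hs])
    exact ⟨Fin.append (e.symm v) (f.symm (p x)), by simp [T_append, hv]⟩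
  exact ⟨LinearEquiv.ofBijective T ⟨T_injective, T_surjective⟩,
    ⟨fun c => (T_append c 0).trans (by simp), p_T⟩, T_append⟩

theorem frameDet_isAdapted {e e' : Frame m V} {f f' : Frame n W} {u u' : Frame (m + n) U}
    (hu : IsAdapted i p e f u) (hu' : IsAdapted i p e' f' u') :
    frameDet u' u = frameDet e' e * frameDet f' f :=
  det_isAdapted hu hu'

end AdaptedFrames

section TransportInFrames

variable {m n : ℕ} {V W U V' W' U' : Type*} [AddCommGroup V] [Module ℝ V] [AddCommGroup W]
  [Module ℝ W] [AddCommGroup U] [Module ℝ U] [AddCommGroup V'] [Module ℝ V'] [AddCommGroup W']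
  [Module ℝ W'] [AddCommGroup U'] [Module ℝ U']

/-- Evaluation on a pair of frames, the coordinate on a tensor product of lines. -/
noncomputable def Line.eval₂ (δ : GLr m →* ℝˣ) (δ' : GLr n →* ℝˣ) (e : Frame m V) (f : Frame n W) :
    Line δ V ⊗[ℝ] Line δ' W ≃ₗ[ℝ] ℝ :=
  TensorProduct.congr (Line.eval δ e) (Line.eval δ' f) ≪≫ₗ TensorProduct.lid ℝ ℝ

theorem Line.eval₂_tmul (δ : GLr m →* ℝˣ) (δ' : GLr n →* ℝˣ) (e : Frame m V) (f : Frame n W)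
    (α : Line δ V) (β : Line δ' W) : Line.eval₂ δ δ' e f (α ⊗ₜ β) = α.1 e * β.1 f := rfl

variable {i : V →ₗ[ℝ] U} {p : U →ₗ[ℝ] W} {i' : V' →ₗ[ℝ] U'} {p' : U' →ₗ[ℝ] W'}
  {e : Frame m V} {f : Frame n W} {u : Frame (m + n) U}
  {e' : Frame m V'} {f' : Frame n W'} {u' : Frame (m + n) U'}

theorem Line.exactIso_symm_apply (χ : ℝ →*₀ ℝ) (h : ShortExact i p)
    (hV : Nonempty (Frame m V)) (hW : Nonempty (Frame n W)) (hu : IsAdapted i p e f u)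
    (t : Line (detChar χ m) V ⊗[ℝ] Line (detChar χ n) W) :
    ((Line.exactIso χ h hV hW).symm t).1 u = Line.eval₂ _ _ e f t := by
  induction t using TensorProduct.induction_on with
  | zero => simp
  | tmul α β => rw [Line.exactIso_symm_tmul χ h hV hW α β hu, Line.eval₂_tmul]
  | add s t hs ht =>
    rw [map_add, map_add, ← hs, ← ht]
    rfl

theorem Line.eval₂_swapIso (χ : ℝ →*₀ ℝ) (h : ShortExact i p) (h' : ShortExact i' p')
    (d : U ≃ₗ[ℝ] U') (hV : Nonempty (Frame m V)) (hW : Nonempty (Frame n W))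
    (hV' : Nonempty (Frame m V')) (hW' : Nonempty (Frame n W'))
    (hu : IsAdapted i p e f u) (hu' : IsAdapted i' p' e' f' u')
    (t : Line (detChar χ m) V ⊗[ℝ] Line (detChar χ n) W) :
    Line.eval₂ _ _ e' f' (Line.swapIso χ h h' d hV hW hV' hW' t) =
      χ (frameDet (u'.trans d.symm) u : ℝˣ) * Line.eval₂ _ _ e f t := by
  rw [← Line.exactIso_symm_apply χ h' hV' hW' hu', ← Line.exactIso_symm_apply χ h hV hW hu]
  simp only [Line.swapIso, LinearEquiv.trans_apply, LinearEquiv.symm_apply_apply]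
  exact Line.eval_change _ ((Line.exactIso χ h hV hW).symm t) u (u'.trans d.symm)

theorem Line.eval₂_congr_dualIso_symm (χ : ℝ →*₀ ℝ) (δ : GLr n →* ℝˣ)
    (hV : Nonempty (Frame m V)) (e : Frame m V) (f : Frame n W)
    (s : Module.Dual ℝ (Line (detChar χ m) V) ⊗[ℝ] Line δ W) :
    Line.eval₂ _ _ (dualFrame e) f
        (TensorProduct.congr (Line.dualIso χ hV).symm (LinearEquiv.refl ℝ (Line δ W)) s) =
      (dualTensorHomEquiv ℝ _ _ s ((Line.eval _ e).symm 1)).1 f := by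
  set ξ := (Line.eval (detChar χ m) e).symm 1
  have ξ_apply : ξ.1 e = 1 := (Line.eval (detChar χ m) e).apply_symm_apply 1
  induction s using TensorProduct.induction_on with
  | zero => simp only [LinearEquiv.map_zero, LinearMap.zero_apply, ZeroMemClass.coe_zero,
      Pi.zero_apply]
  | add s t hs ht =>
    simp only [LinearEquiv.map_add, hs, ht]
    rfl
  | tmul l β =>
    have l_ξ : l ξ = ((Line.dualIso χ hV).symm l).1 (dualFrame e) := by
      simpa [ξ_apply] using Line.dualIso_apply χ hV ((Line.dualIso χ hV).symm l) ξ e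
    rw [TensorProduct.congr_tmul, Line.eval₂_tmul, ← l_ξ]
    simp

theorem Line.lid_rTensor_dualIso (χ : ℝ →*₀ ℝ) (δ : GLr n →* ℝˣ) (hV : Nonempty (Frame m V))
    (e : Frame m V) (f : Frame n W) (l : Line (detChar χ m) (Module.Dual ℝ V))
    (s : Line (detChar χ m) V ⊗[ℝ] Line δ W) :
    (TensorProduct.lid ℝ _ ((Line.dualIso χ hV l).rTensor _ s)).1 f =
      l.1 (dualFrame e) * Line.eval₂ _ _ e f s := by
  induction s using TensorProduct.induction_on with
  | zero => simp
  | add s t hs ht =>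
    rw [map_add, map_add, map_add, mul_add, ← hs, ← ht]
    rfl
  | tmul α β =>
    simp only [LinearMap.rTensor_tmul, TensorProduct.lid_tmul, Line.dualIso_apply χ hV l α e,
      Line.eval₂_tmul, ← mul_assoc]
    rfl

theorem dualTensorHomEquiv_transposeLeft_tmul {P Q P' Q' : Type*} [AddCommGroup P] [Module ℝ P]
    [Module.Finite ℝ P] [AddCommGroup Q] [Module ℝ Q] [AddCommGroup P'] [Module ℝ P']
    [AddCommGroup Q'] [Module ℝ Q'] (φ : P ⊗[ℝ] Q →ₗ[ℝ] P' ⊗[ℝ] Q') (l : Module.Dual ℝ P')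
    (q : Q) (x : P) :
    dualTensorHomEquiv ℝ P Q' (transposeLeft φ (l ⊗ₜ q)) x =
      TensorProduct.lid ℝ Q' (l.rTensor Q' (φ (x ⊗ₜ q))) := by
  simp [transposeLeft]

theorem Line.eval₂_transport (χ : ℝ →*₀ ℝ) (h : ShortExact i p) (h' : ShortExact i' p')
    (d : U ≃ₗ[ℝ] U') (hV : Nonempty (Frame m V)) (hW : Nonempty (Frame n W))
    (hV' : Nonempty (Frame m V')) (hW' : Nonempty (Frame n W'))
    (hu : IsAdapted i p e f u) (hu' : IsAdapted i' p' e' f' u')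
    (t : Line (detChar χ m) (Module.Dual ℝ V') ⊗[ℝ] Line (detChar χ n) W) :
    Line.eval₂ _ _ (dualFrame e) f' (Line.transport χ h h' d hV hW hV' hW' t) =
      χ (frameDet (u'.trans d.symm) u : ℝˣ) * Line.eval₂ _ _ (dualFrame e') f t := by
  induction t using TensorProduct.induction_on with
  | zero => simp only [LinearMap.map_zero, LinearEquiv.map_zero, mul_zero]
  | add s t hs ht => simp only [LinearMap.map_add, LinearEquiv.map_add, hs, ht, mul_add]
  | tmul l β =>
    have eval_one : ((Line.eval (detChar χ m) e).symm 1).1 e = 1 :=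
      (Line.eval (detChar χ m) e).apply_symm_apply 1
    simp only [Line.transport, LinearMap.comp_apply, LinearEquiv.coe_coe]
    rw [Line.eval₂_congr_dualIso_symm, TensorProduct.congr_tmul, LinearEquiv.refl_apply,
      dualTensorHomEquiv_transposeLeft_tmul, Line.lid_rTensor_dualIso χ _ hV' e',
      LinearEquiv.coe_coe, Line.eval₂_swapIso χ h h' d hV hW hV' hW' hu hu', Line.eval₂_tmul,
      Line.eval₂_tmul, eval_one]
    ring

end TransportInFrames

section SwappedFiltrations

variable {r n : ℕ} {V₁ V₂ U₁ U₂ E W : Type*} [AddCommGroup V₁] [Module ℝ V₁] [AddCommGroup V₂]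
  [Module ℝ V₂] [AddCommGroup U₁] [Module ℝ U₁] [AddCommGroup U₂] [Module ℝ U₂] [AddCommGroup E]
  [Module ℝ E] [AddCommGroup W] [Module ℝ W]
  {i₁ : V₁ →ₗ[ℝ] E} {p₁ : E →ₗ[ℝ] U₁} {j₁ : V₂ →ₗ[ℝ] U₁} {q₁ : U₁ →ₗ[ℝ] W}
  {i₂ : V₂ →ₗ[ℝ] E} {p₂ : E →ₗ[ℝ] U₂} {j₂ : V₁ →ₗ[ℝ] U₂} {q₂ : U₂ →ₗ[ℝ] W}

theorem ShortExact.of_swap (h₁ : ShortExact i₁ p₁) (k₁ : ShortExact j₁ q₁) (k₂ : ShortExact j₂ q₂)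
    (h₁₂ : ∀ v, p₁ (i₂ v) = j₁ v) (h₂₁ : ∀ v, p₂ (i₁ v) = j₂ v) (h₂ : ∀ v, p₂ (i₂ v) = 0)
    (hq : ∀ x, q₁ (p₁ x) = q₂ (p₂ x)) : ShortExact i₂ p₂ where
  injective := by
    refine Function.Injective.of_comp (f := p₁) ?_
    simpa only [Function.comp_def, h₁₂] using k₁.injective
  exact x := by
    refine ⟨fun hx => ?_, ?_⟩
    · obtain ⟨v, hv⟩ := (k₁.exact (p₁ x)).1 (by rw [hq, hx, map_zero])
      obtain ⟨w, hw⟩ := (h₁.exact (x - i₂ v)).1 (by rw [map_sub, h₁₂, hv, sub_self])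
      have hw0 : w = 0 := k₂.injective (by rw [← h₂₁, hw, map_sub, hx, h₂, sub_zero, map_zero])
      exact ⟨v, by rw [← sub_eq_zero, ← neg_sub, ← hw, hw0, map_zero, neg_zero]⟩
    · rintro ⟨v, rfl⟩
      exact h₂ v
  surjective y := by
    obtain ⟨z, hz⟩ := k₁.surjective (q₂ y)
    obtain ⟨x, rfl⟩ := h₁.surjective z
    obtain ⟨w, hw⟩ := (k₂.exact (y - p₂ x)).1 (by rw [map_sub, ← hq, hz, sub_self])
    exact ⟨x + i₁ w, by rw [map_add, h₂₁, hw, add_sub_cancel]⟩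

theorem exists_isAdapted_isAdapted (h₁ : ShortExact i₁ p₁) (k₁ : ShortExact j₁ q₁)
    (h₁₂ : ∀ v, p₁ (i₂ v) = j₁ v) (e₁ : Frame r V₁) (e₂ : Frame r V₂) (f : Frame n W)
    (s : (Fin n → ℝ) →ₗ[ℝ] E) (hs : ∀ d, q₁ (p₁ (s d)) = f d) :
    ∃ (u : Frame (r + n) U₁) (F : Frame (r + (r + n)) E), IsAdapted j₁ q₁ e₂ f u ∧
      IsAdapted i₁ p₁ e₁ u F ∧
      ∀ a b d, F (Fin.append a (Fin.append b d)) = i₁ (e₁ a) + i₂ (e₂ b) + s d := by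
  obtain ⟨u, hu, u_append⟩ := exists_isAdapted_append k₁ e₂ f (p₁ ∘ₗ s) hs
  let s' := ((i₂ ∘ₗ e₂.toLinearMap).coprod s) ∘ₗ (appendLinearEquiv r n).symm.toLinearMap
  have s'_append (b : Fin r → ℝ) (d : Fin n → ℝ) : s' (Fin.append b d) = i₂ (e₂ b) + s d := by
    simp [s']
  have p_s' (c : Fin (r + n) → ℝ) : p₁ (s' c) = u c := by
    obtain ⟨b, d, rfl⟩ := exists_eq_append c
    rw [s'_append, u_append, map_add, h₁₂, LinearMap.comp_apply]
  obtain ⟨F, hF, F_append⟩ := exists_isAdapted_append h₁ e₁ u s' p_s'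
  exact ⟨u, F, hu, hF, fun a b d => by rw [F_append, s'_append, add_assoc]⟩

/-- The exchange of the first two blocks of `ℝ^r × ℝ^r × ℝ^n`. -/
def blockSwap (r n : ℕ) : GLr (r + (r + n)) :=
  let blocks := (LinearEquiv.refl ℝ (Fin r → ℝ)).prodCongr (appendLinearEquiv r n) ≪≫ₗ
    appendLinearEquiv r (r + n)
  blocks.symm ≪≫ₗ (LinearEquiv.prodAssoc ℝ _ _ _).symm ≪≫ₗ
    (LinearEquiv.prodComm ℝ _ _).prodCongr (LinearEquiv.refl ℝ _) ≪≫ₗ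
    LinearEquiv.prodAssoc ℝ _ _ _ ≪≫ₗ blocks

theorem blockSwap_append (a b : Fin r → ℝ) (d : Fin n → ℝ) :
    blockSwap r n (Fin.append a (Fin.append b d)) = Fin.append b (Fin.append a d) := by
  simp [blockSwap, appendLinearEquiv_apply, LinearEquiv.prodAssoc]

theorem det_prodComm_self (R M : Type*) [CommRing R] [AddCommGroup M] [Module R M]
    [Module.Free R M] [Module.Finite R M] :
    LinearMap.det (LinearEquiv.prodComm R M M).toLinearMap = (-1) ^ Module.finrank R M := by
  nontriviality R
  let b := Module.Free.chooseBasis R M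
  have toMatrix_eq : LinearMap.toMatrix (b.prod b) (b.prod b) (LinearEquiv.prodComm R M M) =
      Matrix.fromBlocks 0 1 1 0 := by
    ext i j
    rcases i with i | i <;> rcases j with j | j <;>
      simp [LinearMap.toMatrix_apply, Matrix.one_apply, Finsupp.single_apply, eq_comm]
  let ι := Module.Free.ChooseBasisIndex R M
  have shear : Matrix.fromBlocks 0 1 1 0 * Matrix.fromBlocks 1 0 1 1 =
      Matrix.fromBlocks (1 : Matrix ι ι R) (1 : Matrix ι ι R) (1 : Matrix ι ι R) 0 := by
    simp [Matrix.fromBlocks_multiply]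
  have det_eq := congrArg Matrix.det shear
  rw [Matrix.det_mul, Matrix.det_fromBlocks_zero₁₂, Matrix.det_fromBlocks_one₁₁] at det_eq
  rw [← LinearMap.det_toMatrix (b.prod b), toMatrix_eq]
  simpa [Matrix.det_neg, Module.finrank_eq_card_chooseBasisIndex] using det_eq

theorem det_blockSwap (r n : ℕ) : LinearEquiv.det (blockSwap r n) = (-1) ^ r := by
  let swap := (LinearEquiv.prodComm ℝ (Fin r → ℝ) (Fin r → ℝ)).prodCongr
    (LinearEquiv.refl ℝ (Fin n → ℝ))
  have det_swap : LinearEquiv.det swap = (-1) ^ r := by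
    ext
    rw [LinearEquiv.coe_det]
    refine (LinearMap.det_prodMap
      (LinearEquiv.prodComm ℝ (Fin r → ℝ) (Fin r → ℝ)).toLinearMap LinearMap.id).trans ?_
    simp [det_prodComm_self]
  rw [← det_swap, ← LinearEquiv.det_conj swap ((LinearEquiv.prodAssoc ℝ _ _ _).trans
    (((LinearEquiv.refl ℝ (Fin r → ℝ)).prodCongr (appendLinearEquiv r n)).trans
      (appendLinearEquiv r (r + n))))]
  rfl

theorem frameDet_eq_neg_one_pow (h₁ : ShortExact i₁ p₁) (h₂ : ShortExact i₂ p₂)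
    (k₁ : ShortExact j₁ q₁) (k₂ : ShortExact j₂ q₂) (h₁₂ : ∀ v, p₁ (i₂ v) = j₁ v)
    (h₂₁ : ∀ v, p₂ (i₁ v) = j₂ v) (hq : ∀ x, q₁ (p₁ x) = q₂ (p₂ x)) {e₁ : Frame r V₁}
    {e₂ : Frame r V₂} {f : Frame n W} {u₁ : Frame (r + n) U₁} {u₂ : Frame (r + n) U₂}
    (hu₁ : IsAdapted j₁ q₁ e₂ f u₁) (hu₂ : IsAdapted j₂ q₂ e₁ f u₂)
    {F₁ F₂ : Frame (r + (r + n)) E} (hF₁ : IsAdapted i₁ p₁ e₁ u₁ F₁)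
    (hF₂ : IsAdapted i₂ p₂ e₂ u₂ F₂) :
    frameDet F₁ F₂ = (-1) ^ r := by
  obtain ⟨σ, hσ⟩ := (q₁ ∘ₗ p₁).exists_rightInverse_of_surjective
    (LinearMap.range_eq_top.2 (k₁.surjective.comp h₁.surjective))
  have q_p_σ (w : W) : q₁ (p₁ (σ w)) = w := LinearMap.congr_fun hσ w
  obtain ⟨v₁, G₁, hv₁, hG₁, G₁_append⟩ := exists_isAdapted_isAdapted h₁ k₁ h₁₂ e₁ e₂ f
    (σ ∘ₗ f.toLinearMap) (fun d => q_p_σ (f d))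
  obtain ⟨v₂, G₂, hv₂, hG₂, G₂_append⟩ := exists_isAdapted_isAdapted h₂ k₂ h₂₁ e₂ e₁ f
    (σ ∘ₗ f.toLinearMap) (fun d => (hq _).symm.trans (q_p_σ (f d)))
  have G₁_eq : G₁ = (blockSwap r n).trans G₂ := by
    ext x
    obtain ⟨a, c, rfl⟩ := exists_eq_append x
    obtain ⟨b, d, rfl⟩ := exists_eq_append c
    rw [LinearEquiv.trans_apply, blockSwap_append, G₁_append, G₂_append, add_comm (i₂ _)]
  have det_F₁_G₁ : frameDet F₁ G₁ = 1 := by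
    simp [frameDet_isAdapted hG₁ hF₁, frameDet_isAdapted hv₁ hu₁]
  have det_G₂_F₂ : frameDet G₂ F₂ = 1 := by
    simp [frameDet_isAdapted hF₂ hG₂, frameDet_isAdapted hu₂ hv₂]
  rw [← frameDet_mul F₁ G₁ F₂, det_F₁_G₁, one_mul, G₁_eq, frameDet_trans_left, det_G₂_F₂, mul_one,
    det_blockSwap]

end SwappedFiltrations

section ThreeFiltrations

variable {r n : ℕ} {E V₁ V₂ V₃ U₁ U₂ U₃ W₁ W₂ W₃ : Type*}
  [AddCommGroup E] [Module ℝ E] [AddCommGroup V₁] [Module ℝ V₁] [AddCommGroup V₂] [Module ℝ V₂]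
  [AddCommGroup V₃] [Module ℝ V₃] [AddCommGroup U₁] [Module ℝ U₁] [AddCommGroup U₂] [Module ℝ U₂]
  [AddCommGroup U₃] [Module ℝ U₃] [AddCommGroup W₁] [Module ℝ W₁] [AddCommGroup W₂] [Module ℝ W₂]
  [AddCommGroup W₃] [Module ℝ W₃]
  {i₁ : V₁ →ₗ[ℝ] E} {p₁ : E →ₗ[ℝ] U₁} {i₂ : V₂ →ₗ[ℝ] E} {p₂ : E →ₗ[ℝ] U₂}
  {i₃ : V₃ →ₗ[ℝ] E} {p₃ : E →ₗ[ℝ] U₃}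
  {j₁₂ : V₂ →ₗ[ℝ] U₁} {q₁₂ : U₁ →ₗ[ℝ] W₃} {j₁₃ : V₃ →ₗ[ℝ] U₁} {q₁₃ : U₁ →ₗ[ℝ] W₂}
  {j₂₁ : V₁ →ₗ[ℝ] U₂} {q₂₁ : U₂ →ₗ[ℝ] W₃} {j₂₃ : V₃ →ₗ[ℝ] U₂} {q₂₃ : U₂ →ₗ[ℝ] W₁}
  {j₃₁ : V₁ →ₗ[ℝ] U₃} {q₃₁ : U₃ →ₗ[ℝ] W₂} {j₃₂ : V₂ →ₗ[ℝ] U₃} {q₃₂ : U₃ →ₗ[ℝ] W₁}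

theorem frameDet_three_filtrations
    (h₁ : ShortExact i₁ p₁) (h₂ : ShortExact i₂ p₂) (h₃ : ShortExact i₃ p₃)
    (k₁₂ : ShortExact j₁₂ q₁₂) (k₁₃ : ShortExact j₁₃ q₁₃) (k₂₁ : ShortExact j₂₁ q₂₁)
    (k₂₃ : ShortExact j₂₃ q₂₃) (k₃₁ : ShortExact j₃₁ q₃₁) (k₃₂ : ShortExact j₃₂ q₃₂)
    (h₁₂ : ∀ v, p₁ (i₂ v) = j₁₂ v) (h₁₃ : ∀ v, p₁ (i₃ v) = j₁₃ v) (h₂₁ : ∀ v, p₂ (i₁ v) = j₂₁ v)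
    (h₂₃ : ∀ v, p₂ (i₃ v) = j₂₃ v) (h₃₁ : ∀ v, p₃ (i₁ v) = j₃₁ v) (h₃₂ : ∀ v, p₃ (i₂ v) = j₃₂ v)
    (hW₁ : ∀ x, q₂₃ (p₂ x) = q₃₂ (p₃ x)) (hW₂ : ∀ x, q₁₃ (p₁ x) = q₃₁ (p₃ x))
    (hW₃ : ∀ x, q₁₂ (p₁ x) = q₂₁ (p₂ x))
    {e₁ : Frame r V₁} {e₂ : Frame r V₂} {e₃ : Frame r V₃}
    {f₁ : Frame n W₁} {f₂ : Frame n W₂} {f₃ : Frame n W₃}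
    {u₁₂ u₁₃ : Frame (r + n) U₁} {u₂₁ u₂₃ : Frame (r + n) U₂} {u₃₁ u₃₂ : Frame (r + n) U₃}
    (hu₁₂ : IsAdapted j₁₂ q₁₂ e₂ f₃ u₁₂) (hu₁₃ : IsAdapted j₁₃ q₁₃ e₃ f₂ u₁₃)
    (hu₂₁ : IsAdapted j₂₁ q₂₁ e₁ f₃ u₂₁) (hu₂₃ : IsAdapted j₂₃ q₂₃ e₃ f₁ u₂₃)
    (hu₃₁ : IsAdapted j₃₁ q₃₁ e₁ f₂ u₃₁) (hu₃₂ : IsAdapted j₃₂ q₃₂ e₂ f₁ u₃₂) :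
    frameDet u₃₂ u₃₁ = (-1) ^ r * frameDet u₂₃ u₂₁ * frameDet u₁₂ u₁₃ := by
  obtain ⟨F₁₂, hF₁₂⟩ := exists_isAdapted h₁ e₁ u₁₂
  obtain ⟨F₁₃, hF₁₃⟩ := exists_isAdapted h₁ e₁ u₁₃
  obtain ⟨F₂₁, hF₂₁⟩ := exists_isAdapted h₂ e₂ u₂₁
  obtain ⟨F₂₃, hF₂₃⟩ := exists_isAdapted h₂ e₂ u₂₃
  obtain ⟨F₃₁, hF₃₁⟩ := exists_isAdapted h₃ e₃ u₃₁
  obtain ⟨F₃₂, hF₃₂⟩ := exists_isAdapted h₃ e₃ u₃₂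
  have det₁ : frameDet F₁₂ F₁₃ = frameDet u₁₂ u₁₃ := by simp [frameDet_isAdapted hF₁₃ hF₁₂]
  have det₂ : frameDet F₂₃ F₂₁ = frameDet u₂₃ u₂₁ := by simp [frameDet_isAdapted hF₂₁ hF₂₃]
  have det₃ : frameDet F₃₂ F₃₁ = frameDet u₃₂ u₃₁ := by simp [frameDet_isAdapted hF₃₁ hF₃₂]
  have swap₃₂ : frameDet F₃₂ F₂₃ = (-1) ^ r :=
    frameDet_eq_neg_one_pow h₃ h₂ k₃₂ k₂₃ h₃₂ h₂₃ (fun x => (hW₁ x).symm) hu₃₂ hu₂₃ hF₃₂ hF₂₃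
  have swap₂₁ : frameDet F₂₁ F₁₂ = (-1) ^ r :=
    frameDet_eq_neg_one_pow h₂ h₁ k₂₁ k₁₂ h₂₁ h₁₂ (fun x => (hW₃ x).symm) hu₂₁ hu₁₂ hF₂₁ hF₁₂
  have swap₁₃ : frameDet F₁₃ F₃₁ = (-1) ^ r :=
    frameDet_eq_neg_one_pow h₁ h₃ k₁₃ k₃₁ h₁₃ h₃₁ hW₂ hu₁₃ hu₃₁ hF₁₃ hF₃₁
  calc frameDet u₃₂ u₃₁
      = frameDet F₃₂ F₂₃ * (frameDet F₂₃ F₂₁ * (frameDet F₂₁ F₁₂ *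
          (frameDet F₁₂ F₁₃ * frameDet F₁₃ F₃₁))) := by simp only [frameDet_mul, det₃]
    _ = (-1) ^ r * ((-1) ^ r * (-1) ^ r) * frameDet u₂₃ u₂₁ * frameDet u₁₂ u₁₃ := by
      rw [swap₃₂, swap₂₁, swap₁₃, det₁, det₂]
      ac_rfl
    _ = (-1) ^ r * frameDet u₂₃ u₂₁ * frameDet u₁₂ u₁₃ := by
      rw [← mul_pow, neg_one_mul, neg_neg, one_pow, mul_one]

end ThreeFiltrations

section FiberProduct

variable {V U W X : Type*} [AddCommGroup V] [Module ℝ V] [AddCommGroup U] [Module ℝ U]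
  [AddCommGroup W] [Module ℝ W] [AddCommGroup X] [Module ℝ X]

/-- The fibre product `V ×_W U`. For the differentials of source and target at composable arrows
it is the space of pairs of composable tangent vectors. -/
def fiberProd (s : V →ₗ[ℝ] W) (t : U →ₗ[ℝ] W) : Submodule ℝ (V × U) :=
  LinearMap.eqLocus (s ∘ₗ LinearMap.fst ℝ V U) (t ∘ₗ LinearMap.snd ℝ V U)

variable {s : V →ₗ[ℝ] W} {t : U →ₗ[ℝ] W}

/-- The linear map to the fibre product with the given components. -/
def fiberProdLift (a : X →ₗ[ℝ] V) (b : X →ₗ[ℝ] U) (h : ∀ x, s (a x) = t (b x)) :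
    X →ₗ[ℝ] fiberProd s t :=
  (a.prod b).codRestrict _ h

theorem shortExact_fiberProd_snd {i : X →ₗ[ℝ] V} (h : ShortExact i s) (t : U →ₗ[ℝ] W) :
    ShortExact (fiberProdLift (t := t) i 0 (by simpa using h.comp_eq_zero))
      (LinearMap.snd ℝ V U ∘ₗ (fiberProd s t).subtype) where
  injective x y hxy := h.injective (congrArg (fun z => z.1.1) hxy)
  exact := by
    rintro ⟨⟨v, w⟩, hvw : s v = t w⟩
    refine ⟨fun (hw : w = 0) => ?_, ?_⟩
    · subst hw
      obtain ⟨x, rfl⟩ := (h.exact v).1 (hvw.trans (map_zero t))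
      exact ⟨x, rfl⟩
    · rintro ⟨x, hx⟩
      exact (congrArg (fun z => z.1.2) hx).symm
  surjective w := by
    obtain ⟨v, hv⟩ := h.surjective (t w)
    exact ⟨⟨(v, w), hv⟩, rfl⟩

end FiberProduct

section Velocities

variable {EN N EB B : Type*} [NormedAddCommGroup EN] [NormedSpace ℝ EN]
  [TopologicalSpace N] [ChartedSpace EN N]
  [NormedAddCommGroup EB] [NormedSpace ℝ EB] [TopologicalSpace B] [ChartedSpace EB B]

variable (EN) in
/-- The curve `γ` passes at time `0` through `p` with velocity `v`. Differentials of maps are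
computed by following curves, so that identities between maps pass to their differentials. -/
structure HasVelocity (γ : ℝ → N) (p : N) (v : EN) : Prop where
  apply_zero : γ 0 = p
  exists_deriv : ∃ D : ℝ →L[ℝ] EN, D 1 = v ∧ HasMFDerivAt 𝓘(ℝ, ℝ) 𝓘(ℝ, EN) γ 0 D

namespace HasVelocity

variable {γ δ : ℝ → N} {p q : N} {v w : EN}

theorem eventually_mem (h : HasVelocity EN γ p v) {s : Set N} (hs : IsOpen s) (hp : p ∈ s) :
    ∀ᶠ τ in 𝓝 0, γ τ ∈ s := by
  obtain ⟨rfl, D, -, hD⟩ := h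
  exact hD.continuousAt.preimage_mem_nhds (hs.mem_nhds hp)

theorem congr (h : HasVelocity EN γ p v) (e : δ =ᶠ[𝓝 0] γ) : HasVelocity EN δ p v := by
  obtain ⟨h0, D, h1, h2⟩ := h
  exact ⟨e.eq_of_nhds.trans h0, D, h1, h2.congr_of_eventuallyEq e⟩

theorem unique (h : HasVelocity EN γ p v) (h' : HasVelocity EN δ q w) (e : δ =ᶠ[𝓝 0] γ) :
    v = w := by
  obtain ⟨-, D, rfl, h1⟩ := h
  obtain ⟨-, D', rfl, h2⟩ := h'.congr e.symm
  exact DFunLike.congr_fun (hasMFDerivAt_unique h1 h2) (1 : ℝ)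

variable (EN) in
theorem const (p : N) : HasVelocity EN (fun _ => p) p (0 : EN) :=
  ⟨rfl, 0, rfl, hasMFDerivAt_const (I := 𝓘(ℝ, ℝ)) (I' := 𝓘(ℝ, EN)) p (0 : ℝ)⟩

theorem comp_hasMFDerivWithinAt (h : HasVelocity EN γ p v) {f : N → B} {s : Set N}
    {f' : EN →L[ℝ] EB} (hf : HasMFDerivWithinAt 𝓘(ℝ, EN) 𝓘(ℝ, EB) f s p f')
    (hs : ∀ᶠ τ in 𝓝 0, γ τ ∈ s) : HasVelocity EB (fun τ => f (γ τ)) (f p) (f' v) := by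
  obtain ⟨rfl, D, rfl, h1⟩ := h
  have h2 : HasMFDerivWithinAt 𝓘(ℝ, ℝ) 𝓘(ℝ, EB) (f ∘ γ) (γ ⁻¹' s) 0 (f'.comp D) :=
    hf.comp 0 h1.hasMFDerivWithinAt subset_rfl
  exact ⟨rfl, f'.comp D, rfl, h2.hasMFDerivAt hs⟩

theorem comp (h : HasVelocity EN γ p v) {f : N → B}
    (hf : MDifferentiableAt 𝓘(ℝ, EN) 𝓘(ℝ, EB) f p) :
    HasVelocity EB (fun τ => f (γ τ)) (f p) (mfderiv 𝓘(ℝ, EN) 𝓘(ℝ, EB) f p v) :=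
  h.comp_hasMFDerivWithinAt (EB := EB) (f' := mfderiv 𝓘(ℝ, EN) 𝓘(ℝ, EB) f p)
    (hf.hasMFDerivAt.hasMFDerivWithinAt (s := univ)) (Filter.Eventually.of_forall mem_univ)

theorem of_hasDerivAt {γ : ℝ → EN} {v : EN} (h : HasDerivAt γ v 0) : HasVelocity EN γ (γ 0) v :=
  ⟨rfl, _, one_smul ℝ v, h.hasFDerivAt.hasMFDerivAt⟩

theorem hasDerivAt {γ : ℝ → EN} {p v : EN} (h : HasVelocity EN γ p v) : HasDerivAt γ v 0 := by
  obtain ⟨-, D, rfl, h1⟩ := h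
  have h2 : HasFDerivAt γ D 0 := h1.hasFDerivAt
  exact h2.hasDerivAt

theorem add_smul (p v : EN) : HasVelocity EN (fun τ : ℝ => p + τ • v) p v := by
  simpa using of_hasDerivAt (((hasDerivAt_id (0 : ℝ)).smul_const v).const_add p)

end HasVelocity

theorem HasVelocity.symm_comp {e : OpenPartialHomeomorph N EN}
    (he : e.MDifferentiable 𝓘(ℝ, EN) 𝓘(ℝ, EN)) {p : N} (hp : p ∈ e.source) {v : EN} {ζ : ℝ → EN}
    (hζ : HasVelocity EN ζ (e p) (mfderiv 𝓘(ℝ, EN) 𝓘(ℝ, EN) e p v : EN)) :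
    HasVelocity EN (fun τ => e.symm (ζ τ)) p v := by
  let w : EN := mfderiv 𝓘(ℝ, EN) 𝓘(ℝ, EN) e p v
  have hw : (mfderiv 𝓘(ℝ, EN) 𝓘(ℝ, EN) e.symm (e p) w : EN) = v :=
    DFunLike.congr_fun (he.symm_comp_deriv hp) v
  have h := hζ.comp (he.mdifferentiableAt_symm (e.map_source hp))
  rwa [hw, e.left_inv hp] at h

theorem exists_hasVelocity [IsManifold 𝓘(ℝ, EN) ∞ N] (p : N) (v : EN) :
    ∃ γ : ℝ → N, HasVelocity EN γ p v := by
  have he := mdifferentiable_of_mem_maximalAtlas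
    (IsManifold.chart_mem_maximalAtlas (I := 𝓘(ℝ, EN)) (n := ∞) p)
  exact ⟨_, (HasVelocity.add_smul _ _).symm_comp he (mem_chart_source EN p)⟩

theorem codChart_apply {f : N → B} {p : N}
    (hf : Manifold.IsSubmersionAt 𝓘(ℝ, EN) 𝓘(ℝ, EB) ∞ f p) {q : N} (hq : q ∈ hf.domChart.source) :
    hf.codChart (f q) = (hf.equiv (hf.domChart q)).1 := by
  have hq' : hf.domChart q ∈ (hf.domChart.extend 𝓘(ℝ, EN)).target := by
    simpa using hf.domChart.map_source hq
  have h := hf.writtenInCharts hq'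
  simpa [hf.domChart.left_inv hq] using h

theorem mfderiv_codChart_mfderiv [IsManifold 𝓘(ℝ, EN) ∞ N] {f : N → B} {p : N}
    (hf : Manifold.IsSubmersionAt 𝓘(ℝ, EN) 𝓘(ℝ, EB) ∞ f p) (v : EN) :
    (mfderiv 𝓘(ℝ, EB) 𝓘(ℝ, EB) hf.codChart (f p) (mfderiv 𝓘(ℝ, EN) 𝓘(ℝ, EB) f p v) : EB) =
      (hf.equiv (mfderiv 𝓘(ℝ, EN) 𝓘(ℝ, EN) hf.domChart p v)).1 := by
  have he := mdifferentiable_of_mem_maximalAtlas hf.domChart_mem_maximalAtlas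
  have hc := mdifferentiable_of_mem_maximalAtlas hf.codChart_mem_maximalAtlas
  have hp := hf.mem_domChart_source
  obtain ⟨γ, hγ⟩ := exists_hasVelocity p v
  have h_cf := (hγ.comp (hf.contMDiffAt.mdifferentiableAt (by simp))).comp
    (hc.mdifferentiableAt (hf.source_subset_preimage_source hp))
  have h_le := hf.equiv.hasFDerivAt.comp_hasDerivAt (0 : ℝ)
    (hγ.comp (he.mdifferentiableAt hp)).hasDerivAt
  refine h_cf.unique (.of_hasDerivAt h_le.fst) ?_
  filter_upwards [hγ.eventually_mem hf.domChart.open_source hp] with τ hτ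
  exact (codChart_apply hf hτ).symm

/-- In product charts the lift is made of the given curve of the base and of the second component
of a line in the direction of `v`. -/
theorem HasVelocity.exists_lift [IsManifold 𝓘(ℝ, EN) ∞ N] {f : N → B} {p : N} {v : EN}
    (hf : Manifold.IsSubmersionAt 𝓘(ℝ, EN) 𝓘(ℝ, EB) ∞ f p) {β : ℝ → B}
    (hβ : HasVelocity EB β (f p) (mfderiv 𝓘(ℝ, EN) 𝓘(ℝ, EB) f p v : EB)) :
    ∃ γ : ℝ → N, HasVelocity EN γ p v ∧ ∀ᶠ τ in 𝓝 0, f (γ τ) = β τ := by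
  have he := mdifferentiable_of_mem_maximalAtlas hf.domChart_mem_maximalAtlas
  have hc := mdifferentiable_of_mem_maximalAtlas hf.codChart_mem_maximalAtlas
  have hp := hf.mem_domChart_source
  have hfp := hf.source_subset_preimage_source hp
  have deriv_c := mfderiv_codChart_mfderiv hf v
  set e := hf.domChart
  set c := hf.codChart
  set l := hf.equiv
  let w : EN := mfderiv 𝓘(ℝ, EN) 𝓘(ℝ, EN) e p v
  have deriv_line : HasDerivAt (fun τ : ℝ => l (e p + τ • w)) (l w) 0 :=
    l.hasFDerivAt.comp_hasDerivAt (0 : ℝ) (HasVelocity.add_smul (e p) w).hasDerivAt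
  have deriv_cβ : HasDerivAt (fun τ => c (β τ)) (l w).1 0 :=
    deriv_c ▸ (hβ.comp (hc.mdifferentiableAt hfp)).hasDerivAt
  let ζ : ℝ → EN := fun τ => l.symm (c (β τ), (l (e p + τ • w)).2)
  have hζ : HasVelocity EN ζ (e p) w := by
    have h : HasDerivAt ζ (l.symm (l w)) 0 :=
      l.symm.hasFDerivAt.comp_hasDerivAt (0 : ℝ) (deriv_cβ.prodMk deriv_line.snd)
    have hζ₀ : ζ 0 = e p := by
      change l.symm (c (β 0), (l (e p + (0 : ℝ) • w)).2) = e p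
      rw [hβ.apply_zero, zero_smul, add_zero, codChart_apply hf hp]
      exact l.symm_apply_apply (e p)
    rw [l.symm_apply_apply] at h
    exact hζ₀ ▸ HasVelocity.of_hasDerivAt h
  refine ⟨_, hζ.symm_comp he hp, ?_⟩
  filter_upwards [hζ.eventually_mem e.open_target (e.map_source hp),
    hβ.eventually_mem c.open_source hfp] with τ hτ hβτ
  refine c.injOn (hf.source_subset_preimage_source (e.map_target hτ)) hβτ ?_
  rw [codChart_apply hf (e.map_target hτ), e.right_inv hτ]
  exact congrArg Prod.fst (l.apply_symm_apply _)

end Velocities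

namespace Arrows

variable {M : Type*} [Groupoid M] {x y z : M}

theorem tgt_mul {g h : Arrows M} (e : g.src = h.tgt) : (g.mul h).tgt = g.tgt := by
  simp [mul, e]

theorem mul_of_mul_of (g : y ⟶ z) (h : x ⟶ y) {k : Arrows M} (hk : k.src = z) :
    (k.mul (of g)).mul (of h) = k.mul (of (h ≫ g)) := by
  obtain ⟨z', w, k⟩ := k
  obtain rfl : z' = z := hk
  change ((of k).mul (of g)).mul (of h) = (of k).mul (of (h ≫ g))
  simp only [mul_of, Category.assoc]

theorem of_mul_inv (g : y ⟶ z) (h : x ⟶ y) {k : Arrows M} (hk : k.src = x) :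
    (of g).mul (k.mul (of (Groupoid.inv h))).inv =
      (k.mul (of (Groupoid.inv (h ≫ g)))).inv := by
  obtain ⟨x', w, k⟩ := k
  obtain rfl : x' = x := hk
  change (of g).mul ((of k).mul (of (Groupoid.inv h))).inv =
    ((of k).mul (of (Groupoid.inv (h ≫ g)))).inv
  simp only [mul_of]
  simp [inv, Groupoid.inv_eq_inv]

theorem inv_mul_mul_of (g : y ⟶ z) (h : x ⟶ y) {k : Arrows M} (hk : k.src = y) :
    (k.mul (of (Groupoid.inv g))).inv.mul (k.mul (of h)) = of (h ≫ g) := by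
  obtain ⟨y', w, k⟩ := k
  obtain rfl : y' = y := hk
  change (((of k).mul (of (Groupoid.inv g))).inv).mul ((of k).mul (of h)) = _
  simp only [mul_of]
  simp [Groupoid.inv_eq_inv]

end Arrows

section Differentials

variable {EM EG M : Type*} [Groupoid M]
    [NormedAddCommGroup EM] [NormedSpace ℝ EM] [NormedAddCommGroup EG] [NormedSpace ℝ EG]
    [TopologicalSpace M] [ChartedSpace EM M]
    [TopologicalSpace (Arrows M)] [ChartedSpace EG (Arrows M)]

variable (EG) in
/-- The differential at `(g, h)` of the multiplication of composable pairs. Only its values on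
composable tangent vectors are meaningful. -/
noncomputable def dmul {x y z : M} (g : y ⟶ z) (h : x ⟶ y) : EG × EG →L[ℝ] EG :=
  mfderivWithin (𝓘(ℝ, EG).prod 𝓘(ℝ, EG)) 𝓘(ℝ, EG) (fun p : Arrows M × Arrows M => p.1.mul p.2)
    {p | p.1.src = p.2.tgt} (Arrows.of g, Arrows.of h)

variable [IsManifold 𝓘(ℝ, EM) ∞ M] [IsManifold 𝓘(ℝ, EG) ∞ (Arrows M)]
  {x y z : M} {γ δ δ' : ℝ → Arrows M} {v w : EG}

theorem HasVelocity.mul (hG : LieGroupoid EM EG M) {g : y ⟶ z} {h : x ⟶ y}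
    (hδ : HasVelocity EG δ (Arrows.of g) v) (hδ' : HasVelocity EG δ' (Arrows.of h) w)
    (hs : ∀ᶠ τ in 𝓝 0, (δ τ).src = (δ' τ).tgt) :
    HasVelocity EG (fun τ => (δ τ).mul (δ' τ)) (Arrows.of (h ≫ g)) (dmul EG g h (v, w)) := by
  have h_mul : HasMFDerivWithinAt (𝓘(ℝ, EG).prod 𝓘(ℝ, EG)) 𝓘(ℝ, EG)
      (fun p : Arrows M × Arrows M => p.1.mul p.2)
      {p | p.1.src = p.2.tgt} (δ 0, δ' 0) (dmul EG g h) := by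
    rw [hδ.apply_zero, hδ'.apply_zero]
    exact ((hG.contMDiffOn_mul (Arrows.of g, Arrows.of h) rfl).mdifferentiableWithinAt
      (by simp)).hasMFDerivWithinAt
  obtain ⟨hg, D, rfl, hD⟩ := hδ
  obtain ⟨hh, D', rfl, hD'⟩ := hδ'
  have h_comp : HasMFDerivWithinAt 𝓘(ℝ, ℝ) 𝓘(ℝ, EG) (fun τ => (δ τ).mul (δ' τ))
      {τ | (δ τ).src = (δ' τ).tgt} 0 ((dmul EG g h).comp (D.prod D')) :=
    h_mul.comp (0 : ℝ) (hD.prodMk hD').hasMFDerivWithinAt subset_rfl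
  exact ⟨by rw [hg, hh, Arrows.mul_of], _, rfl, h_comp.hasMFDerivAt hs⟩

variable [hG : LieGroupoid EM EG M]

theorem HasVelocity.src {g : x ⟶ y} (hδ : HasVelocity EG δ (Arrows.of g) v) :
    HasVelocity EM (fun τ => (δ τ).src) x (dsrc EM EG g v) :=
  hδ.comp (hG.isSubmersion_src.contMDiff.mdifferentiable (by simp) _)

theorem exists_hasVelocity_algFiber (a : algFiber EM EG x) : ∃ γ : ℝ → Arrows M,
    HasVelocity EG γ (Arrows.unit x) a.1 ∧ ∀ᶠ τ in 𝓝 0, (γ τ).src = x := by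
  obtain ⟨γ, h0, hs, hγ⟩ := submersion_ker hG.isSubmersion_src (Arrows.unit x) a.1 a.2
  exact ⟨γ, ⟨h0, _, one_smul ℝ (a.1 : EG), hγ⟩, hs⟩

theorem HasVelocity.rightTranslate (g : x ⟶ y) {a : algFiber EM EG y}
    (hγ : HasVelocity EG γ (Arrows.unit y) a.1) (hs : ∀ᶠ τ in 𝓝 0, (γ τ).src = y) :
    HasVelocity EG (fun τ => (γ τ).mul (Arrows.of g)) (Arrows.of g)
      (rightTranslation EM EG g a) := by
  have unit_mul : (Arrows.unit y).mul (Arrows.of g) = Arrows.of g := by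
    simpa using Arrows.mul_of (𝟙 y) g
  have h := hγ.comp_hasMFDerivWithinAt
    (mdifferentiableWithinAt_mul hG g (Arrows.unit y) rfl).hasMFDerivWithinAt hs
  rwa [unit_mul] at h

theorem dmul_rightTranslation_zero (g : y ⟶ z) (h : x ⟶ y) (a : algFiber EM EG z) :
    dmul EG g h (rightTranslation EM EG g a, 0) = rightTranslation EM EG (h ≫ g) a := by
  obtain ⟨γ, hγ, hs⟩ := exists_hasVelocity_algFiber a
  refine ((hγ.rightTranslate g hs).mul hG (.const EG (Arrows.of h)) ?_).unique
    (hγ.rightTranslate (h ≫ g) hs) ?_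
  · filter_upwards [hs] with τ hτ using Arrows.src_mul _ _ hτ
  · filter_upwards [hs] with τ hτ using (Arrows.mul_of_mul_of g h hτ).symm

variable [FiniteDimensional ℝ EG]

theorem HasVelocity.inv {g : x ⟶ y} (hδ : HasVelocity EG δ (Arrows.of g) v) :
    HasVelocity EG (fun τ => (δ τ).inv) (Arrows.of (Groupoid.inv g)) (dinv EM EG g v) :=
  hδ.comp (hG.contMDiff_inv.mdifferentiable (by simp) _)

variable (EM EG)

/-- The map `A_x → T_g 𝒢` for an arrow `g : x ⟶ y`: the right translation by the inverse
followed by the inversion. -/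
noncomputable def leftTranslation (g : x ⟶ y) :
    algFiber EM EG x →ₗ[ℝ] TangentSpace 𝓘(ℝ, EG) (Arrows.of g) :=
  (dinv EM EG g).symm.toLinearMap ∘ₗ rightTranslation EM EG (Groupoid.inv g)

/-- The map `dt : T_g 𝒢 → T_y M` for an arrow `g : x ⟶ y`, obtained from `ds` by the inversion. -/
noncomputable def dtgt (g : x ⟶ y) :
    TangentSpace 𝓘(ℝ, EG) (Arrows.of g) →ₗ[ℝ] TangentSpace 𝓘(ℝ, EM) y :=
  dsrc EM EG (Groupoid.inv g) ∘ₗ (dinv EM EG g).toLinearMap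

theorem isAdapted_trans_dinv_symm_iff (g : x ⟶ y) {m n : ℕ} {a : Frame m (algFiber EM EG x)}
    {b : Frame n (TangentSpace 𝓘(ℝ, EM) y)}
    {u : Frame (m + n) (TangentSpace 𝓘(ℝ, EG) (Arrows.of (Groupoid.inv g)))} :
    IsAdapted (leftTranslation EM EG g) (dtgt EM EG g) a b (u.trans (dinv EM EG g).symm) ↔
      IsAdapted (rightTranslation EM EG (Groupoid.inv g)) (dsrc EM EG (Groupoid.inv g)) a b u := by
  simp [IsAdapted, leftTranslation, dtgt]

theorem shortExact_leftTranslation (g : x ⟶ y) :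
    ShortExact (leftTranslation EM EG g) (dtgt EM EG g) := by
  obtain ⟨h_inj, h_exact, h_surj⟩ := shortExact_arrow EM EG (Groupoid.inv g)
  refine ⟨(dinv EM EG g).symm.injective.comp h_inj, fun v => ?_,
    h_surj.comp (dinv EM EG g).surjective⟩
  refine (h_exact (dinv EM EG g v)).trans ⟨?_, ?_⟩
  · rintro ⟨a, ha⟩
    exact ⟨a, (dinv EM EG g).symm_apply_eq.2 ha⟩
  · rintro ⟨a, ha⟩
    exact ⟨a, (dinv EM EG g).symm_apply_eq.1 ha⟩

variable {EM EG}

theorem HasVelocity.tgt {g : x ⟶ y} (hδ : HasVelocity EG δ (Arrows.of g) v) :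
    HasVelocity EM (fun τ => (δ τ).tgt) y (dtgt EM EG g v) :=
  (hδ.inv (EM := EM)).src

theorem HasVelocity.leftTranslate (g : x ⟶ y) {a : algFiber EM EG x}
    (hγ : HasVelocity EG γ (Arrows.unit x) a.1) (hs : ∀ᶠ τ in 𝓝 0, (γ τ).src = x) :
    HasVelocity EG (fun τ => ((γ τ).mul (Arrows.of (Groupoid.inv g))).inv) (Arrows.of g)
      (leftTranslation EM EG g a) := by
  have h_right := hγ.rightTranslate (Groupoid.inv g) hs
  obtain ⟨w, h_inv⟩ : ∃ w : EG, HasVelocity EG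
      (fun τ => ((γ τ).mul (Arrows.of (Groupoid.inv g))).inv) (Arrows.of g) w := by
    have h := h_right.inv (EM := EM)
    rw [show Arrows.of (Groupoid.inv (Groupoid.inv g)) = Arrows.of g from
      Arrows.inv_inv (Arrows.of g)] at h
    exact ⟨_, h⟩
  have h_eq : (dinv EM EG g w : EG) = rightTranslation EM EG (Groupoid.inv g) a :=
    (h_inv.inv (EM := EM)).unique h_right (.of_forall fun _ => (Arrows.inv_inv _).symm)
  rwa [show leftTranslation EM EG g a = w from (dinv EM EG g).symm_apply_eq.2 h_eq.symm]

theorem dmul_zero_leftTranslation (g : y ⟶ z) (h : x ⟶ y) (a : algFiber EM EG x) :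
    dmul EG g h (0, leftTranslation EM EG h a) = leftTranslation EM EG (h ≫ g) a := by
  obtain ⟨γ, hγ, hs⟩ := exists_hasVelocity_algFiber a
  refine ((HasVelocity.const EG (Arrows.of g)).mul hG (hγ.leftTranslate h hs) ?_).unique
    (hγ.leftTranslate (h ≫ g) hs) ?_
  · filter_upwards [hs] with τ hτ
    exact (Arrows.src_mul (γ τ) (Arrows.of (Groupoid.inv h)) hτ).symm
  · filter_upwards [hs] with τ hτ using (Arrows.of_mul_inv g h hτ).symm

theorem dmul_leftTranslation_rightTranslation (g : y ⟶ z) (h : x ⟶ y) (a : algFiber EM EG y) :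
    dmul EG g h (leftTranslation EM EG g a, rightTranslation EM EG h a) = 0 := by
  obtain ⟨γ, hγ, hs⟩ := exists_hasVelocity_algFiber a
  refine ((hγ.leftTranslate g hs).mul hG (hγ.rightTranslate h hs) ?_).unique
    (.const EG (Arrows.of (h ≫ g))) ?_
  · filter_upwards [hs] with τ hτ using (Arrows.tgt_mul hτ).trans (Arrows.tgt_mul hτ).symm
  · filter_upwards [hs] with τ hτ using (Arrows.inv_mul_mul_of g h hτ).symm

theorem dsrc_leftTranslation (g : y ⟶ z) (h : x ⟶ y) (a : algFiber EM EG y) :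
    dsrc EM EG g (leftTranslation EM EG g a) = dtgt EM EG h (rightTranslation EM EG h a) := by
  obtain ⟨γ, hγ, hs⟩ := exists_hasVelocity_algFiber a
  refine HasVelocity.unique (EN := EM) (hγ.leftTranslate g hs).src (hγ.rightTranslate h hs).tgt ?_
  filter_upwards [hs] with τ hτ using (Arrows.tgt_mul hτ).trans (Arrows.tgt_mul hτ).symm

variable (EM EG)

/-- The space of pairs of composable tangent vectors at the composable pair `(g, h)`. -/
noncomputable abbrev composableTangent (g : y ⟶ z) (h : x ⟶ y) :
    Submodule ℝ (TangentSpace 𝓘(ℝ, EG) (Arrows.of g) × TangentSpace 𝓘(ℝ, EG) (Arrows.of h)) :=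
  fiberProd (dsrc EM EG g) (dtgt EM EG h)

/-- The differential at `(g, h)` of the multiplication on composable tangent vectors. -/
noncomputable def dcomp (g : y ⟶ z) (h : x ⟶ y) :
    composableTangent EM EG g h →ₗ[ℝ] TangentSpace 𝓘(ℝ, EG) (Arrows.of (h ≫ g)) :=
  (dmul EG g h).toLinearMap ∘ₗ (composableTangent EM EG g h).subtype

variable {EM EG}

theorem exists_composable_curves {g : y ⟶ z} {h : x ⟶ y} (p : composableTangent EM EG g h) :
    ∃ δ δ' : ℝ → Arrows M, HasVelocity EG δ (Arrows.of g) p.1.1 ∧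
      HasVelocity EG δ' (Arrows.of h) p.1.2 ∧ ∀ᶠ τ in 𝓝 0, (δ τ).src = (δ' τ).tgt := by
  obtain ⟨δ', hδ'⟩ := exists_hasVelocity (EN := EG) (Arrows.of h) p.1.2
  have h_tgt := hδ'.tgt (EM := EM)
  rw [← show dsrc EM EG g p.1.1 = dtgt EM EG h p.1.2 from p.2] at h_tgt
  obtain ⟨δ, hδ, hs⟩ := HasVelocity.exists_lift (p := Arrows.of g)
    (hG.isSubmersion_src.isSubmersionAt _) h_tgt
  exact ⟨δ, δ', hδ, hδ', hs⟩

theorem dsrc_dcomp {g : y ⟶ z} {h : x ⟶ y} (p : composableTangent EM EG g h) :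
    dsrc EM EG (h ≫ g) (dcomp EM EG g h p) = dsrc EM EG h p.1.2 := by
  obtain ⟨δ, δ', hδ, hδ', hs⟩ := exists_composable_curves p
  refine HasVelocity.unique (EN := EM) (hδ.mul hG hδ' hs).src hδ'.src ?_
  filter_upwards [hs] with τ hτ using (Arrows.src_mul _ _ hτ).symm

theorem dtgt_dcomp {g : y ⟶ z} {h : x ⟶ y} (p : composableTangent EM EG g h) :
    dtgt EM EG (h ≫ g) (dcomp EM EG g h p) = dtgt EM EG g p.1.1 := by
  obtain ⟨δ, δ', hδ, hδ', hs⟩ := exists_composable_curves p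
  refine HasVelocity.unique (EN := EM) (hδ.mul hG hδ' hs).tgt hδ.tgt ?_
  filter_upwards [hs] with τ hτ using (Arrows.tgt_mul hτ).symm

end Differentials

section Determinants

variable (EM EG : Type*) {M : Type*} [Groupoid M]
    [NormedAddCommGroup EM] [NormedSpace ℝ EM]
    [NormedAddCommGroup EG] [NormedSpace ℝ EG] [FiniteDimensional ℝ EG]
    [TopologicalSpace M] [ChartedSpace EM M] [IsManifold 𝓘(ℝ, EM) ∞ M]
    [TopologicalSpace (Arrows M)] [ChartedSpace EG (Arrows M)]
    [IsManifold 𝓘(ℝ, EG) ∞ (Arrows M)] [hG : LieGroupoid EM EG M]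

/-- A pair of frames of `A_x` and of `T_x M`: it trivializes the fibre at `x` of every bundle
`L_χ^tr`. -/
abbrev TransverseFrame (x : M) : Type _ :=
  Frame (algRank EM EG) (algFiber EM EG x) ×
    Frame (Module.finrank ℝ EM) (TangentSpace 𝓘(ℝ, EM) x)

variable {EM EG} {x y z : M}

/-- The determinant comparing the two frames of `T_g 𝒢` adapted to the exact sequences
`0 → A_x → T_g 𝒢 → T_y M → 0` and `0 → A_y → T_g 𝒢 → T_x M → 0` that are given by frames of
`A_x`, `T_x M` and `A_y`, `T_y M`. The action of `g` on `L_χ^tr` is, up to sign, multiplication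
by its value under `χ`. -/
noncomputable def arrowDet (g : x ⟶ y) (φ : TransverseFrame EM EG x)
    (ψ : TransverseFrame EM EG y) : ℝˣ :=
  frameDet (exists_isAdapted (shortExact_leftTranslation EM EG g) φ.1 ψ.2).choose
    (exists_isAdapted (shortExact_arrow EM EG g) ψ.1 φ.2).choose

theorem arrowDet_eq {g : x ⟶ y} {φ : TransverseFrame EM EG x} {ψ : TransverseFrame EM EG y}
    {u w : Frame (algRank EM EG + Module.finrank ℝ EM) (TangentSpace 𝓘(ℝ, EG) (Arrows.of g))}
    (hu : IsAdapted (rightTranslation EM EG g) (dsrc EM EG g) ψ.1 φ.2 u)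
    (hw : IsAdapted (leftTranslation EM EG g) (dtgt EM EG g) φ.1 ψ.2 w) :
    arrowDet g φ ψ = frameDet w u := by
  have hw₀ := (exists_isAdapted (shortExact_leftTranslation EM EG g) φ.1 ψ.2).choose_spec
  have hu₀ := (exists_isAdapted (shortExact_arrow EM EG g) ψ.1 φ.2).choose_spec
  rw [arrowDet, ← frameDet_mul _ w, ← frameDet_mul w u, frameDet_isAdapted hw hw₀,
    frameDet_isAdapted hu₀ hu]
  simp

theorem arrowDet_change (g : x ⟶ y) (φ φ' : TransverseFrame EM EG x)
    (ψ ψ' : TransverseFrame EM EG y) :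
    arrowDet g φ ψ = frameDet φ.1 φ'.1 * frameDet ψ.2 ψ'.2 * arrowDet g φ' ψ' *
      (frameDet ψ'.1 ψ.1 * frameDet φ'.2 φ.2) := by
  obtain ⟨u, hu⟩ := exists_isAdapted (shortExact_arrow EM EG g) ψ.1 φ.2
  obtain ⟨w, hw⟩ := exists_isAdapted (shortExact_leftTranslation EM EG g) φ.1 ψ.2
  obtain ⟨u', hu'⟩ := exists_isAdapted (shortExact_arrow EM EG g) ψ'.1 φ'.2
  obtain ⟨w', hw'⟩ := exists_isAdapted (shortExact_leftTranslation EM EG g) φ'.1 ψ'.2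
  rw [arrowDet_eq hu hw, arrowDet_eq hu' hw', ← frameDet_isAdapted hw' hw,
    ← frameDet_isAdapted hu hu', frameDet_mul, frameDet_mul]

theorem arrowDet_comp (h : x ⟶ y) (g : y ⟶ z) (φ : TransverseFrame EM EG x)
    (ψ : TransverseFrame EM EG y) (θ : TransverseFrame EM EG z) :
    arrowDet (h ≫ g) φ θ = (-1) ^ algRank EM EG * arrowDet g ψ θ * arrowDet h φ ψ := by
  obtain ⟨ug, hug⟩ := exists_isAdapted (shortExact_arrow EM EG g) θ.1 ψ.2
  obtain ⟨wg, hwg⟩ := exists_isAdapted (shortExact_leftTranslation EM EG g) ψ.1 θ.2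
  obtain ⟨uh, huh⟩ := exists_isAdapted (shortExact_arrow EM EG h) ψ.1 φ.2
  obtain ⟨wh, hwh⟩ := exists_isAdapted (shortExact_leftTranslation EM EG h) φ.1 ψ.2
  obtain ⟨uk, huk⟩ := exists_isAdapted (shortExact_arrow EM EG (h ≫ g)) θ.1 φ.2
  obtain ⟨wk, hwk⟩ := exists_isAdapted (shortExact_leftTranslation EM EG (h ≫ g)) φ.1 θ.2
  rw [arrowDet_eq hug hwg, arrowDet_eq huh hwh, arrowDet_eq huk hwk]
  let i₁ : algFiber EM EG z →ₗ[ℝ] composableTangent EM EG g h :=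
    fiberProdLift (rightTranslation EM EG g) 0
      (by simpa using (shortExact_arrow EM EG g).comp_eq_zero)
  let i₂ : algFiber EM EG x →ₗ[ℝ] composableTangent EM EG g h :=
    fiberProdLift 0 (leftTranslation EM EG h)
      (by simp [(shortExact_leftTranslation EM EG h).comp_eq_zero])
  let i₃ : algFiber EM EG y →ₗ[ℝ] composableTangent EM EG g h :=
    fiberProdLift (leftTranslation EM EG g) (rightTranslation EM EG h) (dsrc_leftTranslation g h)
  let p₁ := LinearMap.snd ℝ _ _ ∘ₗ (composableTangent EM EG g h).subtype
  let p₂ := LinearMap.fst ℝ _ _ ∘ₗ (composableTangent EM EG g h).subtype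
  let p₃ := dcomp EM EG g h
  have h₁ : ShortExact i₁ p₁ := shortExact_fiberProd_snd (shortExact_arrow EM EG g) _
  have h₂ : ShortExact i₂ p₂ := h₁.of_swap (shortExact_leftTranslation EM EG h)
    (shortExact_arrow EM EG g) (fun _ => rfl) (fun _ => rfl) (fun _ => rfl) fun p => p.2.symm
  have h₃ : ShortExact i₃ p₃ := h₁.of_swap (shortExact_arrow EM EG h)
    (shortExact_arrow EM EG (h ≫ g)) (fun _ => rfl) (dmul_rightTranslation_zero g h)
    (dmul_leftTranslation_rightTranslation g h) fun p => (dsrc_dcomp p).symm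
  exact frameDet_three_filtrations h₁ h₂ h₃
    (shortExact_leftTranslation EM EG h) (shortExact_arrow EM EG h)
    (shortExact_arrow EM EG g) (shortExact_leftTranslation EM EG g)
    (shortExact_arrow EM EG (h ≫ g)) (shortExact_leftTranslation EM EG (h ≫ g))
    (fun _ => rfl) (fun _ => rfl) (fun _ => rfl) (fun _ => rfl)
    (dmul_rightTranslation_zero g h) (dmul_zero_leftTranslation g h)
    (fun p => (dtgt_dcomp p).symm) (fun p => (dsrc_dcomp p).symm) (fun p => p.2.symm)
    hwh huh hug hwg huk hwk

/-- The cocycle through which an arrow acts on the bundles `L_χ^tr`. -/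
noncomputable def arrowCocycle (g : x ⟶ y) (φ : TransverseFrame EM EG x)
    (ψ : TransverseFrame EM EG y) : ℝˣ :=
  (-1) ^ algRank EM EG * arrowDet g φ ψ

theorem arrowCocycle_comp (h : x ⟶ y) (g : y ⟶ z) (φ : TransverseFrame EM EG x)
    (ψ : TransverseFrame EM EG y) (θ : TransverseFrame EM EG z) :
    arrowCocycle (h ≫ g) φ θ = arrowCocycle g ψ θ * arrowCocycle h φ ψ := by
  rw [arrowCocycle, arrowDet_comp h g φ ψ θ, arrowCocycle, arrowCocycle]
  ac_rfl

theorem arrowCocycle_id (φ : TransverseFrame EM EG x) : arrowCocycle (𝟙 x) φ φ = 1 := by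
  simpa using arrowCocycle_comp (𝟙 x) (𝟙 x) φ φ φ

theorem arrowCocycle_inv (g : x ⟶ y) (φ : TransverseFrame EM EG x)
    (ψ : TransverseFrame EM EG y) :
    arrowCocycle (Groupoid.inv g) ψ φ = (arrowCocycle g φ ψ)⁻¹ := by
  rw [eq_inv_iff_mul_eq_one, ← arrowCocycle_comp, Groupoid.comp_inv, arrowCocycle_id]

theorem arrowDet_inv (g : x ⟶ y) (φ : TransverseFrame EM EG x)
    (ψ : TransverseFrame EM EG y) : arrowDet (Groupoid.inv g) ψ φ = (arrowDet g φ ψ)⁻¹ := by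
  have h := arrowCocycle_inv g φ ψ
  rw [arrowCocycle, arrowCocycle, mul_inv, ← inv_pow, inv_neg, inv_one] at h
  exact mul_left_cancel h

variable [FiniteDimensional ℝ EM]

variable (EM EG) in
theorem nonempty_transverseFrame (x : M) : Nonempty (TransverseFrame EM EG x) :=
  nonempty_prod.2 ⟨nonempty_algFrame EM EG x, nonempty_tangentFrame x⟩

/-- The trivialization of the fibre of `L_χ^tr` at `x` given by frames of `A_x` and `T_x M`. -/
noncomputable def trEval (χ : ℝ →*₀ ℝ) [SmoothChar χ] (φ : TransverseFrame EM EG x) :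
    (trLine EM EG χ : LineBundle EM M).Fiber x ≃ₗ[ℝ] ℝ :=
  Line.eval₂ _ _ (dualFrame φ.1) φ.2

theorem trEval_rawAction (χ : ℝ →*₀ ℝ) [SmoothChar χ] (g : x ⟶ y) (φ : TransverseFrame EM EG x)
    (ψ : TransverseFrame EM EG y) (v : (trLine EM EG χ : LineBundle EM M).Fiber x) :
    trEval χ ψ (rawAction EM EG χ x y g v) = χ (arrowDet g φ ψ : ℝˣ) * trEval χ φ v := by
  obtain ⟨u, hu⟩ := exists_isAdapted (shortExact_arrow EM EG g) ψ.1 φ.2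
  obtain ⟨w, hw⟩ := exists_isAdapted (shortExact_arrow EM EG (Groupoid.inv g)) φ.1 ψ.2
  rw [arrowDet_eq hu ((isAdapted_trans_dinv_symm_iff EM EG g).2 hw)]
  exact Line.eval₂_transport χ (shortExact_arrow EM EG g) (shortExact_arrow EM EG (Groupoid.inv g))
    (dinv EM EG g) (nonempty_algFrame EM EG y) (nonempty_tangentFrame x)
    (nonempty_algFrame EM EG x) (nonempty_tangentFrame y) hu hw v

theorem trEval_trAction (χ : ℝ →*₀ ℝ) [SmoothChar χ] (g : x ⟶ y) (φ : TransverseFrame EM EG x)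
    (ψ : TransverseFrame EM EG y) (v : (trLine EM EG χ : LineBundle EM M).Fiber x) :
    trEval χ ψ (trAction EM EG χ x y g v) = χ (arrowCocycle g φ ψ : ℝˣ) * trEval χ φ v := by
  rw [trAction, LinearMap.smul_apply, map_smul, trEval_rawAction χ g φ, arrowCocycle]
  push_cast
  rw [smul_eq_mul, map_mul, mul_assoc]

theorem trAction_id (χ : ℝ →*₀ ℝ) [SmoothChar χ] (x : M) :
    trAction EM EG χ x x (𝟙 x) = LinearMap.id := by
  obtain ⟨φ⟩ := nonempty_transverseFrame EM EG x
  refine LinearMap.ext fun v => (trEval χ φ).injective ?_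
  rw [trEval_trAction χ (𝟙 x) φ, arrowCocycle_id, Units.val_one, map_one, one_mul,
    LinearMap.id_apply]

theorem trAction_comp (χ : ℝ →*₀ ℝ) [SmoothChar χ] (x y z : M) (g : x ⟶ y) (h : y ⟶ z) :
    trAction EM EG χ x z (g ≫ h) = trAction EM EG χ y z h ∘ₗ trAction EM EG χ x y g := by
  obtain ⟨φ⟩ := nonempty_transverseFrame EM EG x
  obtain ⟨ψ⟩ := nonempty_transverseFrame EM EG y
  obtain ⟨θ⟩ := nonempty_transverseFrame EM EG z
  refine LinearMap.ext fun v => (trEval χ θ).injective ?_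
  rw [LinearMap.comp_apply, trEval_trAction χ (g ≫ h) φ, trEval_trAction χ h ψ,
    trEval_trAction χ g φ, arrowCocycle_comp g h φ ψ, Units.val_mul, map_mul, mul_assoc]

end Determinants

section SmoothFields

variable {EP P EN N EB B : Type*} [NormedAddCommGroup EP] [NormedSpace ℝ EP]
  [TopologicalSpace P] [ChartedSpace EP P]
  [NormedAddCommGroup EN] [NormedSpace ℝ EN] [TopologicalSpace N] [ChartedSpace EN N]
  [IsManifold 𝓘(ℝ, EN) ∞ N]

theorem IsSmoothFrameOn.comp [TopologicalSpace B] [NormedAddCommGroup EB] [NormedSpace ℝ EB]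
    [ChartedSpace EB B] {r : ℕ} {V : B → Type*} [∀ x, AddCommGroup (V x)] [∀ x, Module ℝ (V x)]
    {u : B → N} {j : ∀ x, V x →ₗ[ℝ] TangentSpace 𝓘(ℝ, EN) (u x)} {U : Opens B}
    {a : ∀ x, Frame r (V x)} (ha : IsSmoothFrameOn (EM := EB) u j U a) {f : P → B}
    (hf : ContMDiff 𝓘(ℝ, EP) 𝓘(ℝ, EB) ∞ f) :
    IsSmoothFrameOn (EM := EP) (fun x => u (f x)) (fun x => j (f x))
      (Opens.comap ⟨f, hf.continuous⟩ U) fun x => a (f x) :=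
  fun c => (ha c).comp hf.contMDiffOn fun _ hx => hx

theorem contMDiffOn_mfderiv_chart {σ : P → N}
    {e : OpenPartialHomeomorph N EN} (he : e ∈ IsManifold.maximalAtlas 𝓘(ℝ, EN) ∞ N)
    {Y : ∀ q, TangentSpace 𝓘(ℝ, EN) (σ q)} {s : Set P}
    (hY : ContMDiffOn 𝓘(ℝ, EP) (𝓘(ℝ, EN).prod 𝓘(ℝ, EN)) ∞
      (fun q => (⟨σ q, Y q⟩ : TangentBundle 𝓘(ℝ, EN) N)) s) :
    ContMDiffOn 𝓘(ℝ, EP) 𝓘(ℝ, EN) ∞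
      (fun q => (mfderiv 𝓘(ℝ, EN) 𝓘(ℝ, EN) e (σ q) (Y q) : EN)) (s ∩ σ ⁻¹' e.source) := by
  have h_tangentMap := (contMDiffOn_of_mem_maximalAtlas he).contMDiffOn_tangentMapWithin
    (m := ∞) (by simp) e.open_source.uniqueMDiffOn
  have h_comp : ContMDiffOn 𝓘(ℝ, EP) (𝓘(ℝ, EN).prod 𝓘(ℝ, EN)) ∞
      (fun q => (⟨e (σ q), mfderiv 𝓘(ℝ, EN) 𝓘(ℝ, EN) e (σ q) (Y q)⟩ :
        TangentBundle 𝓘(ℝ, EN) EN)) (s ∩ σ ⁻¹' e.source) := by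
    refine (h_tangentMap.comp (hY.mono inter_subset_left) fun q hq => hq.2).congr fun q hq => ?_
    simp only [Function.comp, tangentMapWithin]
    rw [mfderivWithin_of_isOpen e.open_source hq.2]
  intro q hq
  simpa using (contMDiffWithinAt_totalSpace.1 (h_comp q hq)).2

theorem contMDiffOn_add_smul {a w : P → EN} {s : Set P}
    (ha : ContMDiffOn 𝓘(ℝ, EP) 𝓘(ℝ, EN) ∞ a s) (hw : ContMDiffOn 𝓘(ℝ, EP) 𝓘(ℝ, EN) ∞ w s) :
    ContMDiffOn (𝓘(ℝ, EP).prod 𝓘(ℝ, ℝ)) 𝓘(ℝ, EN) ∞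
      (fun q : P × ℝ => a q.1 + q.2 • w q.1) (Prod.fst ⁻¹' s) :=
  (ha.comp contMDiff_fst.contMDiffOn fun _ hq => hq).add
    (contMDiff_snd.contMDiffOn.smul (hw.comp contMDiff_fst.contMDiffOn fun _ hq => hq))

end SmoothFields

section Submersions

universe u

variable {EP P EB B : Type*} {EN : Type u} {N : Type*} [NormedAddCommGroup EP] [NormedSpace ℝ EP]
  [TopologicalSpace P] [ChartedSpace EP P]
  [NormedAddCommGroup EN] [NormedSpace ℝ EN] [TopologicalSpace N] [ChartedSpace EN N]
  [IsManifold 𝓘(ℝ, EN) ∞ N]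
  [NormedAddCommGroup EB] [NormedSpace ℝ EB] [TopologicalSpace B] [ChartedSpace EB B]

theorem exists_smooth_lift_frame [FiniteDimensional ℝ EB] {f : N → B}
    (hf : Manifold.IsSubmersion 𝓘(ℝ, EN) 𝓘(ℝ, EB) ∞ f) (p : N) :
    ∃ (O : Opens N) (X : ∀ q, (Fin (Module.finrank ℝ EB) → ℝ) →ₗ[ℝ] TangentSpace 𝓘(ℝ, EN) q)
      (b : ∀ q, Frame (Module.finrank ℝ EB) (TangentSpace 𝓘(ℝ, EB) (f q))),
      p ∈ O ∧ (∀ d, ContMDiffOn 𝓘(ℝ, EN) (𝓘(ℝ, EN).prod 𝓘(ℝ, EN)) ∞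
        (fun q => (⟨q, X q d⟩ : TangentBundle 𝓘(ℝ, EN) N)) O) ∧
      ∀ q ∈ O, ∀ d, mfderiv 𝓘(ℝ, EN) 𝓘(ℝ, EB) f q (X q d) = b q d := by
  obtain ⟨F, _, _, l, e, -, he, hp, -, hD⟩ := submersion_local hf p
  let β : Frame (Module.finrank ℝ EB) EB := (Module.finBasis ℝ EB).equivFun.symm
  let X (q : N) : (Fin (Module.finrank ℝ EB) → ℝ) →ₗ[ℝ] EN :=
    (mfderiv 𝓘(ℝ, EN) 𝓘(ℝ, EN) e.symm (e q) : EN →L[ℝ] EN).toLinearMap ∘ₗ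
      l.symm.toLinearEquiv.toLinearMap ∘ₗ LinearMap.inl ℝ EB F ∘ₗ β.toLinearMap
  have exists_frame (q : N) : ∃ b : Frame (Module.finrank ℝ EB) (TangentSpace 𝓘(ℝ, EB) (f q)),
      q ∈ e.source → ∀ d, mfderiv 𝓘(ℝ, EN) 𝓘(ℝ, EB) f q (X q d) = b d := by
    by_cases hq : q ∈ e.source
    · obtain ⟨D, hD⟩ := hD _ (e.map_source hq)
      rw [e.left_inv hq] at hD
      refine ⟨β.trans D.toLinearEquiv, fun _ d => (hD (l.symm (β d, 0))).trans ?_⟩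
      rw [l.apply_symm_apply]
      rfl
    · exact ⟨β, fun h => absurd h hq⟩
  choose b hb using exists_frame
  refine ⟨⟨e.source, e.open_source⟩, X, b, hp, fun d => ?_, hb⟩
  refine (contMDiffOn_chart_field (u := (id : N → N)) contMDiff_id he (l.symm (β d, 0))).congr ?_
  exact fun q hq => TotalSpace.ext (e.left_inv hq).symm (heq_of_eq rfl)

theorem exists_smooth_vertical_curves {f : N → B}
    (hf : Manifold.IsSubmersion 𝓘(ℝ, EN) 𝓘(ℝ, EB) ∞ f) {σ : P → N}
    (hσ : ContMDiff 𝓘(ℝ, EP) 𝓘(ℝ, EN) ∞ σ) {Y : ∀ q, TangentSpace 𝓘(ℝ, EN) (σ q)} {s : Set P}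
    (hs : IsOpen s) (hY : ContMDiffOn 𝓘(ℝ, EP) (𝓘(ℝ, EN).prod 𝓘(ℝ, EN)) ∞
      (fun q => (⟨σ q, Y q⟩ : TangentBundle 𝓘(ℝ, EN) N)) s)
    (hfY : ∀ q ∈ s, mfderiv 𝓘(ℝ, EN) 𝓘(ℝ, EB) f (σ q) (Y q) = 0) {p : P} (hp : p ∈ s) :
    ∃ (Ω : Set (P × ℝ)) (Φ : P × ℝ → N), IsOpen Ω ∧ (p, 0) ∈ Ω ∧
      ContMDiffOn (𝓘(ℝ, EP).prod 𝓘(ℝ, ℝ)) 𝓘(ℝ, EN) ∞ Φ Ω ∧ (∀ q ∈ Ω, f (Φ q) = f (σ q.1)) ∧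
      ∀ q, (q, 0) ∈ Ω → HasVelocity EN (fun τ => Φ (q, τ)) (σ q) (Y q) := by
  obtain ⟨F, _, _, l, e, k, he, hpe, hk, hD⟩ := submersion_local hf (σ p)
  have e_diff := mdifferentiable_of_mem_maximalAtlas he
  let O : Set P := s ∩ σ ⁻¹' e.source
  have hO : IsOpen O := hs.inter (e.open_source.preimage hσ.continuous)
  let w : P → EN := fun q => mfderiv 𝓘(ℝ, EN) 𝓘(ℝ, EN) e (σ q) (Y q)
  have w_vertical : ∀ q ∈ O, (l (w q)).1 = 0 := by
    intro q hq
    obtain ⟨D, hD⟩ := hD _ (e.map_source hq.2)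
    have hw : (mfderiv 𝓘(ℝ, EN) 𝓘(ℝ, EN) e.symm (e (σ q)) (w q) : EN) = Y q :=
      DFunLike.congr_fun (e_diff.symm_comp_deriv hq.2) (Y q)
    have h := hD (w q)
    rw [hw, e.left_inv hq.2] at h
    exact D.map_eq_zero_iff.1 (h.symm.trans (hfY q hq.1))
  let θ : P × ℝ → EN := fun q => e (σ q.1) + q.2 • w q.1
  have hθ : ContMDiffOn (𝓘(ℝ, EP).prod 𝓘(ℝ, ℝ)) 𝓘(ℝ, EN) ∞ θ (Prod.fst ⁻¹' O) :=
    contMDiffOn_add_smul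
      ((contMDiffOn_of_mem_maximalAtlas he).comp hσ.contMDiffOn fun q hq => hq.2)
      (contMDiffOn_mfderiv_chart he hY)
  have hθ₀ (q : P) : θ (q, 0) = e (σ q) := by simp [θ]
  refine ⟨Prod.fst ⁻¹' O ∩ θ ⁻¹' e.target, fun q => e.symm (θ q),
    hθ.continuousOn.isOpen_inter_preimage (hO.preimage continuous_fst) e.open_target,
    ⟨⟨hp, hpe⟩, ?_⟩, ?_, ?_, ?_⟩
  · rw [mem_preimage, hθ₀]
    exact e.map_source hpe
  · exact (contMDiffOn_symm_of_mem_maximalAtlas he).comp (hθ.mono inter_subset_left)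
      fun q hq => hq.2
  · rintro ⟨q, τ⟩ ⟨hq, hqτ⟩
    have h_fst : (l (θ (q, τ))).1 = (l (e (σ q))).1 := by simp [θ, w_vertical q hq]
    rw [hk _ hqτ, h_fst, ← hk _ (e.map_source hq.2), e.left_inv hq.2]
  · exact fun q hq =>
      HasVelocity.symm_comp (p := σ q) (v := Y q) e_diff hq.1.2
        (HasVelocity.add_smul (e (σ q)) (w q))

end Submersions

section VelocityFields

variable {EP P EB B : Type*} [NormedAddCommGroup EP] [NormedSpace ℝ EP]
  [TopologicalSpace P] [ChartedSpace EP P] [IsManifold 𝓘(ℝ, EP) ∞ P]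
  [NormedAddCommGroup EB] [NormedSpace ℝ EB] [TopologicalSpace B] [ChartedSpace EB B]
  [IsManifold 𝓘(ℝ, EB) ∞ B]

theorem contMDiffOn_of_hasVelocity {Φ : P × ℝ → B} {Ω : Set (P × ℝ)} (hΩ : IsOpen Ω)
    (hΦ : ContMDiffOn (𝓘(ℝ, EP).prod 𝓘(ℝ, ℝ)) 𝓘(ℝ, EB) ∞ Φ Ω) {σ : P → B}
    {Y : ∀ q, TangentSpace 𝓘(ℝ, EB) (σ q)}
    (hY : ∀ q, (q, 0) ∈ Ω → HasVelocity EB (fun τ => Φ (q, τ)) (σ q) (Y q)) :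
    ContMDiffOn 𝓘(ℝ, EP) (𝓘(ℝ, EB).prod 𝓘(ℝ, EB)) ∞
      (fun q => (⟨σ q, Y q⟩ : TangentBundle 𝓘(ℝ, EB) B)) {q | (q, 0) ∈ Ω} := by
  have hΩ₀ : IsOpen {q : P | (q, (0 : ℝ)) ∈ Ω} := hΩ.preimage (by fun_prop)
  intro p hp
  have hΦp : ContMDiffAt (𝓘(ℝ, EP).prod 𝓘(ℝ, ℝ)) 𝓘(ℝ, EB) ∞
      (Function.uncurry fun q τ => Φ (q, τ)) (p, 0) := hΦ.contMDiffAt (hΩ.mem_nhds hp)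
  have h_unit : ContMDiffAt 𝓘(ℝ, EP) (𝓘(ℝ, ℝ).prod 𝓘(ℝ, ℝ)) ∞
      (fun _ => (⟨0, 1⟩ : TangentBundle 𝓘(ℝ, ℝ) ℝ)) p := contMDiffAt_const
  have h_deriv := ContMDiffWithinAt.clm_apply_of_inCoordinates (s := univ)
    (ϕ := fun q => mfderiv 𝓘(ℝ, ℝ) 𝓘(ℝ, EB) (fun τ => Φ (q, τ)) 0)
    (hΦp.mfderiv (m := ∞) (fun q τ => Φ (q, τ)) (fun _ => 0) contMDiffAt_const (by simp))
    h_unit (hΦp.comp p (contMDiffAt_id.prodMk contMDiffAt_const))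
  refine (ContMDiffWithinAt.contMDiffAt h_deriv Filter.univ_mem).congr_of_eventuallyEq ?_
    |>.contMDiffWithinAt
  filter_upwards [hΩ₀.mem_nhds hp] with q hq
  obtain ⟨h_zero, D, hD, h_mfderiv⟩ := hY q hq
  refine TotalSpace.ext h_zero.symm (heq_of_eq ?_)
  rw [h_mfderiv.mfderiv]
  exact hD.symm

end VelocityFields

section RightInvariantFields

variable {EM EG M : Type*} [Groupoid M]
    [NormedAddCommGroup EM] [NormedSpace ℝ EM] [NormedAddCommGroup EG] [NormedSpace ℝ EG]
    [TopologicalSpace M] [ChartedSpace EM M]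
    [TopologicalSpace (Arrows M)] [ChartedSpace EG (Arrows M)]
    [IsManifold 𝓘(ℝ, EM) ∞ M] [IsManifold 𝓘(ℝ, EG) ∞ (Arrows M)] [hG : LieGroupoid EM EG M]

/-- The section is realized by curves in the source fibres which depend smoothly on the unit, and
these can be multiplied with the arrows. -/
theorem contMDiffOn_rightTranslation {U : Opens M} {Y : ∀ y : M, algFiber EM EG y}
    (hY : ContMDiffOn 𝓘(ℝ, EM) (𝓘(ℝ, EG).prod 𝓘(ℝ, EG)) ∞
      (fun y => (⟨Arrows.unit y, (Y y).1⟩ : TangentBundle 𝓘(ℝ, EG) (Arrows M))) U) :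
    ContMDiffOn 𝓘(ℝ, EG) (𝓘(ℝ, EG).prod 𝓘(ℝ, EG)) ∞
      (fun g : Arrows M => (⟨g, rightTranslation EM EG g.hom (Y g.tgt)⟩ :
        TangentBundle 𝓘(ℝ, EG) (Arrows M))) (Arrows.tgt ⁻¹' (U : Set M)) := by
  intro g₀ hg₀
  obtain ⟨Ω, Φ, hΩ, hg₀Ω, hΦ, h_src, hΦY⟩ := exists_smooth_vertical_curves hG.isSubmersion_src
    hG.contMDiff_unit U.isOpen hY (fun y _ => (Y y).2) hg₀
  let Ω' : Set (Arrows M × ℝ) := Prod.map Arrows.tgt id ⁻¹' Ω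
  have h_tgt : ContMDiff (𝓘(ℝ, EG).prod 𝓘(ℝ, ℝ)) (𝓘(ℝ, EM).prod 𝓘(ℝ, ℝ)) ∞
      (Prod.map Arrows.tgt id : Arrows M × ℝ → M × ℝ) := hG.contMDiff_tgt.prodMap contMDiff_id
  have hΩ' : IsOpen Ω' := hΩ.preimage h_tgt.continuous
  have h_mul : ContMDiffOn (𝓘(ℝ, EG).prod 𝓘(ℝ, ℝ)) 𝓘(ℝ, EG) ∞
      (fun q : Arrows M × ℝ => (Φ (q.1.tgt, q.2)).mul q.1) Ω' :=
    hG.contMDiffOn_mul.comp ((hΦ.comp h_tgt.contMDiffOn fun _ hq => hq).prodMk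
      contMDiff_fst.contMDiffOn) fun q hq => h_src _ hq
  refine ((contMDiffOn_of_hasVelocity hΩ' h_mul fun g hg => ?_) |>.contMDiffAt
    ((hΩ'.preimage (by fun_prop)).mem_nhds hg₀Ω)).contMDiffWithinAt
  refine (hΦY g.tgt hg).rightTranslate g.hom ?_
  have h_mem : ∀ᶠ τ : ℝ in 𝓝 0, (g.tgt, τ) ∈ Ω :=
    (hΩ.preimage (by fun_prop : Continuous fun τ : ℝ => (g.tgt, τ))).mem_nhds hg
  filter_upwards [h_mem] with τ hτ using h_src _ hτ

end RightInvariantFields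

section SmoothFrames

variable {EM EG M : Type*} [Groupoid M]
    [NormedAddCommGroup EM] [NormedSpace ℝ EM]
    [NormedAddCommGroup EG] [NormedSpace ℝ EG] [FiniteDimensional ℝ EG]
    [TopologicalSpace M] [ChartedSpace EM M]
    [TopologicalSpace (Arrows M)] [ChartedSpace EG (Arrows M)]
    [IsManifold 𝓘(ℝ, EM) ∞ M] [IsManifold 𝓘(ℝ, EG) ∞ (Arrows M)] [hG : LieGroupoid EM EG M]

theorem dinv_symm_apply {x y : M} (g : x ⟶ y)
    (v : TangentSpace 𝓘(ℝ, EG) (Arrows.of (Groupoid.inv g))) :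
    (dinv EM EG g).symm v =
      mfderiv 𝓘(ℝ, EG) 𝓘(ℝ, EG) Arrows.inv (Arrows.of (Groupoid.inv g)) v := by
  obtain ⟨γ, hγ⟩ := exists_hasVelocity (EN := EG) (Arrows.of g) ((dinv EM EG g).symm v)
  have h_inv := hγ.inv (EM := EM)
  rw [show dinv EM EG g ((dinv EM EG g).symm v) = v from
    (dinv EM EG g).apply_symm_apply v] at h_inv
  exact hγ.unique (h_inv.inv (EM := EM)) (.of_forall fun _ => Arrows.inv_inv _)

theorem IsSmoothFrameOn.trans_dinv_symm {n : ℕ} {O : Opens (Arrows M)}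
    {u : ∀ g : Arrows M, Frame n (TangentSpace 𝓘(ℝ, EG) g)}
    (hu : IsSmoothFrameOn (EM := EG) id (fun _ => LinearMap.id) O u) :
    IsSmoothFrameOn (EM := EG) id (fun _ => LinearMap.id)
      (Opens.comap ⟨Arrows.inv, (hG.contMDiff_inv).continuous⟩ O)
      (fun g : Arrows M => (u g.inv).trans (dinv EM EG g.hom).symm) := by
  intro c
  refine (((hG.contMDiff_inv.contMDiff_tangentMap (m := ∞) (by simp)).comp_contMDiffOn
    (hu c)).comp hG.contMDiff_inv.contMDiffOn fun _ hg => hg).congr fun g _ => ?_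
  exact TotalSpace.ext (Arrows.inv_inv g).symm
    (heq_of_eq (dinv_symm_apply (EM := EM) g.hom (u g.inv c)))

variable [FiniteDimensional ℝ EM]

theorem exists_smooth_adapted_frame {U : Opens M}
    {a : ∀ y : M, Frame (algRank EM EG) (algFiber EM EG y)}
    (ha : IsSmoothFrameOn (EM := EM) Arrows.unit (fun x => (algFiber EM EG x).subtype) U a)
    {g₀ : Arrows M} (hg₀ : g₀.tgt ∈ U) : ∃ (O : Opens (Arrows M))
      (u : ∀ g : Arrows M, Frame (algRank EM EG + Module.finrank ℝ EM) (TangentSpace 𝓘(ℝ, EG) g))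
      (b : ∀ g : Arrows M, Frame (Module.finrank ℝ EM) (TangentSpace 𝓘(ℝ, EM) g.src)),
      g₀ ∈ O ∧ IsSmoothFrameOn (EM := EG) id (fun _ => LinearMap.id) O u ∧
      IsSmoothFrameOn (EM := EG) Arrows.src (fun _ => LinearMap.id) O b ∧
      ∀ g ∈ O, IsAdapted (rightTranslation EM EG g.hom) (dsrc EM EG g.hom) (a g.tgt) (b g)
        (u g) := by
  obtain ⟨O, X, b, hO, hX, h_dsrc⟩ := exists_smooth_lift_frame hG.isSubmersion_src g₀
  have exists_frame (g : Arrows M) :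
      ∃ u : Frame (algRank EM EG + Module.finrank ℝ EM) (TangentSpace 𝓘(ℝ, EG) g), g ∈ O →
        IsAdapted (rightTranslation EM EG g.hom) (dsrc EM EG g.hom) (a g.tgt) (b g) u ∧
        ∀ c d, u (Fin.append c d) = rightTranslation EM EG g.hom (a g.tgt c) + X g d := by
    by_cases hg : g ∈ O
    · obtain ⟨u, hu⟩ := exists_isAdapted_append (shortExact_arrow EM EG g.hom) (a g.tgt) (b g)
        (X g) (h_dsrc g hg)
      exact ⟨u, fun _ => hu⟩
    · exact ⟨(exists_isAdapted (shortExact_arrow EM EG g.hom) (a g.tgt) (b g)).choose,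
        fun h => absurd h hg⟩
  choose u hu using exists_frame
  refine ⟨O ⊓ Opens.comap ⟨Arrows.tgt, hG.contMDiff_tgt.continuous⟩ U, u, b, ⟨hO, hg₀⟩,
    fun c => ?_, fun d => ?_, fun g hg => (hu g hg.1).1⟩
  · obtain ⟨c, d, rfl⟩ := exists_eq_append c
    have h_right := (contMDiffOn_rightTranslation (Y := fun y => a y c) (ha c)).mono
      (inter_subset_right (s := (O : Set (Arrows M))))
    refine (h_right.add_section ((hX d).mono inter_subset_left)).congr fun g hg => ?_
    exact TotalSpace.ext rfl (heq_of_eq ((hu g hg.1).2 c d))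
  · refine ((hG.isSubmersion_src.contMDiff.contMDiff_tangentMap (m := ∞)
      (by simp)).comp_contMDiffOn ((hX d).mono inter_subset_left)).congr fun g hg => ?_
    exact TotalSpace.ext rfl (heq_of_eq (h_dsrc g hg.1 d).symm)

variable (EM EG) in
/-- The frames of `A_x` and of `T_x M` that make up `φ x` depend smoothly on `x ∈ U`. -/
def IsSmoothTransverseFrameOn (U : Opens M) (φ : ∀ x : M, TransverseFrame EM EG x) : Prop :=
  IsSmoothFrameOn (EM := EM) Arrows.unit (fun x => (algFiber EM EG x).subtype) U
      (fun x => (φ x).1) ∧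
    IsSmoothFrameOn (EM := EM) id (fun _ => LinearMap.id) U fun x => (φ x).2

theorem contMDiffOn_arrowDet {U U' : Opens M} {φ ψ : ∀ x : M, TransverseFrame EM EG x}
    (hφ : IsSmoothTransverseFrameOn EM EG U φ) (hψ : IsSmoothTransverseFrameOn EM EG U' ψ) :
    ContMDiffOn 𝓘(ℝ, EG) 𝓘(ℝ, ℝ) ∞
      (fun g : Arrows M => (arrowDet g.hom (φ g.src) (ψ g.tgt) : ℝ))
      {g | g.src ∈ U ∧ g.tgt ∈ U'} := by
  rintro g₀ ⟨h_src, h_tgt⟩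
  obtain ⟨O, u, b, hO, hu, hb, hub⟩ := exists_smooth_adapted_frame hψ.1 h_tgt
  obtain ⟨O', w, d, hO', hw, hd, hwd⟩ :=
    exists_smooth_adapted_frame (g₀ := g₀.inv) hφ.1 h_src
  have h_det := contMDiffOn_det (fun _ => Function.injective_id)
    (hw.trans_dinv_symm (EM := EM)) hu
  have h_det_tgt := contMDiffOn_det (fun _ => Function.injective_id)
    (hψ.2.comp hG.contMDiff_tgt) (hd.comp hG.contMDiff_inv)
  have h_det_src := contMDiffOn_det (fun _ => Function.injective_id) hb
    (hφ.2.comp hG.isSubmersion_src.contMDiff)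
  have h_smooth :=
    ((h_det_tgt.contMDiffAt ((Opens.isOpen _ |>.inter (Opens.isOpen _)).mem_nhds ⟨h_tgt, hO'⟩)).mul
      (h_det.contMDiffAt ((Opens.isOpen _ |>.inter (Opens.isOpen _)).mem_nhds ⟨hO', hO⟩))).mul
      (h_det_src.contMDiffAt ((Opens.isOpen _ |>.inter (Opens.isOpen _)).mem_nhds ⟨hO, h_src⟩))
  refine (h_smooth.congr_of_eventuallyEq ?_).contMDiffWithinAt
  filter_upwards [O.isOpen.mem_nhds hO,
    (O'.isOpen.preimage hG.contMDiff_inv.continuous).mem_nhds hO'] with g hg hg'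
  rw [arrowDet_change g.hom (φ g.src) ((φ g.src).1, b g) (ψ g.tgt) ((ψ g.tgt).1, d g.inv),
    arrowDet_eq (hub g hg) ((isAdapted_trans_dinv_symm_iff EM EG g.hom).2 (hwd g.inv hg'))]
  simp only [frameDet_self, one_mul, Units.val_mul]
  rfl

end SmoothFrames

section SmoothMaps

theorem coord_apply_eq {V : Type*} [AddCommGroup V] [Module ℝ V] (φ : V ≃ₗ[ℝ] ℝ)
    (l : V →ₗ[ℝ] ℝ) (v : V) : l v = l (φ.symm 1) * φ v := by
  have h : v = φ v • φ.symm 1 := by rw [← map_smul, smul_eq_mul, mul_one, φ.symm_apply_apply]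
  conv_lhs => rw [h, map_smul, smul_eq_mul, mul_comm]

variable {EM M : Type*} [NormedAddCommGroup EM] [NormedSpace ℝ EM] [TopologicalSpace M]
  [ChartedSpace EM M] {EP HP P : Type*} [NormedAddCommGroup EP] [NormedSpace ℝ EP]
  [TopologicalSpace HP] {I : ModelWithCorners ℝ EP HP} [TopologicalSpace P] [ChartedSpace HP P]

theorem LineBundle.contMDiffAt_coord_change (L : LineBundle EM M) {f : P → TotalSpace ℝ L.Fiber}
    {p : P} {φ ψ : Opens M × ∀ x, L.Fiber x ≃ₗ[ℝ] ℝ} (hφ : φ ∈ L.triv) (hψ : ψ ∈ L.triv)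
    (hpφ : (f p).1 ∈ φ.1) (hpψ : (f p).1 ∈ ψ.1)
    (h_base : ContMDiffAt I 𝓘(ℝ, EM) ∞ (fun q => (f q).1) p)
    (h : ContMDiffAt I 𝓘(ℝ, ℝ) ∞ (fun q => φ.2 (f q).1 (f q).2) p) :
    ContMDiffAt I 𝓘(ℝ, ℝ) ∞ (fun q => ψ.2 (f q).1 (f q).2) p := by
  have h_transition := ((L.contMDiffOn_transition φ hφ ψ hψ).contMDiffAt (x := (f p).1)
    ((φ.1.isOpen.inter ψ.1.isOpen).mem_nhds ⟨hpφ, hpψ⟩)).comp p h_base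
  exact (h_transition.mul h).congr_of_eventuallyEq
    (.of_forall fun q => coord_apply_eq (φ.2 (f q).1) (ψ.2 (f q).1).toLinearMap _)

theorem LineBundle.contMDiffAt_iff (L : LineBundle EM M) {f : P → TotalSpace ℝ L.Fiber} {p : P}
    {φ : Opens M × ∀ x, L.Fiber x ≃ₗ[ℝ] ℝ} (hφ : φ ∈ L.triv) (hp : (f p).1 ∈ φ.1) :
    ContMDiffAt I (𝓘(ℝ, EM).prod 𝓘(ℝ, ℝ)) ∞ f p ↔
      ContMDiffAt I 𝓘(ℝ, EM) ∞ (fun q => (f q).1) p ∧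
        ContMDiffAt I 𝓘(ℝ, ℝ) ∞ (fun q => φ.2 (f q).1 (f q).2) p := by
  obtain ⟨hψ, hpψ⟩ := (L.exists_mem_triv (f p).1).choose_spec
  refine contMDiffAt_totalSpace.trans (and_congr_right fun h_base => ?_)
  exact ⟨L.contMDiffAt_coord_change hψ hφ hpψ hp h_base,
    L.contMDiffAt_coord_change hφ hψ hp hpψ h_base⟩

theorem LineBundle.contMDiffAt_coord (L : LineBundle EM M) {φ : Opens M × ∀ x, L.Fiber x ≃ₗ[ℝ] ℝ}
    (hφ : φ ∈ L.triv) {p : TotalSpace ℝ L.Fiber} (hp : p.1 ∈ φ.1) :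
    ContMDiffAt (𝓘(ℝ, EM).prod 𝓘(ℝ, ℝ)) 𝓘(ℝ, ℝ) ∞
      (fun q : TotalSpace ℝ L.Fiber => φ.2 q.1 q.2) p :=
  ((L.contMDiffAt_iff hφ hp).1 contMDiffAt_id).2

theorem isBundleIso_of_coord_eq {L L' : LineBundle EM M} {Φ : ∀ x, L.Fiber x ≃ₗ[ℝ] L'.Fiber x}
    (h : ∀ x₀, ∃ φ ∈ L.triv, ∃ ψ ∈ L'.triv, x₀ ∈ φ.1 ∧ x₀ ∈ ψ.1 ∧
      ∀ x v, ψ.2 x (Φ x v) = φ.2 x v) : IsBundleIso Φ where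
  contMDiff p := by
    obtain ⟨φ, hφ, ψ, hψ, hpφ, hpψ, hΦ⟩ := h p.1
    rw [L'.contMDiffAt_iff hψ hpψ]
    simp only [hΦ]
    exact ⟨contMDiffAt_proj L.Fiber, L.contMDiffAt_coord hφ hpφ⟩
  contMDiff_symm p := by
    obtain ⟨φ, hφ, ψ, hψ, hpφ, hpψ, hΦ⟩ := h p.1
    rw [L.contMDiffAt_iff hφ hpφ]
    simp only [← hΦ, LinearEquiv.apply_symm_apply]
    exact ⟨contMDiffAt_proj L'.Fiber, L'.contMDiffAt_coord hψ hpψ⟩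

end SmoothMaps

section SmoothActions

theorem coord_tensorMap {V V' W W' : Type*} [AddCommGroup V] [Module ℝ V] [AddCommGroup V']
    [Module ℝ V'] [AddCommGroup W] [Module ℝ W] [AddCommGroup W'] [Module ℝ W'] (φ : V ≃ₗ[ℝ] ℝ)
    (φ' : V' ≃ₗ[ℝ] ℝ) (ψ : W ≃ₗ[ℝ] ℝ) (ψ' : W' ≃ₗ[ℝ] ℝ) (A : V →ₗ[ℝ] W) (A' : V' →ₗ[ℝ] W') :
    (TensorProduct.congr ψ ψ' ≪≫ₗ TensorProduct.lid ℝ ℝ) (TensorProduct.map A A'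
      ((TensorProduct.congr φ φ' ≪≫ₗ TensorProduct.lid ℝ ℝ).symm 1)) =
    ψ (A (φ.symm 1)) * ψ' (A' (φ'.symm 1)) := by
  simp

theorem coord_dualMap {V W : Type*} [AddCommGroup V] [Module ℝ V] [AddCommGroup W] [Module ℝ W]
    (φ : V ≃ₗ[ℝ] ℝ) (ψ : W ≃ₗ[ℝ] ℝ) (A : V →ₗ[ℝ] W) :
    (φ.symm.dualMap ≪≫ₗ LinearMap.ringLmapEquivSelf ℝ ℝ ℝ) (A.dualMap
      ((ψ.symm.dualMap ≪≫ₗ LinearMap.ringLmapEquivSelf ℝ ℝ ℝ).symm 1)) = ψ (A (φ.symm 1)) := by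
  simp

theorem Intertwines.symm {EM M : Type*} [Groupoid M] [NormedAddCommGroup EM] [NormedSpace ℝ EM]
    [TopologicalSpace M] [ChartedSpace EM M] {L L' : LineBundle EM M} {ρ : ArrowMaps L}
    {ρ' : ArrowMaps L'} {Φ : ∀ x, L.Fiber x ≃ₗ[ℝ] L'.Fiber x} (h : Intertwines ρ ρ' Φ) :
    Intertwines ρ' ρ fun x => (Φ x).symm := fun x y g v => by
  rw [LinearEquiv.symm_apply_eq, h, LinearEquiv.apply_symm_apply]

variable {EM EG M : Type*} [Groupoid M]
    [NormedAddCommGroup EM] [NormedSpace ℝ EM] [NormedAddCommGroup EG] [NormedSpace ℝ EG]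
    [TopologicalSpace M] [ChartedSpace EM M]
    [TopologicalSpace (Arrows M)] [ChartedSpace EG (Arrows M)]
    {L L' : LineBundle EM M} {ρ : ArrowMaps L} {ρ' : ArrowMaps L'}

variable (EG) in
/-- Around every arrow, the maps `ρ` are multiplication by a smooth function in suitable local
trivializations of `L`; this expresses the smoothness of `s^* L → L` on the manifold of arrows. -/
def HasSmoothCoordinates (ρ : ArrowMaps L) : Prop :=
  ∀ g₀ : Arrows M, ∃ φ ∈ L.triv, ∃ ψ ∈ L.triv, g₀.src ∈ φ.1 ∧ g₀.tgt ∈ ψ.1 ∧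
    ContMDiffAt 𝓘(ℝ, EG) 𝓘(ℝ, ℝ) ∞
      (fun g : Arrows M => ψ.2 g.tgt (ρ g.src g.tgt g.hom ((φ.2 g.src).symm 1))) g₀

theorem HasSmoothCoordinates.tensor (h : HasSmoothCoordinates EG ρ)
    (h' : HasSmoothCoordinates EG ρ') : HasSmoothCoordinates EG (ArrowMaps.tensor ρ ρ') := by
  intro g₀
  obtain ⟨φ, hφ, ψ, hψ, hs, ht, hρ⟩ := h g₀
  obtain ⟨φ', hφ', ψ', hψ', hs', ht', hρ'⟩ := h' g₀
  refine ⟨_, ⟨φ, hφ, φ', hφ', rfl⟩, _, ⟨ψ, hψ, ψ', hψ', rfl⟩, ⟨hs, hs'⟩, ⟨ht, ht'⟩, ?_⟩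
  refine (hρ.mul hρ').congr_of_eventuallyEq (.of_forall fun g => ?_)
  exact coord_tensorMap _ _ _ _ _ _

variable (EM EG M) in
theorem hasSmoothCoordinates_trivial : HasSmoothCoordinates EG (ArrowMaps.trivial EM M) :=
  fun _ => ⟨_, rfl, _, rfl, trivial, trivial, contMDiffAt_const (c := (1 : ℝ))⟩

variable [IsManifold 𝓘(ℝ, EM) ∞ M] [IsManifold 𝓘(ℝ, EG) ∞ (Arrows M)] {hG : LieGroupoid EM EG M}

theorem HasSmoothCoordinates.dual (hG : LieGroupoid EM EG M) (h : HasSmoothCoordinates EG ρ) :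
    HasSmoothCoordinates EG (ArrowMaps.dual ρ) := by
  intro g₀
  obtain ⟨φ, hφ, ψ, hψ, hs, ht, hρ⟩ := h g₀.inv
  refine ⟨_, ⟨ψ, hψ, rfl⟩, _, ⟨φ, hφ, rfl⟩, ht, hs, ?_⟩
  refine (hρ.comp g₀ hG.contMDiff_inv.contMDiffAt).congr_of_eventuallyEq (.of_forall fun g => ?_)
  exact coord_dualMap _ _ _

theorem HasSmoothCoordinates.isRepresentation (h : HasSmoothCoordinates EG ρ)
    (h_id : ∀ x, ρ x x (𝟙 x) = LinearMap.id)
    (h_comp : ∀ (x y z : M) (g : x ⟶ y) (h : y ⟶ z), ρ x z (g ≫ h) = ρ y z h ∘ₗ ρ x y g) :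
    IsRepresentation hG ρ := by
  refine ⟨h_id, h_comp, fun p => ?_⟩
  obtain ⟨φ, hφ, ψ, hψ, hs, ht, hρ⟩ := h p.1
  have h_proj : ContMDiffAt (𝓘(ℝ, EG).prod 𝓘(ℝ, ℝ)) 𝓘(ℝ, EG) ∞
      (fun q : TotalSpace ℝ ((srcMap hG : Arrows M → M) *ᵖ L.Fiber) => q.1) p :=
    contMDiffAt_proj _
  have h_lift : ContMDiffAt (𝓘(ℝ, EG).prod 𝓘(ℝ, ℝ)) (𝓘(ℝ, EM).prod 𝓘(ℝ, ℝ)) ∞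
      (fun q : TotalSpace ℝ ((srcMap hG : Arrows M → M) *ᵖ L.Fiber) =>
        (⟨q.1.src, q.2⟩ : TotalSpace ℝ L.Fiber)) p :=
    contMDiffAt_totalSpace.2 ⟨hG.isSubmersion_src.contMDiff.contMDiffAt.comp p h_proj,
      (contMDiffAt_totalSpace.1 (contMDiffAt_id (x := p))).2⟩
  have h_coord := ((L.contMDiffAt_iff hφ hs).1 h_lift).2
  refine (L.contMDiffAt_iff hψ ht).2 ⟨hG.contMDiff_tgt.contMDiffAt.comp p h_proj, ?_⟩
  exact ((hρ.comp p h_proj).mul h_coord).congr_of_eventuallyEq (.of_forall fun q =>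
    coord_apply_eq (φ.2 q.1.src) ((ψ.2 q.1.tgt).toLinearMap ∘ₗ ρ q.1.src q.1.tgt q.1.hom) q.2)

theorem IsRepresentation.hasSmoothCoordinates (h : IsRepresentation hG ρ) :
    HasSmoothCoordinates EG ρ := by
  intro g₀
  obtain ⟨φ, hφ, hs⟩ := L.exists_mem_triv g₀.src
  obtain ⟨ψ, hψ, ht⟩ := L.exists_mem_triv g₀.tgt
  have h_section : ContMDiffAt 𝓘(ℝ, EG) (𝓘(ℝ, EM).prod 𝓘(ℝ, ℝ)) ∞
      (fun g : Arrows M => (⟨g.src, (φ.2 g.src).symm 1⟩ : TotalSpace ℝ L.Fiber)) g₀ := by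
    refine (L.contMDiffAt_iff hφ hs).2 ⟨hG.isSubmersion_src.contMDiff.contMDiffAt, ?_⟩
    simp only [LinearEquiv.apply_symm_apply]
    exact contMDiffAt_const
  have h_pullback : ContMDiffAt 𝓘(ℝ, EG) (𝓘(ℝ, EG).prod 𝓘(ℝ, ℝ)) ∞
      (fun g : Arrows M => (⟨g, (φ.2 g.src).symm 1⟩ :
        TotalSpace ℝ ((srcMap hG : Arrows M → M) *ᵖ L.Fiber))) g₀ :=
    contMDiffAt_totalSpace.2 ⟨contMDiffAt_id, (contMDiffAt_totalSpace.1 h_section).2⟩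
  exact ⟨φ, hφ, ψ, hψ, hs, ht, ((L.contMDiffAt_iff hψ ht).1
    (h.contMDiff.contMDiffAt.comp g₀ h_pullback)).2⟩

theorem IsRepresentation.tensor (h : IsRepresentation hG ρ) (h' : IsRepresentation hG ρ') :
    IsRepresentation hG (ArrowMaps.tensor ρ ρ') := by
  refine (h.hasSmoothCoordinates.tensor h'.hasSmoothCoordinates).isRepresentation
    (fun x => ?_) (fun x y z g k => ?_)
  · simp only [ArrowMaps.tensor, h.map_id, h'.map_id]
    exact TensorProduct.map_id
  · simp only [ArrowMaps.tensor, h.map_comp, h'.map_comp]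
    exact TensorProduct.map_comp _ _ _ _

theorem IsRepresentation.dual (h : IsRepresentation hG ρ) :
    IsRepresentation hG (ArrowMaps.dual ρ) := by
  refine (h.hasSmoothCoordinates.dual hG).isRepresentation (fun x => ?_) (fun x y z g k => ?_)
  · have h_inv : Groupoid.inv (𝟙 x) = 𝟙 x := by simp [Groupoid.inv_eq_inv]
    simp only [ArrowMaps.dual, h_inv, h.map_id]
    exact LinearMap.dualMap_id
  · have h_inv : Groupoid.inv (g ≫ k) = Groupoid.inv k ≫ Groupoid.inv g := by
      simp [Groupoid.inv_eq_inv]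
    simp only [ArrowMaps.dual, h_inv, h.map_comp]
    exact (LinearMap.dualMap_comp_dualMap _ _).symm

variable (EM M) in
theorem isRepresentation_trivial (hG : LieGroupoid EM EG M) :
    IsRepresentation hG (ArrowMaps.trivial EM M) :=
  (hasSmoothCoordinates_trivial EM EG M).isRepresentation (fun _ => rfl) (fun _ _ _ _ _ => rfl)

theorem IsRepresentationIso.symm {Φ : ∀ x, L.Fiber x ≃ₗ[ℝ] L'.Fiber x}
    (h : IsRepresentationIso hG ρ ρ' Φ) : IsRepresentationIso hG ρ' ρ fun x => (Φ x).symm where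
  left := h.right
  right := h.left
  isBundleIso := ⟨h.isBundleIso.contMDiff_symm, h.isBundleIso.contMDiff⟩
  intertwines := h.intertwines.symm

end SmoothActions

section Products

variable {m n : ℕ} {V W : Type*} [AddCommGroup V] [Module ℝ V] [AddCommGroup W] [Module ℝ W]

theorem Line.constIso_eq_eval (hV : Nonempty (Frame m V)) (e : Frame m V) :
    Line.constIso hV = Line.eval 1 e :=
  LinearEquiv.ext fun ξ => Line.constIso_apply hV ξ e

theorem Line.mulIso_trans_eval₂ {δ δ' δ'' : GLr m →* ℝˣ} (h : δ * δ' = δ'')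
    {ε ε' ε'' : GLr n →* ℝˣ} (h' : ε * ε' = ε'') (hV : Nonempty (Frame m V))
    (hW : Nonempty (Frame n W)) (e : Frame m V) (f : Frame n W) :
    TensorProduct.tensorTensorTensorComm ℝ (Line δ V) (Line ε W) (Line δ' V) (Line ε' W) ≪≫ₗ
        TensorProduct.congr (Line.mulIso h hV) (Line.mulIso h' hW) ≪≫ₗ Line.eval₂ δ'' ε'' e f =
      TensorProduct.congr (Line.eval₂ δ ε e f) (Line.eval₂ δ' ε' e f) ≪≫ₗ
        TensorProduct.lid ℝ ℝ := by
  refine LinearEquiv.toLinearMap_injective (TensorProduct.ext_fourfold' fun α β α' β' => ?_)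
  simp only [LinearEquiv.coe_coe, LinearEquiv.trans_apply, TensorProduct.congr_tmul,
    TensorProduct.tensorTensorTensorComm_tmul, Line.eval₂_tmul, TensorProduct.lid_tmul, smul_eq_mul]
  exact mul_mul_mul_comm (α.1 e) (α'.1 e) (β.1 f) (β'.1 f)

theorem Line.mulIso_constIso_trans_lid {δ δ' : GLr m →* ℝˣ} (h : δ * δ' = 1)
    {ε ε' : GLr n →* ℝˣ} (h' : ε * ε' = 1) (hV : Nonempty (Frame m V)) (hW : Nonempty (Frame n W))
    (e : Frame m V) (f : Frame n W) :
    TensorProduct.tensorTensorTensorComm ℝ (Line δ V) (Line ε W) (Line δ' V) (Line ε' W) ≪≫ₗ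
        TensorProduct.congr (Line.mulIso h hV ≪≫ₗ Line.constIso hV)
          (Line.mulIso h' hW ≪≫ₗ Line.constIso hW) ≪≫ₗ TensorProduct.lid ℝ ℝ =
      TensorProduct.congr (Line.eval₂ δ ε e f) (Line.eval₂ δ' ε' e f) ≪≫ₗ
        TensorProduct.lid ℝ ℝ := by
  rw [← Line.mulIso_trans_eval₂ h h' hV hW e f, Line.constIso_eq_eval hV e,
    Line.constIso_eq_eval hW f, TensorProduct.congr_trans]
  rfl

end Products

section TransverseLines

variable {EM EG M : Type*} [Groupoid M]
    [NormedAddCommGroup EM] [NormedSpace ℝ EM] [NormedAddCommGroup EG] [NormedSpace ℝ EG]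
    [TopologicalSpace M] [ChartedSpace EM M]
    [TopologicalSpace (Arrows M)] [ChartedSpace EG (Arrows M)]
    [IsManifold 𝓘(ℝ, EM) ∞ M] [IsManifold 𝓘(ℝ, EG) ∞ (Arrows M)] [hG : LieGroupoid EM EG M]
    [FiniteDimensional ℝ EG] [FiniteDimensional ℝ EM]
    {χ ψ κ : ℝ →*₀ ℝ} [SmoothChar χ] [SmoothChar ψ] [SmoothChar κ] {x y : M}

theorem trMulIso_trans_trEval (h : χ * ψ = κ) (φ : TransverseFrame EM EG x) :
    trMulIso EM EG h x ≪≫ₗ trEval κ φ =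
      TensorProduct.congr (trEval χ φ) (trEval ψ φ) ≪≫ₗ TensorProduct.lid ℝ ℝ :=
  Line.mulIso_trans_eval₂ (detChar_mul h _) (detChar_mul h _) (nonempty_dualAlgFrame EM EG x)
    (nonempty_tangentFrame x) (dualFrame φ.1) φ.2

theorem orientationSquareIso_eq (φ : TransverseFrame EM EG x) :
    orientationSquareIso EM EG M x =
      TensorProduct.congr (trEval signChar φ) (trEval signChar φ) ≪≫ₗ TensorProduct.lid ℝ ℝ :=
  Line.mulIso_constIso_trans_lid ((detChar_mul signChar_mul_signChar _).trans (detChar_one _))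
    ((detChar_mul signChar_mul_signChar _).trans (detChar_one _)) (nonempty_dualAlgFrame EM EG x)
    (nonempty_tangentFrame x) (dualFrame φ.1) φ.2

theorem trEval_trMulIso_tmul (h : χ * ψ = κ) (φ : TransverseFrame EM EG x)
    (v : (trLine EM EG χ : LineBundle EM M).Fiber x)
    (w : (trLine EM EG ψ : LineBundle EM M).Fiber x) :
    trEval κ φ (trMulIso EM EG h x (v ⊗ₜ[ℝ] w)) = trEval χ φ v * trEval ψ φ w :=
  LinearEquiv.congr_fun (trMulIso_trans_trEval h φ) (v ⊗ₜ w)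

theorem orientationSquareIso_tmul (φ : TransverseFrame EM EG x)
    (v w : (trLine EM EG signChar : LineBundle EM M).Fiber x) :
    (orientationSquareIso EM EG M x (v ⊗ₜ[ℝ] w) : ℝ) =
      trEval signChar φ v * trEval signChar φ w :=
  LinearEquiv.congr_fun (orientationSquareIso_eq φ) (v ⊗ₜ w)

variable (EM EG) in
theorem exists_isSmoothTransverseFrameOn (x₀ : M) :
    ∃ (U : Opens M) (φ : ∀ x : M, TransverseFrame EM EG x),
      x₀ ∈ U ∧ IsSmoothTransverseFrameOn EM EG U φ := by
  obtain ⟨U, a, hU, ha⟩ := exists_smoothFrame_alg EM EG x₀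
  obtain ⟨V, b, hV, hb⟩ := exists_smoothFrame_tangent (EM := EM) x₀
  exact ⟨U ⊓ V, fun x => (a x, b x), ⟨hU, hV⟩, fun c => (ha c).mono inter_subset_left,
    fun c => (hb c).mono inter_subset_right⟩

theorem IsSmoothTransverseFrameOn.trEval_mem_triv {U : Opens M}
    {φ : ∀ x : M, TransverseFrame EM EG x} (hφ : IsSmoothTransverseFrameOn EM EG U φ)
    (χ : ℝ →*₀ ℝ) [SmoothChar χ] :
    (U, fun x => trEval χ (φ x)) ∈ (trLine EM EG χ : LineBundle EM M).triv :=
  ⟨(U, fun x => Line.eval _ (dualFrame (φ x).1)), ⟨_, hφ.1, rfl⟩,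
    (U, fun x => Line.eval _ (φ x).2), ⟨_, hφ.2, rfl⟩, Prod.ext (inf_idem U).symm rfl⟩

theorem hasSmoothCoordinates_trAction (χ : ℝ →*₀ ℝ) [hχ : SmoothChar χ] :
    HasSmoothCoordinates EG (trAction EM EG χ : ArrowMaps (trLine EM EG χ : LineBundle EM M)) := by
  intro g₀
  obtain ⟨U, φ, hU, hφ⟩ := exists_isSmoothTransverseFrameOn EM EG g₀.src
  obtain ⟨U', ψ, hU', hψ⟩ := exists_isSmoothTransverseFrameOn EM EG g₀.tgt
  refine ⟨_, hφ.trEval_mem_triv χ, _, hψ.trEval_mem_triv χ, hU, hU', ?_⟩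
  have h_nhds : {g : Arrows M | g.src ∈ U ∧ g.tgt ∈ U'} ∈ 𝓝 g₀ :=
    ((U.isOpen.preimage hG.isSubmersion_src.contMDiff.continuous).inter
      (U'.isOpen.preimage hG.contMDiff_tgt.continuous)).mem_nhds ⟨hU, hU'⟩
  have h_cocycle : ContMDiffAt 𝓘(ℝ, EG) 𝓘(ℝ, ℝ) ∞
      (fun g : Arrows M => (arrowCocycle g.hom (φ g.src) (ψ g.tgt) : ℝ)) g₀ := by
    simp only [arrowCocycle, Units.val_mul]
    exact contMDiffAt_const.mul ((contMDiffOn_arrowDet hφ hψ).contMDiffAt h_nhds)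
  have h_char : ContMDiffAt 𝓘(ℝ, ℝ) 𝓘(ℝ, ℝ) ∞ χ (arrowCocycle g₀.hom (φ g₀.src) (ψ g₀.tgt) : ℝ) :=
    (hχ.contDiffOn.contDiffAt (isOpen_compl_singleton.mem_nhds (Units.ne_zero _))).contMDiffAt
  refine (h_char.comp g₀ h_cocycle).congr_of_eventuallyEq (.of_forall fun g => ?_)
  refine (trEval_trAction χ g.hom (φ g.src) (ψ g.tgt) _).trans ?_
  rw [LinearEquiv.apply_symm_apply, mul_one]
  rfl

theorem isRepresentation_trAction (χ : ℝ →*₀ ℝ) [SmoothChar χ] :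
    IsRepresentation hG (trAction EM EG χ : ArrowMaps (trLine EM EG χ : LineBundle EM M)) :=
  (hasSmoothCoordinates_trAction χ).isRepresentation (trAction_id χ) (trAction_comp χ)

theorem isBundleIso_trMulIso (h : χ * ψ = κ) :
    IsBundleIso (EM := EM) (M := M) (trMulIso EM EG h) :=
  isBundleIso_of_coord_eq fun x₀ =>
    have ⟨_, φ, hU, hφ⟩ := exists_isSmoothTransverseFrameOn EM EG x₀
    ⟨_, ⟨_, hφ.trEval_mem_triv χ, _, hφ.trEval_mem_triv ψ, rfl⟩, _, hφ.trEval_mem_triv κ,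
      ⟨hU, hU⟩, hU, fun x => LinearEquiv.congr_fun (trMulIso_trans_trEval h (φ x))⟩

theorem isBundleIso_orientationSquareIso :
    IsBundleIso (EM := EM) (M := M) (orientationSquareIso EM EG M) :=
  isBundleIso_of_coord_eq fun x₀ =>
    have ⟨_, φ, hU, hφ⟩ := exists_isSmoothTransverseFrameOn EM EG x₀
    ⟨_, ⟨_, hφ.trEval_mem_triv signChar, _, hφ.trEval_mem_triv signChar, rfl⟩, _, rfl,
      ⟨hU, hU⟩, trivial, fun x => LinearEquiv.congr_fun (orientationSquareIso_eq (φ x))⟩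

theorem isBundleIso_orientationDualIso :
    IsBundleIso (EM := EM) (M := M) (orientationDualIso EM EG M) := by
  refine isBundleIso_of_coord_eq fun x₀ => ?_
  obtain ⟨_, φ, hU, hφ⟩ := exists_isSmoothTransverseFrameOn EM EG x₀
  refine ⟨_, hφ.trEval_mem_triv signChar, _, ⟨_, hφ.trEval_mem_triv signChar, rfl⟩, hU, hU,
    fun x v => ?_⟩
  refine (orientationSquareIso_tmul (φ x) v ((trEval signChar (φ x)).symm 1)).trans ?_
  rw [LinearEquiv.apply_symm_apply, mul_one]

end TransverseLines

section Equivariance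

variable {EM EG M : Type*} [Groupoid M]
    [NormedAddCommGroup EM] [NormedSpace ℝ EM] [NormedAddCommGroup EG] [NormedSpace ℝ EG]
    [TopologicalSpace M] [ChartedSpace EM M]
    [TopologicalSpace (Arrows M)] [ChartedSpace EG (Arrows M)]
    [IsManifold 𝓘(ℝ, EM) ∞ M] [IsManifold 𝓘(ℝ, EG) ∞ (Arrows M)] [hG : LieGroupoid EM EG M]
    [FiniteDimensional ℝ EG] [FiniteDimensional ℝ EM]

/-- In transverse frames, the maps `ρ` of the bundle `L_χ^tr` are multiplication by the values of
`χ` on `D`. The isomorphisms between the bundles `L_χ^tr` commute with families of such maps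
because `D` does not depend on `χ`. -/
def IsMultiplicationBy (χ : ℝ →*₀ ℝ) [SmoothChar χ]
    (ρ : ArrowMaps (trLine EM EG χ : LineBundle EM M))
    (D : ∀ x y : M, (x ⟶ y) → TransverseFrame EM EG x → TransverseFrame EM EG y → ℝˣ) : Prop :=
  ∀ (x y : M) (g : x ⟶ y) (φ : TransverseFrame EM EG x) (ψ : TransverseFrame EM EG y)
    (v : (trLine EM EG χ : LineBundle EM M).Fiber x),
    trEval χ ψ (ρ x y g v) = χ (D x y g φ ψ : ℝˣ) * trEval χ φ v

variable {χ ψ κ : ℝ →*₀ ℝ} [SmoothChar χ] [SmoothChar ψ] [SmoothChar κ]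
  {D : ∀ x y : M, (x ⟶ y) → TransverseFrame EM EG x → TransverseFrame EM EG y → ℝˣ}

theorem isMultiplicationBy_rawAction (χ : ℝ →*₀ ℝ) [SmoothChar χ] :
    IsMultiplicationBy χ (rawAction EM EG χ : ArrowMaps (trLine EM EG χ : LineBundle EM M))
      fun _ _ g => arrowDet g :=
  fun _ _ g => trEval_rawAction χ g

theorem isMultiplicationBy_trAction (χ : ℝ →*₀ ℝ) [SmoothChar χ] :
    IsMultiplicationBy χ (trAction EM EG χ : ArrowMaps (trLine EM EG χ : LineBundle EM M))
      fun _ _ g => arrowCocycle g :=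
  fun _ _ g => trEval_trAction χ g

theorem intertwines_trMulIso (h : χ * ψ = κ)
    {ρ : ArrowMaps (trLine EM EG χ : LineBundle EM M)}
    {ρ' : ArrowMaps (trLine EM EG ψ : LineBundle EM M)}
    {ρ'' : ArrowMaps (trLine EM EG κ : LineBundle EM M)} (hρ : IsMultiplicationBy χ ρ D)
    (hρ' : IsMultiplicationBy ψ ρ' D) (hρ'' : IsMultiplicationBy κ ρ'' D) :
    Intertwines (ArrowMaps.tensor ρ ρ') ρ'' (trMulIso EM EG h) := fun x y g => by
  obtain ⟨φ⟩ := nonempty_transverseFrame EM EG x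
  obtain ⟨θ⟩ := nonempty_transverseFrame EM EG y
  refine LinearMap.congr_fun (f := (trMulIso EM EG h y).toLinearMap ∘ₗ ArrowMaps.tensor ρ ρ' x y g)
    (g := ρ'' x y g ∘ₗ (trMulIso EM EG h x).toLinearMap)
    (TensorProduct.ext' fun v w => (trEval κ θ).injective ?_)
  calc trEval κ θ (trMulIso EM EG h y (ρ x y g v ⊗ₜ[ℝ] ρ' x y g w))
      = (χ (D x y g φ θ : ℝˣ) * trEval χ φ v) * (ψ (D x y g φ θ : ℝˣ) * trEval ψ φ w) := by
        rw [trEval_trMulIso_tmul, hρ x y g φ θ, hρ' x y g φ θ]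
    _ = κ (D x y g φ θ : ℝˣ) * (trEval χ φ v * trEval ψ φ w) := by
        rw [mul_mul_mul_comm, ← h]
        rfl
    _ = trEval κ θ (ρ'' x y g (trMulIso EM EG h x (v ⊗ₜ[ℝ] w))) := by
        rw [hρ'' x y g φ θ, trEval_trMulIso_tmul]

theorem signChar_mul_self (c : ℝˣ) : signChar (c : ℝ) * signChar (c : ℝ) = 1 :=
  (DFunLike.congr_fun signChar_mul_signChar (c : ℝ)).trans
    (MonoidWithZeroHom.one_apply_of_ne_zero c.ne_zero)

variable {ρ : ArrowMaps (trLine EM EG signChar : LineBundle EM M)}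

theorem intertwines_orientationSquareIso (hρ : IsMultiplicationBy signChar ρ D) :
    Intertwines (ArrowMaps.tensor ρ ρ) (ArrowMaps.trivial EM M)
      (orientationSquareIso EM EG M) := fun x y g => by
  obtain ⟨φ⟩ := nonempty_transverseFrame EM EG x
  obtain ⟨ψ⟩ := nonempty_transverseFrame EM EG y
  refine LinearMap.congr_fun
    (f := (orientationSquareIso EM EG M y).toLinearMap ∘ₗ ArrowMaps.tensor ρ ρ x y g)
    (g := (orientationSquareIso EM EG M x).toLinearMap) (TensorProduct.ext' fun v w => ?_)
  refine (orientationSquareIso_tmul ψ _ _).trans (.trans ?_ (orientationSquareIso_tmul φ v w).symm)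
  rw [hρ x y g φ ψ, hρ x y g φ ψ, mul_mul_mul_comm, signChar_mul_self, one_mul]

theorem intertwines_orientationDualIso (hρ : IsMultiplicationBy signChar ρ D)
    (hD : ∀ (x y : M) (g : x ⟶ y) φ ψ, D y x (Groupoid.inv g) ψ φ = (D x y g φ ψ)⁻¹) :
    Intertwines ρ (ArrowMaps.dual ρ) (orientationDualIso EM EG M) := fun x y g v => by
  obtain ⟨φ⟩ := nonempty_transverseFrame EM EG x
  obtain ⟨ψ⟩ := nonempty_transverseFrame EM EG y
  have h_inv : signChar (D y x (Groupoid.inv g) ψ φ : ℝˣ) = signChar (D x y g φ ψ : ℝˣ) := by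
    rw [hD, Units.val_inv_eq_inv_val, map_inv₀, inv_eq_of_mul_eq_one_left (signChar_mul_self _)]
  refine LinearMap.ext fun w => ?_
  refine (orientationSquareIso_tmul ψ (ρ x y g v) w).trans
    (.trans ?_ (orientationSquareIso_tmul φ v (ρ y x (Groupoid.inv g) w)).symm)
  rw [hρ x y g φ ψ, hρ y x (Groupoid.inv g) ψ φ, h_inv, mul_assoc, mul_left_comm]

theorem isRepresentationIso_trMulIso (h : χ * ψ = κ) :
    IsRepresentationIso hG (ArrowMaps.tensor (trAction EM EG χ) (trAction EM EG ψ))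
      (trAction EM EG κ) (trMulIso EM EG h) where
  left := (isRepresentation_trAction χ).tensor (isRepresentation_trAction ψ)
  right := isRepresentation_trAction κ
  isBundleIso := isBundleIso_trMulIso h
  intertwines := intertwines_trMulIso h (isMultiplicationBy_trAction χ)
    (isMultiplicationBy_trAction ψ) (isMultiplicationBy_trAction κ)

theorem isRepresentationIso_orientationSquareIso :
    IsRepresentationIso hG (ArrowMaps.tensor (trAction EM EG signChar) (trAction EM EG signChar))
      (ArrowMaps.trivial EM M) (orientationSquareIso EM EG M) where
  left := (isRepresentation_trAction signChar).tensor (isRepresentation_trAction signChar)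
  right := isRepresentation_trivial EM M hG
  isBundleIso := isBundleIso_orientationSquareIso
  intertwines := intertwines_orientationSquareIso (isMultiplicationBy_trAction signChar)

theorem isRepresentationIso_orientationDualIso :
    IsRepresentationIso hG (trAction EM EG signChar) (ArrowMaps.dual (trAction EM EG signChar))
      (orientationDualIso EM EG M) where
  left := isRepresentation_trAction signChar
  right := (isRepresentation_trAction signChar).dual
  isBundleIso := isBundleIso_orientationDualIso
  intertwines := intertwines_orientationDualIso (isMultiplicationBy_trAction signChar)
    fun _ _ => arrowCocycle_inv

theorem intertwines_rawAction_trMulIso (h : χ * ψ = κ) :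
    Intertwines (ArrowMaps.tensor (rawAction EM EG χ) (rawAction EM EG ψ)) (rawAction EM EG κ)
      (trMulIso EM EG h : ∀ _ : M, _) :=
  intertwines_trMulIso h (isMultiplicationBy_rawAction χ) (isMultiplicationBy_rawAction ψ)
    (isMultiplicationBy_rawAction κ)

end Equivariance

end TransverseBundles

open TransverseBundles in
theorem mainTheorem7 {EM EG M : Type*} [Groupoid M]
    [NormedAddCommGroup EM] [NormedSpace ℝ EM] [FiniteDimensional ℝ EM]
    [NormedAddCommGroup EG] [NormedSpace ℝ EG] [FiniteDimensional ℝ EG]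
    [TopologicalSpace M] [ChartedSpace EM M] [IsManifold 𝓘(ℝ, EM) ∞ M]
    [TopologicalSpace (Arrows M)] [ChartedSpace EG (Arrows M)] [IsManifold 𝓘(ℝ, EG) ∞ (Arrows M)]
    [hG : LieGroupoid EM EG M] :
    -- the canonical isomorphisms are isomorphisms of representations
    (IsRepresentationIso hG (trAction EM EG absChar)
        (ArrowMaps.tensor (trAction EM EG idChar) (trAction EM EG signChar)) (densityIso EM EG M) ∧
      IsRepresentationIso hG (trAction EM EG idChar)
        (ArrowMaps.tensor (trAction EM EG absChar) (trAction EM EG signChar)) (volumeIso EM EG M) ∧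
      IsRepresentationIso hG (ArrowMaps.tensor (trAction EM EG signChar) (trAction EM EG signChar))
        (ArrowMaps.trivial EM M) (orientationSquareIso EM EG M) ∧
      IsRepresentationIso hG (trAction EM EG signChar)
        (ArrowMaps.dual (trAction EM EG signChar)) (orientationDualIso EM EG M)) ∧
    -- they also commute with the transformations without the sign `χ((-1)^r)`
    (Intertwines (rawAction EM EG absChar)
        (ArrowMaps.tensor (rawAction EM EG idChar) (rawAction EM EG signChar)) (densityIso EM EG M) ∧
      Intertwines (rawAction EM EG idChar)
        (ArrowMaps.tensor (rawAction EM EG absChar) (rawAction EM EG signChar)) (volumeIso EM EG M) ∧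
      Intertwines (ArrowMaps.tensor (rawAction EM EG signChar) (rawAction EM EG signChar))
        (ArrowMaps.trivial EM M) (orientationSquareIso EM EG M) ∧
      Intertwines (rawAction EM EG signChar)
        (ArrowMaps.dual (rawAction EM EG signChar)) (orientationDualIso EM EG M)) :=
  ⟨⟨(isRepresentationIso_trMulIso idChar_mul_signChar).symm,
      (isRepresentationIso_trMulIso absChar_mul_signChar).symm,
      isRepresentationIso_orientationSquareIso, isRepresentationIso_orientationDualIso⟩,
    (intertwines_rawAction_trMulIso idChar_mul_signChar).symm,
    (intertwines_rawAction_trMulIso absChar_mul_signChar).symm,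
    intertwines_orientationSquareIso (isMultiplicationBy_rawAction signChar),
    intertwines_orientationDualIso (isMultiplicationBy_rawAction signChar) fun _ _ => arrowDet_inv⟩
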